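/- Let $P,T>0$ and $\mathbb T_P=[-P/2,P/2]^3$; "periodic" means $P$-periodic in each coordinate of $x\in\mathbb R^3$. Let $u_0\in L^2(\mathbb T_P;\mathbb R^3)$ and $f\in L^2([0,T)\times\mathbb T_P;\mathbb R^3)$ be periodic in $x$. Test functions are the smooth functions of $(t,x)$ that are periodic in $x$ and vanish for all $t\ge T'$, for some $T'<T$ (no condition at $t=0$). For $\mu>0$, a *periodic Leray–Hopf weak solution* of the Navier–Stokes equations $$\partial_t u+\nabla\cdot(u\otimes u)+\nabla p=\mu\Delta u+f,\qquad \nabla\cdot u=0,\qquad u|_{t=0}=u_0$$ on $[0,T)$ is a pair $(u,p)$, periodic in $x$, such that $u\in L^2(0,T;H^1(\mathbb T_P))\cap C([0,T];L^2_w(\mathbb T_P))$ (i.e. bounded in $L^2$ and weakly continuous in time), $p$ and $(\tfrac12|u|^2+p)u$ are integrable on $[0,T)\times\mathbb T_P$, $\nabla\cdot u=0$ in the sense of distributions, for every test function $\psi$ and $i=1,2,3$ $$\int_0^T\!\!\int_{\mathbb T_P}\Big(u_i\partial_t\psi+\sum_j u_iu_j\partial_j\psi+p\,\partial_i\psi+\mu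 u_i\Delta\psi+f_i\psi\Big)dx\,dt+\int_{\mathbb T_P}u_{0,i}\,\psi(0,\cdot)\,dx=0,\qquad(1)$$ and the local energy inequality $$\partial_t(\tfrac12|u|^2)+\nabla\cdot\big(u(\tfrac12|u|^2+p)\big)+\mu|\nabla u|^2-\mu\Delta(\tfrac12|u|^2)\le f\cdot u$$ holds in the sense of distributions on $[0,T)\times\mathbb R^3$ with initial value $\tfrac12|u_0|^2$ (i.e. tested with nonnegative test functions, including the initial term). A *periodic weak solution of the Euler equations with data $u_0$ and pressure $p$* is a pair $(u,p)$, periodic in $x$, with $u\in L^2$ and $p\in L^1$ on $[0,T)\times\mathbb T_P$, $\nabla\cdot u=0$ in the sense of distributions, and (1) with $\mu=0$. Let $S\subset(0,\infty)$ and, for $\mu\in S$, let $(u^\mu,p^\mu)$ be a periodic Leray–Hopf weak solution with viscosity $\mu$, force $f$ and data $u_0$ (the same for all $\mu$). Assume (K41w): there are $\beta>0$, $C>0$ and $k_*$, independent of $\mu$, such that for all $\mu\in S$ and all $\mathbf k\in\frac{2\pi}{P}\mathbb Z^3$ with $|\mathbf k|\ge k_*$ $$|\mathbf k|^{3+\beta}\int_0^T|\hat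 u^\mu(t,\mathbf k)|^2\,dt\le C,\qquad \hat u^\mu(t,\mathbf k)=\frac1{P^3}\int_{\mathbb T_P}u^\mu(t,x)e^{-i\mathbf k\cdot x}\,dx .$$ Then there is $q>2$ such that $u^\mu\in L^2\cap L^q([0,T)\times\mathbb T_P)$ for all $\mu\in S$, and $(u^\mu)$ is strongly precompact in $L^2\cap L^q([0,T)\times\mathbb T_P)$ as $\mu\to0$: every sequence $\mu_n\to0$ in $S$ has a subsequence along which $u^{\mu_n}$ converges, in $L^2\cap L^q([0,T)\times\mathbb T_P)$ and almost everywhere, to some $u\in L^2\cap L^q([0,T)\times\mathbb T_P)$ which, together with a pressure function $p$, is a periodic weak solution of the Euler equations with force $f$ and data $u_0$. Moreover (for a suitable representative of $u$), for all $t\in[0,T)$, $u(t)\in L^2(\mathbb T_P)$ and $$\int_{\mathbb T_P}|u(t,x)|^2dx\le\int_{\mathbb T_P}|u_0(x)|^2dx+2\int_0^t\int_{\mathbb T_P}u(s,x)\cdot f(s,x)\,dx\,ds .$$ -/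

import Mathlib

open MeasureTheory Set Filter Topology
open scoped ContDiff ENNReal

namespace InviscidLimit

noncomputable section

/-- Three-dimensional Euclidean space. -/
abbrev E3 : Type := EuclideanSpace ℝ (Fin 3)

/-- The `j`-th canonical basis vector. -/
abbrev basisVec (j : Fin 3) : E3 := EuclideanSpace.single j (1 : ℝ)

/-- Functions on `ℝ³` that are periodic with period `P` in every coordinate direction. -/
def IsPeriodic {α : Type*} (P : ℝ) (g : E3 → α) : Prop :=
  ∀ (x : E3) (j : Fin 3), g (x + P • basisVec j) = g x

/-- The period cell `[-P/2, P/2]³`. -/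
def cell (P : ℝ) : Set E3 := {x | ∀ j, x j ∈ Icc (-(P / 2)) (P / 2)}

/-- Lebesgue measure on the period cell. -/
def cellMeasure (P : ℝ) : Measure E3 := volume.restrict (cell P)

/-- Lebesgue measure on `[0,T) × [-P/2, P/2]³`. -/
def slabMeasure (P T : ℝ) : Measure (ℝ × E3) :=
  (volume.restrict (Ico 0 T)).prod (cellMeasure P)

/-- Smooth functions, periodic in space, vanishing for times near `T` and later. There is no
condition at `t = 0`, so that the weak formulations below encode the initial data. -/
structure IsTest (P T : ℝ) (ψ : ℝ → E3 → ℝ) : Prop where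
  smooth : ContDiff ℝ ∞ (Function.uncurry ψ)
  periodic : ∀ t, IsPeriodic P (ψ t)
  support : ∃ T' < T, ∀ t, T' ≤ t → ∀ x, ψ t x = 0

/-- Time derivative. -/
def dt (ψ : ℝ → E3 → ℝ) (t : ℝ) (x : E3) : ℝ := deriv (fun s => ψ s x) t

/-- Spatial partial derivative in direction `j`. -/
def dx (j : Fin 3) (ψ : ℝ → E3 → ℝ) (t : ℝ) (x : E3) : ℝ := fderiv ℝ (ψ t) x (basisVec j)

/-- Spatial Laplacian. -/
def lap (ψ : ℝ → E3 → ℝ) (t : ℝ) (x : E3) : ℝ := ∑ j, dx j (dx j ψ) t x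

/-- `∇ · u = 0` in the sense of distributions. -/
def DivFree (P T : ℝ) (u : ℝ → E3 → E3) : Prop :=
  ∀ ψ, IsTest P T ψ →
    ∫ z, (∑ j, u z.1 z.2 j * dx j ψ z.1 z.2) ∂(slabMeasure P T) = 0

/-- `∂ₜu + ∇·(u ⊗ u) + ∇p = μ Δu + f`, `u|_{t=0} = u₀`, in the sense of distributions on
`[0,T) × ℝ³`, written for each component of the equation. -/
def Momentum (P T μ : ℝ) (u₀ : E3 → E3) (f u : ℝ → E3 → E3) (p : ℝ → E3 → ℝ) : Prop :=
  ∀ (i : Fin 3) (ψ : ℝ → E3 → ℝ), IsTest P T ψ →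
    (∫ z, (u z.1 z.2 i * dt ψ z.1 z.2
        + (∑ j, u z.1 z.2 i * u z.1 z.2 j * dx j ψ z.1 z.2)
        + p z.1 z.2 * dx i ψ z.1 z.2
        + μ * (u z.1 z.2 i * lap ψ z.1 z.2)
        + f z.1 z.2 i * ψ z.1 z.2) ∂(slabMeasure P T))
      + ∫ x, u₀ x i * ψ 0 x ∂(cellMeasure P) = 0

/-- `G i j` is the weak derivative `∂u_i/∂x_j`, and it is square integrable on
`[0,T) × [-P/2, P/2]³`. -/
def IsWeakGradient (P T : ℝ) (u : ℝ → E3 → E3) (G : Fin 3 → Fin 3 → ℝ → E3 → ℝ) : Prop :=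
  ∀ i j, MemLp (Function.uncurry (G i j)) 2 (slabMeasure P T) ∧
    ∀ ψ, IsTest P T ψ →
      ∫ z, u z.1 z.2 i * dx j ψ z.1 z.2 ∂(slabMeasure P T)
        = - ∫ z, G i j z.1 z.2 * ψ z.1 z.2 ∂(slabMeasure P T)

/-- `∂ₜ(|u|²/2) + ∇·(u(|u|²/2 + p)) + μ|∇u|² - μ Δ(|u|²/2) ≤ f·u` in the sense of distributions
on `[0,T) × ℝ³`, with initial data `u₀`; `G` stands for `∇u`. -/
def LocalEnergyIneq (P T μ : ℝ) (u₀ : E3 → E3) (f u : ℝ → E3 → E3) (p : ℝ → E3 → ℝ)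
    (G : Fin 3 → Fin 3 → ℝ → E3 → ℝ) : Prop :=
  ∀ ψ, IsTest P T ψ → (∀ t x, 0 ≤ ψ t x) →
    μ * ∫ z, (∑ i, ∑ j, G i j z.1 z.2 ^ 2) * ψ z.1 z.2 ∂(slabMeasure P T)
      ≤ (∫ z, (‖u z.1 z.2‖ ^ 2 / 2 * (dt ψ z.1 z.2 + μ * lap ψ z.1 z.2)
          + (‖u z.1 z.2‖ ^ 2 / 2 + p z.1 z.2) * (∑ j, u z.1 z.2 j * dx j ψ z.1 z.2)
          + inner ℝ (f z.1 z.2) (u z.1 z.2) * ψ z.1 z.2) ∂(slabMeasure P T))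
        + ∫ x, ‖u₀ x‖ ^ 2 / 2 * ψ 0 x ∂(cellMeasure P)

/-- `u ∈ C([0,T]; L²_w)`: bounded in `L²` of the cell, and continuous in time for the weak
topology of `L²`. -/
def WeaklyContinuous (P T : ℝ) (u : ℝ → E3 → E3) : Prop :=
  (∀ t ∈ Icc 0 T, MemLp (u t) 2 (cellMeasure P)) ∧
  (∃ M : ℝ, ∀ t ∈ Icc 0 T, ∫ x, ‖u t x‖ ^ 2 ∂(cellMeasure P) ≤ M) ∧
  ∀ g : E3 → E3, MemLp g 2 (cellMeasure P) →
    ContinuousOn (fun t => ∫ x, inner ℝ (u t x) (g x) ∂(cellMeasure P)) (Icc 0 T)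

/-- Periodic Leray-Hopf weak solutions, with pressure `p`, of the forced Navier-Stokes equations
with viscosity `μ` and initial data `u₀`, satisfying the local energy inequality. -/
structure IsNavierStokesSolution (P T μ : ℝ) (u₀ : E3 → E3) (f u : ℝ → E3 → E3)
    (p : ℝ → E3 → ℝ) : Prop where
  periodic : ∀ t, IsPeriodic P (u t)
  periodic_pressure : ∀ t, IsPeriodic P (p t)
  memLp : MemLp (Function.uncurry u) 2 (slabMeasure P T)
  weaklyContinuous : WeaklyContinuous P T u
  integrable_pressure : Integrable (Function.uncurry p) (slabMeasure P T)
  /-- The energy flux is integrable, so that its divergence is a distribution. -/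
  integrable_flux : Integrable
    (fun z : ℝ × E3 => (‖u z.1 z.2‖ ^ 2 / 2 + p z.1 z.2) • u z.1 z.2) (slabMeasure P T)
  divFree : DivFree P T u
  momentum : Momentum P T μ u₀ f u p
  energy : ∃ G, IsWeakGradient P T u G ∧ LocalEnergyIneq P T μ u₀ f u p G

/-- Periodic weak solutions, with pressure `p`, of the forced incompressible Euler equations with
initial data `u₀`. -/
structure IsEulerSolution (P T : ℝ) (u₀ : E3 → E3) (f u : ℝ → E3 → E3)
    (p : ℝ → E3 → ℝ) : Prop where
  periodic : ∀ t, IsPeriodic P (u t)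
  periodic_pressure : ∀ t, IsPeriodic P (p t)
  memLp : MemLp (Function.uncurry u) 2 (slabMeasure P T)
  integrable_pressure : Integrable (Function.uncurry p) (slabMeasure P T)
  divFree : DivFree P T u
  momentum : Momentum P T 0 u₀ f u p

/-- The wavevector `(2π/P) n`. -/
def waveVec (P : ℝ) (n : Fin 3 → ℤ) : E3 := WithLp.toLp 2 fun j => 2 * Real.pi / P * (n j : ℝ)

/-- The `i`-th component of the Fourier coefficient of `g` at the wavevector `k`. -/
def fourierCoef (P : ℝ) (g : E3 → E3) (k : E3) (i : Fin 3) : ℂ :=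
  (1 / (P : ℂ) ^ 3) *
    ∫ x, Complex.exp (-(Complex.I * ((inner ℝ k x : ℝ) : ℂ))) * ((g x i : ℝ) : ℂ) ∂(cellMeasure P)

/-- The weak pathwise Kolmogorov hypothesis on `[0,T]` for the family `(u μ)`, `μ ∈ S`:
`|k|^{3+β} ∫₀ᵀ |û^μ(t,k)|² dt ≤ C` for `|k| ≥ k_*`, with `β > 0`, `C`, `k_*` independent
of `μ`. -/
def K41w (P T : ℝ) (S : Set ℝ) (u : ℝ → ℝ → E3 → E3) : Prop :=
  ∃ β > (0 : ℝ), ∃ C > (0 : ℝ), ∃ kStar : ℝ, ∀ μ ∈ S, ∀ n : Fin 3 → ℤ,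
    kStar ≤ ‖waveVec P n‖ →
      ‖waveVec P n‖ ^ (3 + β) *
        ∫ t in Ico 0 T, (∑ i, ‖fourierCoef P (u μ t) (waveVec P n) i‖ ^ 2) ≤ C

/-- `∫|u(t)|² ≤ ∫|u₀|² + 2∫₀ᵗ∫ u·f` for every `t ∈ [0,T)`, all `u(t)` being in `L²`. -/
def EnergyIneq (P T : ℝ) (u₀ : E3 → E3) (f u : ℝ → E3 → E3) : Prop :=
  ∀ t ∈ Ico 0 T, MemLp (u t) 2 (cellMeasure P) ∧
    ∫ x, ‖u t x‖ ^ 2 ∂(cellMeasure P)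
      ≤ ∫ x, ‖u₀ x‖ ^ 2 ∂(cellMeasure P)
        + 2 * ∫ s in Ico 0 t, ∫ x, inner ℝ (u s x) (f s x) ∂(cellMeasure P)

end

end InviscidLimit

open InviscidLimit

open MeasureTheory Set Filter Topology
open scoped ContDiff ENNReal

namespace InviscidLimit

noncomputable section

/-! ### Fourier coefficients on the torus, Parseval, and the passage from the period cell to the
torus -/

section

open UnitAddTorus

/-! The hypothesis (K41w) is a compactness statement in disguise. In dimension three `∑ (1 +
|n|)^{-(3+β/2)}` converges, so a decay `|n|^{-(3+β)}` of the time-averaged squared coefficients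
leaves a factor `|n|^{-β/2}` to spare: the high-frequency tails are small in `L²` uniformly in the
viscosity, and translations in space are controlled by a positive power of the shift. Low
frequencies are bounded through the energy inequality.

Velocity. Testing the momentum equation with `θ(t) e^{-ik·x}` and projecting orthogonally to `k`
removes the pressure. Each Fourier coefficient is then a primitive in time of a function dominated
by `K (1 + ∑ |f̂|)`, independently of `μ` (`exists_primitive_fc`). Arzelà–Ascoli gives a subsequence
along which all coefficients converge at almost every time, and the uniform tails upgrade this to
strong `L²` convergence (`exists_subseq_cauchy`).

Higher integrability. The coefficients are bounded in time, so a Fourier truncation at size `2^l` is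
at most of order `8^l`, while the tail has squared `L²` norm of order `2^{-lβ/2}`. Where the
function exceeds twice the truncation bound, it is dominated by the tail; summing over amplitude
layers bounds an `L^{2+β/12}` norm (`exists_lintegral_rpow_bound`). Interpolation with `L²` gives
strong convergence in `L^{2+β/24}`.

Pressure. The quadratic terms converge only in `L¹`, where `∂ᵢ∂ⱼΔ⁻¹` is unbounded. It is written as
a superposition over heat scales `s ∈ (0,1]` of second derivatives of Gaussians, acting on
differences `D(·-√s z) - D`, plus a smoothing remainder. The singular weight `s⁻¹` is integrable
against the translation modulus of `uᵢuⱼ`. Taking the geometric mean of that modulus with the plain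
`L¹` norm makes the estimate tend to zero (`exists_pressure_bound`). The mean-free pressures are
therefore Cauchy in `L¹`.

Conclusion. Strong convergence passes to the limit in every term of the weak formulation, and the
viscous term vanishes (`momentum_of_tendsto`). The energy inequality survives at almost every time
by Fatou (`energy_of_tendsto`); replacing the limit by zero at exceptional times makes it hold at
all times (`exists_energyIneq_representative`). -/

/-- The three-dimensional unit torus. -/
abbrev X3 : Type := UnitAddTorus (Fin 3)

/-- Normalised Haar measure on the torus. -/
def torusMeasure : Measure X3 := Measure.pi fun _ => AddCircle.haarAddCircle

instance : IsProbabilityMeasure torusMeasure := by unfold torusMeasure; infer_instance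
instance : Measure.IsAddHaarMeasure torusMeasure := by unfold torusMeasure; infer_instance

/-- Fourier coefficients on the torus. -/
def tcoef (g : X3 → ℂ) (n : Fin 3 → ℤ) : ℂ := ∫ θ, mFourier (-n) θ * g θ ∂torusMeasure

lemma norm_mFourier_apply (n : Fin 3 → ℤ) (θ : X3) : ‖mFourier n θ‖ = 1 := by
  simp [mFourier, Circle.norm_coe]

lemma integrable_mFourier_mul {g : X3 → ℂ} (hg : Integrable g torusMeasure) (n : Fin 3 → ℤ) :
    Integrable (fun θ => mFourier n θ * g θ) torusMeasure :=
  hg.bdd_mul (c := 1) (mFourier n).continuous.aestronglyMeasurable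
    (Eventually.of_forall fun θ => (norm_mFourier_apply n θ).le)

lemma norm_tcoef_le (g : X3 → ℂ) (n : Fin 3 → ℤ) :
    ‖tcoef g n‖ ≤ ∫ θ, ‖g θ‖ ∂torusMeasure := by
  refine (norm_integral_le_integral_norm _).trans_eq ?_
  simp [norm_mFourier_apply]

lemma tcoef_congr_ae {g h : X3 → ℂ} (H : g =ᵐ[torusMeasure] h) (n : Fin 3 → ℤ) :
    tcoef g n = tcoef h n :=
  integral_congr_ae (H.mono fun θ hθ => by simp only [hθ])

lemma tcoef_sub {g h : X3 → ℂ} (hg : Integrable g torusMeasure) (hh : Integrable h torusMeasure)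
    (n : Fin 3 → ℤ) : tcoef (fun θ => g θ - h θ) n = tcoef g n - tcoef h n := by
  simp only [tcoef, mul_sub]
  exact integral_sub (integrable_mFourier_mul hg _) (integrable_mFourier_mul hh _)

lemma tcoef_const_mul (c : ℂ) (g : X3 → ℂ) (n : Fin 3 → ℤ) :
    tcoef (fun θ => c * g θ) n = c * tcoef g n := by
  simp only [tcoef, mul_left_comm _ c]
  exact integral_const_mul _ _

lemma tcoef_finset_sum {ι : Type*} (s : Finset ι) {g : ι → X3 → ℂ}
    (hg : ∀ i ∈ s, Integrable (g i) torusMeasure) (n : Fin 3 → ℤ) :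
    tcoef (fun θ => ∑ i ∈ s, g i θ) n = ∑ i ∈ s, tcoef (g i) n := by
  simp only [tcoef, Finset.mul_sum]
  exact integral_finsetSum _ fun i hi => integrable_mFourier_mul (hg i hi) _

section Parseval

attribute [local instance] instMeasureSpaceUnitAddCircle

lemma volume_eq_torusMeasure : (volume : Measure X3) = torusMeasure := rfl

lemma tcoef_mFourier (m n : Fin 3 → ℤ) :
    tcoef (fun θ => mFourier m θ) n = if n = m then 1 else 0 := by
  have := (orthonormal_iff_ite.mp (orthonormal_mFourier (d := Fin 3))) n m
  simp only [ContinuousMap.inner_toLp, ← mFourier_neg] at this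
  rw [← this, tcoef, ← volume_eq_torusMeasure]
  simp only [mul_comm]

lemma hasSum_sq_tcoef {g : X3 → ℂ} (hg : MemLp g 2 torusMeasure) :
    HasSum (fun n => ‖tcoef g n‖ ^ 2) (∫ θ, ‖g θ‖ ^ 2 ∂torusMeasure) := by
  have h := hasSum_sq_mFourierCoeff (d := Fin 3) (hg.toLp g)
  have e : ∀ n, mFourierCoeff (d := Fin 3) (hg.toLp g) n = tcoef g n := fun n =>
    tcoef_congr_ae hg.coeFn_toLp n
  have h' := h.congr_fun fun n => (congrArg (fun z => ‖z‖ ^ 2) (e n).symm : _)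
  convert h' using 1
  exact integral_congr_ae (hg.coeFn_toLp.mono fun θ hθ => congrArg (fun z : ℂ => ‖z‖ ^ 2) hθ.symm)

end Parseval

/-- Parseval with values in `ℝ≥0∞`, so that sums over frequencies and integrals over time can be
exchanged without summability hypotheses. -/
lemma lintegral_enorm_sq_eq_tsum {g : X3 → ℂ} (hg : MemLp g 2 torusMeasure) :
    ∫⁻ θ, ‖g θ‖ₑ ^ 2 ∂torusMeasure = ∑' n, ‖tcoef g n‖ₑ ^ 2 := by
  have h := hasSum_sq_tcoef hg
  have h2 := h.tsum_eq
  have e : ∀ z : ℂ, ‖z‖ₑ ^ 2 = ENNReal.ofReal (‖z‖ ^ 2) := fun z => by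
    rw [ENNReal.ofReal_pow (norm_nonneg _), ofReal_norm]
  simp only [e]
  rw [← ENNReal.ofReal_tsum_of_nonneg (fun _ => by positivity) h.summable, h2,
    ofReal_integral_eq_lintegral_ofReal ((memLp_two_iff_integrable_sq_norm hg.1).1 hg)
      (Eventually.of_forall fun _ => by positivity)]

lemma lintegral_enorm_sub_trunc_sq {g : X3 → ℂ} (hg : MemLp g 2 torusMeasure)
    (F : Finset (Fin 3 → ℤ)) :
    ∫⁻ θ, ‖g θ - ∑ m ∈ F, tcoef g m * mFourier m θ‖ₑ ^ 2 ∂torusMeasure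
      = ∑' n, if n ∈ F then 0 else ‖tcoef g n‖ₑ ^ 2 := by
  have hm : ∀ m, MemLp (fun θ => tcoef g m * mFourier m θ) 2 torusMeasure := fun m =>
    MemLp.of_bound (by fun_prop) ‖tcoef g m‖
      (Eventually.of_forall fun θ => by simp [norm_mFourier_apply])
  have hs : MemLp (fun θ => ∑ m ∈ F, tcoef g m * mFourier m θ) 2 torusMeasure :=
    memLp_finsetSum _ fun m _ => hm m
  rw [lintegral_enorm_sq_eq_tsum (g := fun θ => g θ - ∑ m ∈ F, tcoef g m * mFourier m θ)
    (hg.sub hs)]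
  refine tsum_congr fun n => ?_
  rw [tcoef_sub (hg.integrable one_le_two) (hs.integrable one_le_two),
    tcoef_finset_sum _ fun m _ => (hm m).integrable one_le_two]
  simp only [tcoef_const_mul, tcoef_mFourier]
  split_ifs with h <;> simp [h]

lemma mFourier_add_apply (n : Fin 3 → ℤ) (x y : X3) :
    mFourier n (x + y) = mFourier n x * mFourier n y := by
  simp only [mFourier, ContinuousMap.coe_mk, ← Finset.prod_mul_distrib, Pi.add_apply]
  exact Finset.prod_congr rfl fun i _ => by simp [fourier_apply, AddCircle.toCircle_add]

lemma tcoef_translate (g : X3 → ℂ) (y : X3) (n : Fin 3 → ℤ) :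
    tcoef (fun θ => g (θ - y)) n = mFourier (-n) y * tcoef g n := by
  rw [tcoef, ← integral_add_right_eq_self _ y, tcoef, ← integral_const_mul]
  refine integral_congr_ae (Eventually.of_forall fun θ => ?_)
  simp only [mFourier_add_apply, add_sub_cancel_right]
  ring

/-- The projection `ℝ³ → X3`. -/
def toTorus (y : Fin 3 → ℝ) : X3 := fun j => (y j : UnitAddCircle)

lemma measurable_toTorus : Measurable toTorus :=
  measurable_pi_lambda _ fun j => AddCircle.measurable_mk'.comp (measurable_pi_apply j)

lemma mFourier_toTorus (n : Fin 3 → ℤ) (y : Fin 3 → ℝ) :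
    mFourier n (toTorus y) = ∏ j, Complex.exp (2 * Real.pi * Complex.I * n j * y j) := by
  simp [mFourier, toTorus]

/-- The section of the covering map `ℝ³ → X3`, with values in the period cell. -/
def cellSection (P : ℝ) (θ : X3) : E3 :=
  WithLp.toLp 2 fun j => P * (AddCircle.equivIoc 1 (-(1 / 2)) (θ j) : ℝ)

lemma measurable_cellSection (P : ℝ) : Measurable (cellSection P) := by
  refine (MeasurableEquiv.toLp 2 (Fin 3 → ℝ)).measurable.comp
    (measurable_pi_lambda _ fun j => ?_)
  exact measurable_const.mul (measurable_subtype_coe.comp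
    ((AddCircle.measurableEquivIoc 1 (-(1 / 2))).measurable.comp (measurable_pi_apply j)))

/-- The scale `P` of the section cancels the `P` in the wavevector; this identifies the physical
Fourier coefficients with those on the unit torus. -/
lemma mFourier_neg_eq_exp {P : ℝ} (hP : 0 < P) (n : Fin 3 → ℤ) (θ : X3) :
    mFourier (-n) θ =
      Complex.exp (-(Complex.I * ((inner ℝ (waveVec P n) (cellSection P θ) : ℝ) : ℂ))) := by
  have h : θ = toTorus (fun j => (AddCircle.equivIoc 1 (-(1 / 2)) (θ j) : ℝ)) := by
    funext j
    exact AddCircle.coe_equivIoc.symm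
  conv_lhs => rw [h]
  rw [mFourier_toTorus, ← Complex.exp_sum]
  congr 1
  simp only [waveVec, cellSection, PiLp.inner_apply, Pi.neg_apply]
  push_cast
  rw [Finset.mul_sum, ← Finset.sum_neg_distrib]
  refine Finset.sum_congr rfl fun j _ => ?_
  have : (P : ℂ) ≠ 0 := by exact_mod_cast hP.ne'
  simp
  field_simp

lemma measurePreserving_equivIoc_val (a : ℝ) :
    MeasurePreserving (fun θ : UnitAddCircle => (AddCircle.equivIoc 1 a θ : ℝ))
      AddCircle.haarAddCircle (volume.restrict (Ioc a (a + 1))) := by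
  have h := (measurePreserving_subtype_coe (μa := volume) (measurableSet_Ioc (a := a)
    (b := a + 1))).comp (AddCircle.measurePreserving_equivIoc 1 (a := a))
  have e : (volume : Measure (AddCircle (1 : ℝ))) = AddCircle.haarAddCircle := by
    rw [AddCircle.volume_eq_smul_haarAddCircle]; simp
  rw [e] at h
  exact h

/-- The section takes values in a half-open cube, which differs from the closed cell by a null set;
dilation by `P` accounts for the factor `P⁻³`. -/
lemma map_cellSection {P : ℝ} (hP : 0 < P) :
    torusMeasure.map (cellSection P) = ENNReal.ofReal (P ^ 3)⁻¹ • cellMeasure P := by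
  set e : X3 → (Fin 3 → ℝ) := fun θ j => (AddCircle.equivIoc 1 (-(1 / 2)) (θ j) : ℝ) with he
  have h1 : MeasurePreserving e torusMeasure
      (Measure.pi fun _ => volume.restrict (Ioc (-(1 / 2) : ℝ) (-(1 / 2) + 1))) :=
    measurePreserving_pi _ _ fun _ => measurePreserving_equivIoc_val _
  have h2 : (Measure.pi fun _ : Fin 3 => (volume : Measure ℝ).restrict
      (Ioc (-(1 / 2) : ℝ) (-(1 / 2) + 1)))
      = volume.restrict (Icc (fun _ => -(1 / 2)) (fun _ => 1 / 2)) := by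
    rw [← Measure.restrict_pi_pi, ← volume_pi]
    refine Measure.restrict_congr_set ?_
    have := Measure.univ_pi_Ioc_ae_eq_Icc (μ := fun _ : Fin 3 => (volume : Measure ℝ))
      (f := fun _ => (-(1 / 2) : ℝ)) (g := fun _ => (1 / 2 : ℝ))
    norm_num at this ⊢
    exact this
  have h3 : Measure.map (fun y : Fin 3 → ℝ => P • y)
      (volume.restrict (Icc (fun _ => -(1 / 2)) (fun _ => 1 / 2)))
      = ENNReal.ofReal (P ^ 3)⁻¹ • volume.restrict (Icc (fun _ => -(P / 2)) (fun _ => P / 2)) := by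
    have hpre : (Icc (fun _ => -(1 / 2)) (fun _ => 1 / 2) : Set (Fin 3 → ℝ))
        = (fun y : Fin 3 → ℝ => P • y) ⁻¹' (Icc (fun _ => -(P / 2)) (fun _ => P / 2)) := by
      ext y
      simp only [mem_Icc, Pi.le_def, mem_preimage, Pi.smul_apply, smul_eq_mul]
      refine and_congr (forall_congr' fun j => ?_) (forall_congr' fun j => ?_)
      · constructor <;> intro h <;> nlinarith
      · constructor <;> intro h <;> nlinarith
    rw [hpre, ← Measure.restrict_map (by fun_prop) measurableSet_Icc,
      Measure.map_addHaar_smul _ hP.ne', Measure.restrict_smul]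
    congr 2
    simp [abs_of_pos hP]
  have h4 : Measure.map (MeasurableEquiv.toLp 2 (Fin 3 → ℝ))
      (volume.restrict (Icc (fun _ => -(P / 2)) (fun _ => P / 2))) = cellMeasure P := by
    have := (EuclideanSpace.volume_preserving_symm_measurableEquiv_toLp (Fin 3)).symm
    have hpre : (Icc (fun _ => -(P / 2)) (fun _ => P / 2) : Set (Fin 3 → ℝ))
        = (MeasurableEquiv.toLp 2 (Fin 3 → ℝ)) ⁻¹' (cell P) := by
      ext y
      simp only [mem_Icc, Pi.le_def, mem_preimage, cell, mem_ofPred_eq, forall_and]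
      rfl
    rw [hpre, ← MeasurableEquiv.restrict_map]
    congr 1
    exact this.map_eq
  have hc : cellSection P = (MeasurableEquiv.toLp 2 (Fin 3 → ℝ)) ∘ (fun y => P • y) ∘ e := rfl
  rw [hc, ← Measure.map_map (MeasurableEquiv.measurable _)
    ((by fun_prop : Measurable fun y : Fin 3 → ℝ => P • y).comp h1.measurable),
    ← Measure.map_map (by fun_prop) h1.measurable, h1.map_eq, h2, h3, Measure.map_smul, h4]

end

/-! ### Lattice sums and uniqueness of Fourier coefficients in `L¹` -/

section

open UnitAddTorus

/-- The threshold `3` is the rank of the lattice; the convergence for `a = 3 + β/2` is what makes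
the Kolmogorov exponent sufficient. -/
lemma summable_one_add_norm_rpow {a : ℝ} (ha : 3 < a) :
    Summable fun n : Fin 3 → ℤ => (1 + ‖n‖) ^ (-a) := by
  let L := Submodule.span ℤ (Set.range (Pi.basisFun ℝ (Fin 3)))
  have hr : Module.finrank ℤ L = 3 := by
    have := ZLattice.rank ℝ L
    simpa using this
  have hL := ZLattice.summable_norm_rpow L (-a) (by rw [hr]; norm_num; exact ha)
  have hmem : ∀ n : Fin 3 → ℤ, (fun j => (n j : ℝ)) ∈ L := by
    intro n
    rw [(Pi.basisFun ℝ (Fin 3)).mem_span_iff_repr_mem ℤ]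
    intro i
    exact ⟨n i, by simp⟩
  have h2 := hL.comp_injective (i := fun n : Fin 3 → ℤ => (⟨_, hmem n⟩ : L)) (by
    intro m n h
    funext j
    have : ((m j : ℤ) : ℝ) = n j := congrFun (congrArg Subtype.val h) j
    exact_mod_cast this)
  have hn : ∀ n : Fin 3 → ℤ, ‖(⟨_, hmem n⟩ : L)‖ = ‖n‖ := by
    intro n
    change ‖(fun j => (n j : ℝ))‖ = ‖n‖
    refine le_antisymm ((pi_norm_le_iff_of_nonneg (norm_nonneg _)).2 fun j => ?_)
      ((pi_norm_le_iff_of_nonneg (norm_nonneg _)).2 fun j => ?_)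
    · have := norm_le_pi_norm n j
      rwa [Int.norm_eq_abs] at this
    · have := norm_le_pi_norm (fun j => (n j : ℝ)) j
      rwa [Real.norm_eq_abs, ← Int.norm_eq_abs] at this
  refine Summable.of_norm_bounded_eventually h2 ?_
  filter_upwards [(Set.finite_singleton (0 : Fin 3 → ℤ)).compl_mem_cofinite] with n hn0
  have hpos : 0 < ‖n‖ := norm_pos_iff.2 (by simpa using hn0)
  simp only [Function.comp, hn]
  rw [Real.norm_of_nonneg (by positivity)]
  exact Real.rpow_le_rpow_of_nonpos hpos (by linarith) (by linarith)

/-- The squared Euclidean norm of an integer vector. -/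
def nsq (n : Fin 3 → ℤ) : ℝ := ∑ j, (n j : ℝ) ^ 2

lemma nsq_nonneg (n : Fin 3 → ℤ) : 0 ≤ nsq n := Finset.sum_nonneg fun _ _ => by positivity

lemma abs_le_norm (n : Fin 3 → ℤ) (j : Fin 3) : |(n j : ℝ)| ≤ ‖n‖ := by
  have := norm_le_pi_norm n j
  rwa [Int.norm_eq_abs] at this

lemma norm_sq_le_nsq (n : Fin 3 → ℤ) : ‖n‖ ^ 2 ≤ nsq n := by
  have : ‖n‖ ≤ √(nsq n) := by
    refine (pi_norm_le_iff_of_nonneg (Real.sqrt_nonneg _)).2 fun j => ?_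
    rw [Int.norm_eq_abs]
    refine Real.abs_le_sqrt ?_
    exact Finset.single_le_sum (f := fun j => (n j : ℝ) ^ 2) (fun _ _ => by positivity)
      (Finset.mem_univ j)
  calc ‖n‖ ^ 2 ≤ √(nsq n) ^ 2 := by gcongr
    _ = nsq n := Real.sq_sqrt (nsq_nonneg n)

lemma nsq_pos {n : Fin 3 → ℤ} (hn : n ≠ 0) : 0 < nsq n :=
  lt_of_lt_of_le (by have := norm_pos_iff.2 hn; positivity) (norm_sq_le_nsq n)

lemma abs_mul_le_nsq (n : Fin 3 → ℤ) (i j : Fin 3) : |(n i : ℝ) * n j| ≤ nsq n := by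
  rw [abs_mul]
  refine le_trans ?_ (norm_sq_le_nsq n)
  rw [sq]
  exact mul_le_mul (abs_le_norm n i) (abs_le_norm n j) (abs_nonneg _) (norm_nonneg _)

lemma summable_exp_neg_nsq : Summable fun n : Fin 3 → ℤ => Real.exp (-(Real.pi * nsq n)) := by
  refine Summable.of_nonneg_of_le (fun _ => (Real.exp_pos _).le) (fun n => ?_)
    ((summable_one_add_norm_rpow (a := 4) (by norm_num)).mul_left (Real.exp 4))
  have h1 : (1 + ‖n‖) ^ (4 : ℝ) ≤ Real.exp (4 * ‖n‖) := by
    rw [show 4 * ‖n‖ = ‖n‖ * 4 by ring, Real.exp_mul]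
    have := Real.add_one_le_exp ‖n‖
    gcongr
    linarith
  rw [Real.rpow_neg (by positivity), ← div_eq_mul_inv, le_div_iff₀ (by positivity)]
  calc Real.exp (-(Real.pi * nsq n)) * (1 + ‖n‖) ^ (4 : ℝ)
      ≤ Real.exp (-(Real.pi * nsq n)) * Real.exp (4 * ‖n‖) := by gcongr
    _ = Real.exp (-(Real.pi * nsq n) + 4 * ‖n‖) := (Real.exp_add _ _).symm
    -- With `x = ‖n‖` the claim is `-π x² + 4x ≤ 4`, which follows from `π > 3` and the
    -- nonnegativity of squares.
    _ ≤ Real.exp 4 := by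
      refine Real.exp_le_exp.2 ?_
      have := norm_sq_le_nsq n
      nlinarith [Real.pi_gt_three, sq_nonneg (‖n‖ - 1), norm_nonneg n, nsq_nonneg n]

lemma integral_continuous_mul_eq_zero {g : X3 → ℂ} (hg : Integrable g torusMeasure)
    (h : ∀ n, tcoef g n = 0) (φ : C(X3, ℂ)) : ∫ θ, φ θ * g θ ∂torusMeasure = 0 := by
  have h_int : ∀ p : C(X3, ℂ), Integrable (fun θ => p θ * g θ) torusMeasure := fun p =>
    hg.bdd_mul (c := ‖p‖) p.continuous.aestronglyMeasurable
      (Eventually.of_forall fun θ => p.norm_coe_le_norm θ)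
  have hspan : ∀ p ∈ Submodule.span ℂ (Set.range (mFourier (d := Fin 3))),
      ∫ θ, p θ * g θ ∂torusMeasure = 0 := by
    intro p hp
    induction hp using Submodule.span_induction with
    | mem x hx =>
      obtain ⟨n, rfl⟩ := hx
      have := h (-n)
      rwa [tcoef, neg_neg] at this
    | zero => simp
    | add x y _ _ hx hy =>
      simp only [ContinuousMap.add_apply, add_mul]
      rw [integral_add (h_int x) (h_int y), hx, hy, add_zero]
    | smul a x _ hx =>
      simp only [ContinuousMap.smul_apply, smul_eq_mul, mul_assoc]
      rw [integral_const_mul, hx, mul_zero]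
  have hφ : φ ∈ (Submodule.span ℂ (Set.range (mFourier (d := Fin 3)))).topologicalClosure := by
    rw [span_mFourier_closure_eq_top]; trivial
  rw [← norm_le_zero_iff]
  refine le_of_forall_pos_le_add fun ε hε => ?_
  set K := ∫ θ, ‖g θ‖ ∂torusMeasure with hK
  have hK0 : 0 ≤ K := integral_nonneg fun _ => norm_nonneg _
  obtain ⟨p, hp, hpd⟩ := Metric.mem_closure_iff.1 hφ (ε / (K + 1)) (by positivity)
  have e : ∫ θ, φ θ * g θ ∂torusMeasure = ∫ θ, (φ - p) θ * g θ ∂torusMeasure := by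
    simp only [ContinuousMap.sub_apply, sub_mul]
    rw [integral_sub (h_int φ) (h_int p), hspan p hp, sub_zero]
  rw [e, zero_add]
  calc ‖∫ θ, (φ - p) θ * g θ ∂torusMeasure‖ ≤ ∫ θ, ‖φ - p‖ * ‖g θ‖ ∂torusMeasure := by
        refine norm_integral_le_of_norm_le (hg.norm.const_mul _) (Eventually.of_forall fun θ => ?_)
        rw [norm_mul]
        gcongr
        exact (φ - p).norm_coe_le_norm θ
    _ = ‖φ - p‖ * K := integral_const_mul _ _
    _ ≤ ε / (K + 1) * (K + 1) := by
        rw [dist_eq_norm] at hpd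
        gcongr
        linarith
    _ = ε := by field_simp

/-- Uniqueness is needed for functions that are merely integrable, such as the pressure, so Parseval
does not apply. Trigonometric polynomials are dense in `C(X3, ℂ)`, and continuous functions decrease
to indicators of closed sets. -/
lemma ae_eq_zero_of_tcoef_eq_zero {g : X3 → ℂ} (hg : Integrable g torusMeasure)
    (h : ∀ n, tcoef g n = 0) : g =ᵐ[torusMeasure] 0 := by
  refine ae_eq_zero_of_forall_setIntegral_isClosed_eq_zero hg fun s hs => ?_
  have hlim : Tendsto (fun k => ∫ θ, (((hs.apprSeq k θ : NNReal) : ℝ) : ℂ) * g θ ∂torusMeasure)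
      atTop (𝓝 (∫ θ, (s.indicator (fun _ => (1 : ℂ)) θ) * g θ ∂torusMeasure)) := by
    refine tendsto_integral_of_dominated_convergence (fun θ => ‖g θ‖) (fun k => ?_) hg.norm
      (fun k => ?_) ?_
    · refine AEStronglyMeasurable.mul ?_ hg.1
      exact (Complex.continuous_ofReal.comp (NNReal.continuous_coe.comp
        (hs.apprSeq k).continuous)).aestronglyMeasurable
    · refine Eventually.of_forall fun θ => ?_
      rw [norm_mul]
      refine mul_le_of_le_one_left (norm_nonneg _) ?_
      rw [Complex.norm_real, Real.norm_of_nonneg NNReal.zero_le_coe]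
      exact_mod_cast HasOuterApproxClosed.apprSeq_apply_le_one hs k θ
    · refine Eventually.of_forall fun θ => ?_
      refine Tendsto.mul_const _ ?_
      have := (tendsto_pi_nhds.1 (HasOuterApproxClosed.tendsto_apprSeq hs)) θ
      have h2 := ((Complex.continuous_ofReal.comp NNReal.continuous_coe).tendsto _).comp this
      refine h2.congr' (Eventually.of_forall fun k => rfl) |>.trans (le_of_eq ?_)
      congr 1
      by_cases hθ : θ ∈ s <;> simp [hθ]
  have hz : ∀ k, ∫ θ, (((hs.apprSeq k θ : NNReal) : ℝ) : ℂ) * g θ ∂torusMeasure = 0 := fun k =>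
    integral_continuous_mul_eq_zero hg h ⟨fun θ => (((hs.apprSeq k θ : NNReal) : ℝ) : ℂ),
      Complex.continuous_ofReal.comp (NNReal.continuous_coe.comp (hs.apprSeq k).continuous)⟩
  simp only [hz] at hlim
  rw [← tendsto_nhds_unique tendsto_const_nhds hlim |>.symm, ← integral_indicator hs.measurableSet]
  refine integral_congr_ae (Eventually.of_forall fun θ => ?_)
  by_cases hθ : θ ∈ s <;> simp [hθ]

/-- An absolutely convergent Fourier series has the prescribed coefficients. -/
lemma tcoef_tsum {c : (Fin 3 → ℤ) → ℂ} (hc : Summable fun n => ‖c n‖) (n : Fin 3 → ℤ) :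
    tcoef (fun θ => ∑' m, c m * mFourier m θ) n = c n := by
  have hb : ∀ m θ, ‖mFourier (-n) θ * (c m * mFourier m θ)‖ = ‖c m‖ := fun m θ => by
    simp [norm_mFourier_apply]
  have hi : ∀ m, Integrable (fun θ => mFourier (-n) θ * (c m * mFourier m θ)) torusMeasure :=
    fun m => Integrable.of_bound (by fun_prop) ‖c m‖ (Eventually.of_forall fun θ => (hb m θ).le)
  have h := hasSum_integral_of_summable_integral_norm hi
    (by simpa only [hb, integral_const, probReal_univ, one_smul] using hc)
  have e : ∀ m, ∫ θ, mFourier (-n) θ * (c m * mFourier m θ) ∂torusMeasure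
      = if m = n then c n else 0 := fun m => by
    have := tcoef_const_mul (c m) (fun θ => mFourier m θ) n
    rw [tcoef] at this
    rw [this, tcoef_mFourier]
    by_cases hmn : m = n
    · simp [hmn]
    · simp [hmn, Ne.symm hmn]
  simp only [e] at h
  have h3 := h.unique (hasSum_ite_eq n (c n))
  rw [← h3, tcoef]
  simp only [tsum_mul_left]

lemma norm_tsum_mFourier_le {c : (Fin 3 → ℤ) → ℂ} (hc : Summable fun n => ‖c n‖) (θ : X3) :
    ‖∑' m, c m * mFourier m θ‖ ≤ ∑' m, ‖c m‖ := by
  have e : ∀ m, ‖c m * mFourier m θ‖ = ‖c m‖ := fun m => by simp [norm_mFourier_apply]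
  refine (norm_tsum_le_tsum_norm (by simpa only [e] using hc)).trans_eq ?_
  simp only [e]

lemma continuous_tsum_mFourier {c : (Fin 3 → ℤ) → ℂ} (hc : Summable fun n => ‖c n‖) :
    Continuous fun θ => ∑' m, c m * mFourier m θ :=
  continuous_tsum (fun m => by fun_prop) hc fun m θ => by simp [norm_mFourier_apply]

end

/-! ### Averaged difference operators and Gaussian kernels -/

section

open UnitAddTorus

section DifferenceOperator

set_option linter.unusedSectionVars false

variable {Y : Type*} [MeasurableSpace Y]

/-- The operator `D ↦ ∫ k(y) (D(· - a(y)) - D) dρ(y)`. -/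
def diffOp (ρ : Measure Y) (k : Y → ℝ) (a : Y → X3) (D : X3 → ℂ) (θ : X3) : ℂ :=
  ∫ y, (k y : ℂ) * (D (θ - a y) - D θ) ∂ρ

/-- The integrated modulus of continuity dominating `diffOp`. -/
def diffMod (ρ : Measure Y) (k : Y → ℝ) (a : Y → X3) (D : X3 → ℂ) : ℝ≥0∞ :=
  ∫⁻ y, ‖k y‖ₑ * ∫⁻ θ, ‖D (θ - a y) - D θ‖ₑ ∂torusMeasure ∂ρ

variable {ρ : Measure Y} [SFinite ρ] {k : Y → ℝ} {a : Y → X3} {D : X3 → ℂ}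

lemma measurable_diff (ha : Measurable a) (hD : Measurable D) :
    Measurable fun p : Y × X3 => D (p.2 - a p.1) - D p.2 :=
  (hD.comp (measurable_snd.sub (ha.comp measurable_fst))).sub (hD.comp measurable_snd)

lemma integrable_diff (hk : Measurable k) (ha : Measurable a) (hD : Measurable D)
    (hJ : diffMod ρ k a D ≠ ⊤) :
    Integrable (fun p : Y × X3 => (k p.1 : ℂ) * (D (p.2 - a p.1) - D p.2))
      (ρ.prod torusMeasure) := by
  have hm : Measurable (fun p : Y × X3 => (k p.1 : ℂ) * (D (p.2 - a p.1) - D p.2)) :=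
    (Complex.measurable_ofReal.comp (hk.comp measurable_fst)).mul (measurable_diff ha hD)
  refine ⟨hm.aestronglyMeasurable, ?_⟩
  rw [hasFiniteIntegral_iff_enorm, lintegral_prod _ hm.enorm.aemeasurable]
  refine lt_of_le_of_lt (le_of_eq ?_) hJ.lt_top
  refine lintegral_congr fun y => ?_
  simp only [enorm_mul]
  rw [lintegral_const_mul' _ _ enorm_ne_top]
  congr 1
  rw [← ofReal_norm, Complex.norm_real, ofReal_norm]

lemma integrable_diffOp (hk : Measurable k) (ha : Measurable a) (hD : Measurable D)
    (hJ : diffMod ρ k a D ≠ ⊤) : Integrable (diffOp ρ k a D) torusMeasure :=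
  (integrable_diff hk ha hD hJ).integral_prod_right

lemma lintegral_enorm_diffOp_le (hk : Measurable k) (ha : Measurable a) (hD : Measurable D) :
    ∫⁻ θ, ‖diffOp ρ k a D θ‖ₑ ∂torusMeasure ≤ diffMod ρ k a D := by
  have hm : Measurable (fun p : Y × X3 => (k p.1 : ℂ) * (D (p.2 - a p.1) - D p.2)) :=
    (Complex.measurable_ofReal.comp (hk.comp measurable_fst)).mul (measurable_diff ha hD)
  calc ∫⁻ θ, ‖diffOp ρ k a D θ‖ₑ ∂torusMeasure
      ≤ ∫⁻ θ, ∫⁻ y, ‖(k y : ℂ) * (D (θ - a y) - D θ)‖ₑ ∂ρ ∂torusMeasure :=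
        lintegral_mono fun θ => enorm_integral_le_lintegral_enorm _
    _ = ∫⁻ y, ∫⁻ θ, ‖(k y : ℂ) * (D (θ - a y) - D θ)‖ₑ ∂torusMeasure ∂ρ :=
        lintegral_lintegral_swap (hm.enorm.comp measurable_swap).aemeasurable
    _ = diffMod ρ k a D := by
        refine lintegral_congr fun y => ?_
        simp only [enorm_mul]
        rw [lintegral_const_mul' _ _ enorm_ne_top]
        congr 1
        rw [← ofReal_norm, Complex.norm_real, ofReal_norm]

lemma integral_mFourier_diff (hDi : Integrable D torusMeasure) (n : Fin 3 → ℤ) (y : Y) :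
    ∫ θ, mFourier (-n) θ * ((k y : ℂ) * (D (θ - a y) - D θ)) ∂torusMeasure
      = (k y : ℂ) * (mFourier (-n) (a y) - 1) * tcoef D n := by
  have h := tcoef_const_mul (k y : ℂ) (fun θ => D (θ - a y) - D θ) n
  rw [tcoef] at h
  rw [h, tcoef_sub (hDi.comp_sub_right (a y)) hDi, tcoef_translate]
  ring

lemma integrable_mFourier_diff (hk : Measurable k) (ha : Measurable a) (hD : Measurable D)
    (hJ : diffMod ρ k a D ≠ ⊤) (n : Fin 3 → ℤ) :
    Integrable (fun p : Y × X3 => mFourier (-n) p.2 * ((k p.1 : ℂ) * (D (p.2 - a p.1) - D p.2)))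
      (ρ.prod torusMeasure) :=
  (integrable_diff hk ha hD hJ).bdd_mul (c := 1)
    (((mFourier (-n)).continuous.measurable.comp measurable_snd).aestronglyMeasurable)
    (Eventually.of_forall fun p => (norm_mFourier_apply (-n) p.2).le)

/-- Convergence of the integral defining the symbol is not assumed: Fubini makes the symbol times
`tcoef D n` integrable, and one divides by the nonzero coefficient. -/
lemma integrable_symbol (hk : Measurable k) (ha : Measurable a) (hD : Measurable D)
    (hDi : Integrable D torusMeasure) (hJ : diffMod ρ k a D ≠ ⊤) {n : Fin 3 → ℤ}
    (hn : tcoef D n ≠ 0) : Integrable (fun y => (k y : ℂ) * (mFourier (-n) (a y) - 1)) ρ := by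
  have h := (integrable_mFourier_diff hk ha hD hJ n).integral_prod_left
  simp only [integral_mFourier_diff hDi n] at h
  have h2 := h.mul_const (tcoef D n)⁻¹
  refine h2.congr (Eventually.of_forall fun y => ?_)
  simp only
  rw [mul_assoc, mul_inv_cancel₀ hn, mul_one]

/-- Translations multiply Fourier coefficients by characters, so by Fubini `diffOp` is a Fourier
multiplier. -/
lemma tcoef_diffOp (hk : Measurable k) (ha : Measurable a) (hD : Measurable D)
    (hDi : Integrable D torusMeasure) (hJ : diffMod ρ k a D ≠ ⊤) (n : Fin 3 → ℤ) :
    tcoef (diffOp ρ k a D) n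
      = (∫ y, (k y : ℂ) * (mFourier (-n) (a y) - 1) ∂ρ) * tcoef D n := by
  have h := integral_integral_swap (f := fun y θ =>
    mFourier (-n) θ * ((k y : ℂ) * (D (θ - a y) - D θ))) (integrable_mFourier_diff hk ha hD hJ n)
  simp only [integral_mFourier_diff hDi n] at h
  rw [integral_mul_const] at h
  rw [h, tcoef]
  refine integral_congr_ae (Eventually.of_forall fun θ => ?_)
  simp only [diffOp]
  exact (integral_const_mul _ _).symm

end DifferenceOperator

section HeatKernel

/-- The Gaussian `exp(-πz²)` and its first two derivatives. -/
def gaussDeriv : ℕ → ℝ → ℝ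
  | 0, z => Real.exp (-Real.pi * z ^ 2)
  | 1, z => -2 * Real.pi * z * Real.exp (-Real.pi * z ^ 2)
  | _, z => (4 * Real.pi ^ 2 * z ^ 2 - 2 * Real.pi) * Real.exp (-Real.pi * z ^ 2)

lemma hasDerivAt_gauss (z : ℝ) : HasDerivAt (fun z : ℝ => Real.exp (-Real.pi * z ^ 2))
    (-2 * Real.pi * z * Real.exp (-Real.pi * z ^ 2)) z := by
  have := ((hasDerivAt_pow 2 z).const_mul (-Real.pi)).exp
  convert this using 1
  simp; ring

lemma hasDerivAt_gaussDeriv_zero (z : ℝ) :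
    HasDerivAt (gaussDeriv 0) (gaussDeriv 1 z) z := hasDerivAt_gauss z

lemma hasDerivAt_gaussDeriv_one (z : ℝ) :
    HasDerivAt (gaussDeriv 1) (gaussDeriv 2 z) z := by
  have h1 : HasDerivAt (fun z : ℝ => -2 * Real.pi * z) (-2 * Real.pi * 1) z :=
    (hasDerivAt_id z).const_mul _
  refine (h1.mul (hasDerivAt_gauss z)).congr_deriv ?_
  simp only [gaussDeriv]; ring

lemma continuous_gaussDeriv (d : ℕ) : Continuous (gaussDeriv d) := by
  match d with
  | 0 => unfold gaussDeriv; fun_prop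
  | 1 => unfold gaussDeriv; fun_prop
  | _ + 2 => unfold gaussDeriv; fun_prop

lemma integrable_pow_mul_gauss (m : ℕ) :
    Integrable fun z : ℝ => z ^ m * Real.exp (-Real.pi * z ^ 2) := by
  have := integrable_rpow_mul_exp_neg_mul_sq Real.pi_pos (s := m)
    (by have : (0 : ℝ) ≤ m := by positivity
        linarith)
  simpa using this

lemma integrable_one_add_mul_gaussDeriv (d : ℕ) :
    Integrable fun z : ℝ => (1 + |z|) * gaussDeriv d z := by
  have hE : ∀ m, Integrable fun z : ℝ => |z| ^ m * Real.exp (-Real.pi * z ^ 2) := fun m => by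
    refine (integrable_pow_mul_gauss m).norm.congr (Eventually.of_forall fun z => ?_)
    simp [abs_of_pos (Real.exp_pos _)]
  have h := (((hE 0).add (hE 1)).add ((hE 2).add (hE 3))).const_mul (100 : ℝ)
  refine h.mono' (by have := continuous_gaussDeriv d; fun_prop)
    (Eventually.of_forall fun z => ?_)
  have hpi := Real.pi_lt_four
  have hpi0 := Real.pi_pos
  have hz := abs_nonneg z
  -- The coefficients come from `π < 4`; after multiplication by `1 + |z|` every coefficient is
  -- below `100`.
  have key : |gaussDeriv d z| ≤ (8 + 8 * |z| + 64 * |z| ^ 2) * Real.exp (-Real.pi * z ^ 2) := by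
    match d with
    | 0 =>
      simp only [gaussDeriv, abs_of_pos (Real.exp_pos _)]
      nlinarith [Real.exp_pos (-Real.pi * z ^ 2), sq_nonneg |z|,
        mul_nonneg hz (Real.exp_pos (-Real.pi * z ^ 2)).le]
    | 1 =>
      simp only [gaussDeriv, abs_mul, abs_of_pos (Real.exp_pos _), abs_of_pos hpi0]
      gcongr
      norm_num
      nlinarith [sq_nonneg |z|]
    | _ + 2 =>
      simp only [gaussDeriv]
      rw [abs_mul, abs_of_pos (Real.exp_pos _)]
      gcongr
      refine (abs_sub _ _).trans ?_
      rw [abs_of_nonneg (by positivity), abs_of_pos (by positivity), sq_abs]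
      have : Real.pi ^ 2 ≤ 16 := by nlinarith
      nlinarith [sq_nonneg z]
  rw [norm_mul, Real.norm_of_nonneg (by positivity), Real.norm_eq_abs]
  refine (mul_le_mul_of_nonneg_left key (by positivity)).trans ?_
  have hb : (1 + |z|) * (8 + 8 * |z| + 64 * |z| ^ 2)
      ≤ 100 * (|z| ^ 0 + |z| ^ 1 + (|z| ^ 2 + |z| ^ 3)) := by
    nlinarith [pow_nonneg hz 2, pow_nonneg hz 3]
  have := mul_le_mul_of_nonneg_right hb (Real.exp_pos (-Real.pi * z ^ 2)).le
  simp only [Pi.add_apply]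
  calc _ = (1 + |z|) * (8 + 8 * |z| + 64 * |z| ^ 2) * Real.exp (-Real.pi * z ^ 2) := by ring
    _ ≤ _ := this
    _ = _ := by ring

lemma integrable_gaussDeriv (d : ℕ) : Integrable (gaussDeriv d) := by
  refine (integrable_one_add_mul_gaussDeriv d).mono
    (continuous_gaussDeriv d).aestronglyMeasurable (Eventually.of_forall fun z => ?_)
  rw [norm_mul]
  refine le_mul_of_one_le_left (norm_nonneg _) ?_
  rw [Real.norm_of_nonneg (by positivity)]
  linarith [abs_nonneg z]

open FourierTransform in
-- The Gaussian `exp(-πz²)` is its own Fourier transform, and each derivative contributes a factor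
-- `2πia`.
lemma fourier_gaussDeriv (d : ℕ) (hd : d ≤ 2) (a : ℝ) :
    𝓕 (fun z : ℝ => (gaussDeriv d z : ℂ)) a
      = (2 * Real.pi * Complex.I * a) ^ d * Complex.exp (-Real.pi * a ^ 2) := by
  have hI : ∀ d, Integrable fun z : ℝ => (gaussDeriv d z : ℂ) := fun d =>
    (integrable_gaussDeriv d).ofReal
  have step : ∀ d, (∀ z, HasDerivAt (gaussDeriv d) (gaussDeriv (d + 1) z) z) →
      𝓕 (fun z : ℝ => (gaussDeriv (d + 1) z : ℂ)) a
        = (2 * Real.pi * Complex.I * a) * 𝓕 (fun z : ℝ => (gaussDeriv d z : ℂ)) a := by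
    intro d h
    have h' : ∀ z, HasDerivAt (fun z : ℝ => (gaussDeriv d z : ℂ)) (gaussDeriv (d + 1) z : ℂ) z :=
      fun z => (h z).ofReal_comp
    have hder : deriv (fun z : ℝ => (gaussDeriv d z : ℂ)) = fun z => (gaussDeriv (d + 1) z : ℂ) :=
      funext fun z => (h' z).deriv
    have := congrFun (Real.fourier_deriv (hI d) (fun z => (h' z).differentiableAt)
      (by rw [hder]; exact hI _)) a
    rw [hder] at this
    simpa using this
  have h0 : 𝓕 (fun z : ℝ => (gaussDeriv 0 z : ℂ)) a = Complex.exp (-Real.pi * a ^ 2) := by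
    have := congrFun (fourier_gaussian_pi (b := 1) (by simp)) a
    simp only [mul_one, Complex.one_cpow, div_one, one_mul] at this
    rw [← this, show (fun z : ℝ => (gaussDeriv 0 z : ℂ))
      = fun x : ℝ => Complex.exp (-Real.pi * (x : ℂ) ^ 2) from funext fun z => by simp [gaussDeriv]]
  have h1 := step 0 hasDerivAt_gaussDeriv_zero
  have h2 := step 1 hasDerivAt_gaussDeriv_one
  interval_cases d
  · simp [h0]
  · rw [h1, h0]; ring
  · rw [h2, h1, h0]; ring

lemma integral_gaussDeriv_mul_exp (d : ℕ) (hd : d ≤ 2) (a : ℝ) :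
    ∫ z : ℝ, (gaussDeriv d z : ℂ) * Complex.exp (-(2 * Real.pi * Complex.I * a * z))
      = (2 * Real.pi * Complex.I * a) ^ d * Complex.exp (-Real.pi * a ^ 2) := by
  rw [← fourier_gaussDeriv d hd a, Real.fourier_eq']
  refine integral_congr_ae (Eventually.of_forall fun z => ?_)
  simp only [smul_eq_mul]
  rw [mul_comm]
  congr 2
  simp
  ring

/-- Order of differentiation of `∂ᵢ∂ⱼ` in the variable `l`. -/
def derivOrder (i j l : Fin 3) : ℕ := (if l = i then 1 else 0) + (if l = j then 1 else 0)

lemma derivOrder_le (i j l : Fin 3) : derivOrder i j l ≤ 2 := by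
  unfold derivOrder; split_ifs <;> norm_num

/-- `∂ᵢ∂ⱼ` of the Gaussian on `ℝ³`. -/
def heatKernel (i j : Fin 3) (z : Fin 3 → ℝ) : ℝ := ∏ l, gaussDeriv (derivOrder i j l) (z l)

lemma continuous_heatKernel (i j : Fin 3) : Continuous (heatKernel i j) :=
  continuous_finsetProd _ fun l _ => (continuous_gaussDeriv _).comp (continuous_apply l)

/-- The product `∏ (1 + |z_l|)` dominates `1 + ‖z‖`, which reduces the moment bound to one variable.
The extra moment is needed to integrate powers of the shift `√s z`. -/
lemma integrable_one_add_norm_mul_heatKernel (i j : Fin 3) :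
    Integrable fun z : Fin 3 → ℝ => (1 + ‖z‖) * heatKernel i j z := by
  have h := Integrable.fintype_prod
    (fun l : Fin 3 => integrable_one_add_mul_gaussDeriv (derivOrder i j l))
  refine h.mono (by have := continuous_heatKernel i j; fun_prop)
    (Eventually.of_forall fun z => ?_)
  simp only [Finset.prod_mul_distrib, norm_mul]
  rw [heatKernel]
  gcongr
  rw [Real.norm_of_nonneg (by positivity), Real.norm_of_nonneg (by positivity)]
  have hl : ∀ l, |z l| ≤ ∏ l, (1 + |z l|) - 1 := by
    intro l
    have h0 := abs_nonneg (z 0); have h1 := abs_nonneg (z 1); have h2 := abs_nonneg (z 2)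
    have := mul_nonneg h0 h1; have := mul_nonneg h1 h2; have := mul_nonneg h0 h2
    have := mul_nonneg (mul_nonneg h0 h1) h2
    simp only [Fin.prod_univ_three]
    fin_cases l <;> simp <;> nlinarith
  have : ‖z‖ ≤ ∏ l, (1 + |z l|) - 1 :=
    (pi_norm_le_iff_of_nonneg ((abs_nonneg _).trans (hl 0))).2 fun l => hl l
  linarith

lemma integrable_heatKernel (i j : Fin 3) : Integrable (heatKernel i j) := by
  refine (integrable_one_add_norm_mul_heatKernel i j).mono
    (continuous_heatKernel i j).aestronglyMeasurable (Eventually.of_forall fun z => ?_)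
  rw [norm_mul]
  refine le_mul_of_one_le_left (norm_nonneg _) ?_
  rw [Real.norm_of_nonneg (by positivity)]
  linarith [norm_nonneg z]

lemma integral_heatKernel_mul_exp (i j : Fin 3) (a : Fin 3 → ℝ) :
    ∫ z : Fin 3 → ℝ, (heatKernel i j z : ℂ) *
        ∏ l, Complex.exp (-(2 * Real.pi * Complex.I * a l * z l))
      = -(4 * Real.pi ^ 2 * a i * a j) * Complex.exp (-Real.pi * ∑ l, (a l : ℂ) ^ 2) := by
  simp only [heatKernel, Complex.ofReal_prod, ← Finset.prod_mul_distrib]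
  rw [integral_fintype_prod_volume_eq_prod (fun l z => (gaussDeriv (derivOrder i j l) z : ℂ) *
    Complex.exp (-(2 * Real.pi * Complex.I * a l * z)))]
  simp only [integral_gaussDeriv_mul_exp _ (derivOrder_le i j _), Finset.prod_mul_distrib]
  rw [← Complex.exp_sum, ← Finset.mul_sum]
  congr 1
  simp only [derivOrder, pow_add, pow_ite, pow_one, pow_zero, Finset.prod_mul_distrib,
    Finset.prod_ite_eq', Finset.mem_univ, if_true]
  linear_combination (4 * Real.pi ^ 2 * a i * a j : ℂ) * Complex.I_sq

end HeatKernel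

end

/-! ### Inverse Laplacian by heat flow and the `L¹` pressure estimate at a fixed time -/

section

open UnitAddTorus

/-- Parameter space of the heat-flow representation of the inverse Laplacian. -/
def heatMeasure : Measure (ℝ × (Fin 3 → ℝ)) := (volume.restrict (Ioc 0 1)).prod volume

instance : SFinite heatMeasure := by unfold heatMeasure; infer_instance

/-- Weight `s⁻¹ ∂ᵢ∂ⱼG(z)`. -/
def heatWeight (i j : Fin 3) (p : ℝ × (Fin 3 → ℝ)) : ℝ := p.1⁻¹ * heatKernel i j p.2

/-- Translation by `√s z`. -/
def heatShift (p : ℝ × (Fin 3 → ℝ)) : X3 := toTorus (√p.1 • p.2)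

lemma measurable_heatWeight (i j : Fin 3) : Measurable (heatWeight i j) :=
  measurable_fst.inv.mul ((continuous_heatKernel i j).measurable.comp measurable_snd)

lemma measurable_heatShift : Measurable heatShift :=
  measurable_toTorus.comp ((measurable_fst.sqrt).smul measurable_snd)

lemma integral_heatKernel (i j : Fin 3) : ∫ z, (heatKernel i j z : ℂ) = 0 := by
  have := integral_heatKernel_mul_exp i j 0
  simpa using this

/-- The two derivatives of the Gaussian, evaluated at frequency `√s n`, produce a factor `s` that
cancels the weight `s⁻¹`. Subtracting `1` is free because the kernel has integral zero. -/
lemma integral_heatWeight_slice (i j : Fin 3) (n : Fin 3 → ℤ) {s : ℝ} (hs : 0 < s) :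
    ∫ z, (heatWeight i j (s, z) : ℂ) * (mFourier (-n) (heatShift (s, z)) - 1)
      = ((-(4 * Real.pi ^ 2 * n i * n j) * Real.exp (-(Real.pi * nsq n * s)) : ℝ) : ℂ) := by
  have hk : Integrable fun z : Fin 3 → ℝ => (heatKernel i j z : ℂ) :=
    (integrable_heatKernel i j).ofReal
  have hbd : Integrable fun z : Fin 3 → ℝ => (heatKernel i j z : ℂ) *
      ∏ l, Complex.exp (-(2 * Real.pi * Complex.I * ((√s * n l : ℝ) : ℂ) * z l)) := by
    refine hk.mul_bdd (c := 1)
      (Continuous.aestronglyMeasurable (by fun_prop))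
      (Eventually.of_forall fun z => ?_)
    rw [norm_prod]
    refine Finset.prod_le_one (fun _ _ => norm_nonneg _) fun l _ => ?_
    rw [Complex.norm_exp]
    simp
  have h1 : ∀ z : Fin 3 → ℝ, (heatWeight i j (s, z) : ℂ) * (mFourier (-n) (heatShift (s, z)) - 1)
      = (s : ℂ)⁻¹ * ((heatKernel i j z : ℂ) *
        ∏ l, Complex.exp (-(2 * Real.pi * Complex.I * ((√s * n l : ℝ) : ℂ) * z l))
          - (heatKernel i j z : ℂ)) := by
    intro z
    rw [heatShift, mFourier_toTorus, heatWeight]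
    have : (∏ l, Complex.exp (2 * Real.pi * Complex.I * ((-n) l : ℤ) * ((√s • z) l : ℝ)))
      = ∏ l, Complex.exp (-(2 * Real.pi * Complex.I * ((√s * n l : ℝ) : ℂ) * z l)) := by
      refine Finset.prod_congr rfl fun l _ => ?_
      congr 1
      simp
      ring
    rw [this]
    push_cast
    ring
  simp only [h1]
  rw [integral_const_mul, integral_sub hbd hk,
    integral_heatKernel, sub_zero, integral_heatKernel_mul_exp i j (fun l => √s * n l)]
  have hsum : (∑ l, (((√s * n l : ℝ)) : ℂ) ^ 2) = ((s * nsq n : ℝ) : ℂ) := by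
    rw [nsq, Finset.mul_sum]
    push_cast
    refine Finset.sum_congr rfl fun l _ => ?_
    rw [mul_pow]
    congr 1
    exact_mod_cast Real.sq_sqrt hs.le
  rw [hsum]
  have hsq : ((√s : ℝ) : ℂ) * (√s : ℝ) = s := by exact_mod_cast Real.mul_self_sqrt hs.le
  have hs' : (s : ℂ) ≠ 0 := by exact_mod_cast hs.ne'
  have he : Complex.exp (-Real.pi * ((s * nsq n : ℝ) : ℂ))
      = ((Real.exp (-(Real.pi * nsq n * s)) : ℝ) : ℂ) := by
    push_cast
    congr 1
    ring
  rw [he]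
  push_cast
  field_simp
  linear_combination (-(n i * n j : ℂ)) * hsq

/-- The factor `nsq n` stays on the left so that `n = 0` needs no separate treatment. -/
lemma nsq_mul_integral_exp (n : Fin 3 → ℤ) :
    nsq n * ∫ s in Ioc (0 : ℝ) 1, Real.exp (-(Real.pi * nsq n * s))
      = Real.pi⁻¹ * (1 - Real.exp (-(Real.pi * nsq n))) := by
  rw [← intervalIntegral.integral_of_le zero_le_one, ← intervalIntegral.integral_const_mul]
  have h : ∀ s ∈ uIcc (0 : ℝ) 1, HasDerivAt
      (fun s => -Real.pi⁻¹ * Real.exp (-(Real.pi * nsq n * s)))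
      (nsq n * Real.exp (-(Real.pi * nsq n * s))) s := by
    intro s _
    have := ((((hasDerivAt_id s).const_mul (Real.pi * nsq n)).neg).exp).const_mul (-Real.pi⁻¹)
    refine this.congr_deriv ?_
    have := Real.pi_pos.ne'
    simp
    field_simp
  rw [intervalIntegral.integral_eq_sub_of_hasDerivAt h (by
    apply Continuous.intervalIntegrable; fun_prop)]
  simp
  ring

/-- Away from `n = 0` the symbol is that of `∂ᵢ∂ⱼΔ⁻¹`, up to the constant `-4π`, damped by `1 -
exp(-π|n|²)`. The heat flow is stopped at `s = 1`, so a rapidly decaying low-frequency remainder is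
left. -/
lemma nsq_mul_heatSymbol (i j : Fin 3) (n : Fin 3 → ℤ)
    (h : Integrable (fun p => (heatWeight i j p : ℂ) * (mFourier (-n) (heatShift p) - 1))
      heatMeasure) :
    (nsq n : ℂ) * ∫ p, (heatWeight i j p : ℂ) * (mFourier (-n) (heatShift p) - 1) ∂heatMeasure
      = -(4 * Real.pi * (1 - Real.exp (-(Real.pi * nsq n)))) * (n i * n j) := by
  rw [heatMeasure] at h ⊢
  rw [integral_prod _ h, setIntegral_congr_fun measurableSet_Ioc
    (fun s hs => integral_heatWeight_slice i j n hs.1), integral_complex_ofReal,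
    integral_const_mul]
  have := nsq_mul_integral_exp n
  rw [← Complex.ofReal_mul, mul_left_comm, this]
  have hp : (Real.pi : ℂ) ≠ 0 := by exact_mod_cast Real.pi_pos.ne'
  push_cast
  field_simp

/-- Constant in the low-frequency part of the pressure estimate. -/
def lowFreqConst : ℝ := ∑' n : Fin 3 → ℤ, Real.exp (-(Real.pi * nsq n))

/-- `L¹` estimate for the solution of `-Δr = ∂ᵢ∂ⱼDᵢⱼ` on the torus. -/
theorem lintegral_enorm_pressure_le {r : X3 → ℂ} {D : Fin 3 → Fin 3 → X3 → ℂ}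
    (hr : Integrable r torusMeasure) (hD : ∀ i j, Measurable (D i j))
    (hDi : ∀ i j, Integrable (D i j) torusMeasure) (hr0 : tcoef r 0 = 0)
    (hrel : ∀ n, (nsq n : ℂ) * tcoef r n = -∑ i, ∑ j, (n i * n j : ℂ) * tcoef (D i j) n) :
    ∫⁻ θ, ‖r θ‖ₑ ∂torusMeasure ≤
      ENNReal.ofReal lowFreqConst * ∑ i, ∑ j, ∫⁻ θ, ‖D i j θ‖ₑ ∂torusMeasure
        + ∑ i, ∑ j, diffMod heatMeasure (heatWeight i j) heatShift (D i j) := by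
  -- If one of the moduli is infinite, the right-hand side is `⊤` and there is nothing to prove.
  by_cases hJ : ∀ i j, diffMod heatMeasure (heatWeight i j) heatShift (D i j) ≠ ⊤
  swap
  · push Not at hJ
    obtain ⟨i, j, hij⟩ := hJ
    have : ∑ i, ∑ j, diffMod heatMeasure (heatWeight i j) heatShift (D i j) = ⊤ := by
      refine ENNReal.sum_eq_top.2 ⟨i, Finset.mem_univ _, ?_⟩
      exact ENNReal.sum_eq_top.2 ⟨j, Finset.mem_univ _, hij⟩
    simp [this]
  set W : Fin 3 → Fin 3 → X3 → ℂ := fun i j =>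
    diffOp heatMeasure (heatWeight i j) heatShift (D i j) with hW
  have hWi : ∀ i j, Integrable (W i j) torusMeasure := fun i j =>
    integrable_diffOp (measurable_heatWeight i j) measurable_heatShift (hD i j) (hJ i j)
  have hWs : Integrable (fun θ => ∑ i, ∑ j, W i j θ) torusMeasure :=
    integrable_finsetSum _ fun i _ => integrable_finsetSum _ fun j _ => hWi i j
  have hWc : ∀ i j n, (nsq n : ℂ) * tcoef (W i j) n
      = -(4 * Real.pi * (1 - Real.exp (-(Real.pi * nsq n)))) * (n i * n j * tcoef (D i j) n) := by
    intro i j n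
    simp only [hW]
    rw [tcoef_diffOp (measurable_heatWeight i j) measurable_heatShift (hD i j) (hDi i j) (hJ i j)]
    by_cases h0 : tcoef (D i j) n = 0
    · simp [h0]
    · have := nsq_mul_heatSymbol i j n (integrable_symbol (measurable_heatWeight i j)
        measurable_heatShift (hD i j) (hDi i j) (hJ i j) h0)
      rw [← mul_assoc, this]
      ring
  have hWc0 : ∀ i j, tcoef (W i j) 0 = 0 := by
    intro i j
    simp only [hW]
    rw [tcoef_diffOp (measurable_heatWeight i j) measurable_heatShift (hD i j) (hDi i j) (hJ i j)]
    simp [mFourier_zero]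
  -- Combining the symbol with the pressure relation shows that the difference operators recover all
  -- of `r̂(n)` except the fraction `exp(-π|n|²)`.
  have hWsc : ∀ n, tcoef (fun θ => ∑ i, ∑ j, W i j θ) n
      = 4 * Real.pi * (1 - Real.exp (-(Real.pi * nsq n))) * tcoef r n := by
    intro n
    rw [tcoef_finset_sum _ fun i _ => integrable_finsetSum _ fun j _ => hWi i j]
    simp only [tcoef_finset_sum _ fun j _ => hWi _ j]
    by_cases hn : n = 0
    · subst hn
      simp [hWc0, hr0]
    · have hN : (nsq n : ℂ) ≠ 0 := by exact_mod_cast (nsq_pos hn).ne'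
      refine mul_left_cancel₀ hN ?_
      rw [mul_left_comm, hrel]
      simp only [Finset.mul_sum, hWc, mul_neg, ← Finset.sum_neg_distrib]
      refine Finset.sum_congr rfl fun i _ => Finset.sum_congr rfl fun j _ => ?_
      ring
  set S : ℝ := ∑ i, ∑ j, ∫ θ, ‖D i j θ‖ ∂torusMeasure with hS
  have hS0 : 0 ≤ S := Finset.sum_nonneg fun i _ => Finset.sum_nonneg fun j _ =>
    integral_nonneg fun _ => norm_nonneg _
  -- Since `|nᵢnⱼ| ≤ |n|²`, each coefficient of `r` is bounded by the `L¹` norms of the `D i j`;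
  -- this controls the remainder.
  have hrb : ∀ n, ‖tcoef r n‖ ≤ S := by
    intro n
    by_cases hn : n = 0
    · subst hn; simpa [hr0] using hS0
    · have hN := nsq_pos hn
      have h1 : nsq n * ‖tcoef r n‖ ≤ nsq n * S := by
        have : nsq n * ‖tcoef r n‖ = ‖(nsq n : ℂ) * tcoef r n‖ := by
          rw [norm_mul, Complex.norm_real, Real.norm_of_nonneg hN.le]
        rw [this, hrel, norm_neg, hS, Finset.mul_sum]
        refine (norm_sum_le _ _).trans (Finset.sum_le_sum fun i _ => ?_)
        rw [Finset.mul_sum]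
        refine (norm_sum_le _ _).trans (Finset.sum_le_sum fun j _ => ?_)
        rw [norm_mul]
        refine mul_le_mul ?_ (norm_tcoef_le _ _) (norm_nonneg _) hN.le
        have := abs_mul_le_nsq n i j
        rw [← Real.norm_eq_abs, ← Complex.norm_real] at this
        simpa using this
      exact le_of_mul_le_mul_left h1 hN
  set c : (Fin 3 → ℤ) → ℂ := fun n => (Real.exp (-(Real.pi * nsq n)) : ℂ) * tcoef r n with hc
  have hcb : ∀ n, ‖c n‖ ≤ Real.exp (-(Real.pi * nsq n)) * S := fun n => by
    simp only [hc]
    simp only [norm_mul, Complex.norm_real, Real.norm_of_nonneg (Real.exp_pos _).le]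
    gcongr
    exact hrb n
  have hcs : Summable fun n => ‖c n‖ :=
    Summable.of_nonneg_of_le (fun _ => norm_nonneg _) hcb (summable_exp_neg_nsq.mul_right S)
  have hVi : Integrable (fun θ => ∑' m, c m * mFourier m θ) torusMeasure :=
    Integrable.of_bound (continuous_tsum_mFourier hcs).aestronglyMeasurable (∑' m, ‖c m‖)
      (Eventually.of_forall fun θ => norm_tsum_mFourier_le hcs θ)
  have hpi : (4 * Real.pi : ℂ) ≠ 0 := by
    have := Real.pi_pos.ne'
    exact_mod_cast mul_ne_zero four_ne_zero this
  have hrW : Integrable (fun θ => r θ - (4 * Real.pi : ℂ)⁻¹ * (∑ i, ∑ j, W i j θ)) torusMeasure :=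
    hr.sub (hWs.const_mul _)
  -- Decomposition `r = (4π)⁻¹ ∑ W + V`, where `V` has coefficients `exp(-π|n|²) r̂(n)`; both sides
  -- have the same Fourier coefficients. The factor `(4π)⁻¹ ≤ 1` is dropped in the final bound.
  have hz := ae_eq_zero_of_tcoef_eq_zero
    (g := fun θ => r θ - (4 * Real.pi : ℂ)⁻¹ * (∑ i, ∑ j, W i j θ) - ∑' m, c m * mFourier m θ)
    (hrW.sub hVi) (fun n => by
      rw [tcoef_sub hrW hVi, tcoef_sub hr (hWs.const_mul _),
        tcoef_const_mul, tcoef_tsum hcs, hWsc]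
      simp only [hc]
      field_simp
      ring)
  have hVb : ∀ θ, ‖∑' m, c m * mFourier m θ‖ ≤ lowFreqConst * S := fun θ => by
    refine (norm_tsum_mFourier_le hcs θ).trans ?_
    rw [lowFreqConst, ← tsum_mul_right]
    exact hcs.tsum_le_tsum hcb (summable_exp_neg_nsq.mul_right S)
  have hSe : ENNReal.ofReal S = ∑ i, ∑ j, ∫⁻ θ, ‖D i j θ‖ₑ ∂torusMeasure := by
    rw [hS, ENNReal.ofReal_sum_of_nonneg fun i _ => Finset.sum_nonneg fun j _ =>
      integral_nonneg fun _ => norm_nonneg _]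
    refine Finset.sum_congr rfl fun i _ => ?_
    rw [ENNReal.ofReal_sum_of_nonneg fun j _ => integral_nonneg fun _ => norm_nonneg _]
    exact Finset.sum_congr rfl fun j _ => ofReal_integral_norm_eq_lintegral_enorm (hDi i j)
  have hlc : 0 ≤ lowFreqConst := tsum_nonneg fun _ => (Real.exp_pos _).le
  have hae : ∀ᵐ θ ∂torusMeasure, ‖r θ‖ₑ ≤
      ENNReal.ofReal (lowFreqConst * S) + ∑ i, ∑ j, ‖W i j θ‖ₑ := by
    filter_upwards [hz] with θ hθ
    have e : r θ = ∑' m, c m * mFourier m θ + (4 * Real.pi : ℂ)⁻¹ * ∑ i, ∑ j, W i j θ := by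
      simp only [Pi.zero_apply] at hθ
      linear_combination hθ
    rw [e]
    refine (enorm_add_le _ _).trans (add_le_add ?_ ?_)
    · rw [← ofReal_norm]
      exact ENNReal.ofReal_le_ofReal (hVb θ)
    · rw [enorm_mul]
      refine (mul_le_of_le_one_left (zero_le) ?_).trans
        ((enorm_sum_le _ _).trans (Finset.sum_le_sum fun i _ => enorm_sum_le _ _))
      rw [← ofReal_norm]
      refine ENNReal.ofReal_le_one.2 ?_
      rw [norm_inv, norm_mul, Complex.norm_real, Real.norm_of_nonneg Real.pi_pos.le]
      refine inv_le_one_of_one_le₀ ?_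
      norm_num
      linarith [Real.pi_gt_three]
  refine (lintegral_mono_ae hae).trans ?_
  rw [lintegral_add_left measurable_const, lintegral_const, measure_univ, mul_one,
    ENNReal.ofReal_mul hlc, hSe]
  refine add_le_add le_rfl ?_
  rw [lintegral_finsetSum' _ fun i _ => Finset.aemeasurable_fun_sum _ fun j _ =>
    (hWi i j).1.enorm]
  refine Finset.sum_le_sum fun i _ => ?_
  rw [lintegral_finsetSum' _ fun j _ => (hWi i j).1.enorm]
  exact Finset.sum_le_sum fun j _ =>
    lintegral_enorm_diffOp_le (measurable_heatWeight i j) measurable_heatShift (hD i j)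

end

/-! ### Spectral decay in space-time and the modulus of continuity under translations -/

section

open UnitAddTorus

/-- Lebesgue measure on the time interval `[0,T)`. -/
abbrev timeMeasure (T : ℝ) : Measure ℝ := volume.restrict (Ico 0 T)

/-- The product measure on `[0,T) × X3`. -/
def torusSlab (T : ℝ) : Measure (ℝ × X3) := (timeMeasure T).prod torusMeasure

/-- Fourier coefficients in space of a function of time and space. -/
def scoef (g : ℝ × X3 → ℂ) (t : ℝ) (n : Fin 3 → ℤ) : ℂ := tcoef (fun θ => g (t, θ)) n

variable {T : ℝ}

lemma aestronglyMeasurable_scoef {g : ℝ × X3 → ℂ} (hg : AEStronglyMeasurable g (torusSlab T))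
    (n : Fin 3 → ℤ) : AEStronglyMeasurable (fun t => scoef g t n) (timeMeasure T) := by
  have : AEStronglyMeasurable (fun p : ℝ × X3 => mFourier (-n) p.2 * g p)
      ((timeMeasure T).prod torusMeasure) :=
    (((mFourier (-n)).continuous.comp continuous_snd).aestronglyMeasurable).mul hg
  exact this.integral_prod_right'

lemma memLp_two_slice {g : ℝ × X3 → ℂ} (hg : MemLp g 2 (torusSlab T)) :
    ∀ᵐ t ∂timeMeasure T, MemLp (fun θ => g (t, θ)) 2 torusMeasure := by
  have h1 := (memLp_two_iff_integrable_sq_norm hg.1).1 hg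
  have h2 := hg.1
  rw [torusSlab] at h1 h2
  filter_upwards [h1.prod_right_ae, h2.prodMk_left] with t ht ht2
  exact (memLp_two_iff_integrable_sq_norm ht2).2 ht

lemma lintegral_torusSlab {F : ℝ × X3 → ℝ≥0∞} (hF : AEMeasurable F (torusSlab T)) :
    ∫⁻ p, F p ∂torusSlab T = ∫⁻ t, ∫⁻ θ, F (t, θ) ∂torusMeasure ∂timeMeasure T :=
  lintegral_prod _ hF

lemma lintegral_slab_enorm_sq {g : ℝ × X3 → ℂ} (hg : MemLp g 2 (torusSlab T)) :
    ∫⁻ p, ‖g p‖ₑ ^ 2 ∂torusSlab T = ∑' n, ∫⁻ t, ‖scoef g t n‖ₑ ^ 2 ∂timeMeasure T := by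
  rw [lintegral_torusSlab (hg.1.enorm.pow_const 2), ← lintegral_tsum fun n =>
    (aestronglyMeasurable_scoef hg.1 n).enorm.pow_const 2]
  refine lintegral_congr_ae ?_
  filter_upwards [memLp_two_slice hg] with t ht
  exact lintegral_enorm_sq_eq_tsum ht

/-- Partial Fourier sum over a finite set of frequencies. -/
def trunc (F : Finset (Fin 3 → ℤ)) (g : ℝ × X3 → ℂ) (p : ℝ × X3) : ℂ :=
  ∑ m ∈ F, scoef g p.1 m * mFourier m p.2

lemma aestronglyMeasurable_trunc (F : Finset (Fin 3 → ℤ)) {g : ℝ × X3 → ℂ}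
    (hg : AEStronglyMeasurable g (torusSlab T)) :
    AEStronglyMeasurable (trunc F g) (torusSlab T) := by
  refine Finset.aestronglyMeasurable_fun_sum _ fun m _ => ?_
  exact ((aestronglyMeasurable_scoef hg m).comp_fst).mul
    (((mFourier m).continuous.comp continuous_snd).aestronglyMeasurable)

lemma lintegral_slab_sub_trunc_sq {g : ℝ × X3 → ℂ} (hg : MemLp g 2 (torusSlab T))
    (F : Finset (Fin 3 → ℤ)) :
    ∫⁻ p, ‖g p - trunc F g p‖ₑ ^ 2 ∂torusSlab T
      = ∑' n, if n ∈ F then 0 else ∫⁻ t, ‖scoef g t n‖ₑ ^ 2 ∂timeMeasure T := by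
  have e : ∀ n, (if n ∈ F then 0 else ∫⁻ t, ‖scoef g t n‖ₑ ^ 2 ∂timeMeasure T)
      = ∫⁻ t, (if n ∈ F then 0 else ‖scoef g t n‖ₑ ^ 2) ∂timeMeasure T := fun n => by
    split_ifs <;> simp
  simp only [e]
  rw [lintegral_torusSlab (F := fun p => ‖g p - trunc F g p‖ₑ ^ 2)
      ((hg.1.sub (aestronglyMeasurable_trunc F hg.1)).enorm.pow_const 2),
    ← lintegral_tsum fun n => by
      split_ifs
      · exact aemeasurable_const
      · exact (aestronglyMeasurable_scoef hg.1 n).enorm.pow_const 2]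
  refine lintegral_congr_ae ?_
  filter_upwards [memLp_two_slice hg] with t ht
  exact lintegral_enorm_sub_trunc_sq ht F

/-- Square-integrable functions whose Fourier coefficients decay like `|n|^{-(3+β)}` in the mean. -/
structure HasSpectralDecay (T β C : ℝ) (g : ℝ × X3 → ℂ) : Prop where
  memLp : MemLp g 2 (torusSlab T)
  decay : ∀ n, ∫⁻ t, ‖scoef g t n‖ₑ ^ 2 ∂timeMeasure T
    ≤ ENNReal.ofReal (C * (1 + ‖n‖) ^ (-(3 + β)))

/-- The sum of the weights `(1 + |n|)^{-(3+β/2)}`. -/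
def weightSum (β : ℝ) : ℝ := ∑' n : Fin 3 → ℤ, (1 + ‖n‖) ^ (-(3 + β / 2))

lemma weightSum_nonneg (β : ℝ) : 0 ≤ weightSum β := tsum_nonneg fun _ => by positivity

lemma tsum_ofReal_weight {β : ℝ} (hβ : 0 < β) {C : ℝ} (hC : 0 ≤ C) :
    ∑' n : Fin 3 → ℤ, ENNReal.ofReal (C * (1 + ‖n‖) ^ (-(3 + β / 2)))
      = ENNReal.ofReal (C * weightSum β) := by
  rw [weightSum, ← tsum_mul_left, ENNReal.ofReal_tsum_of_nonneg (fun _ => by positivity)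
    ((summable_one_add_norm_rpow (by linarith)).mul_left C)]

/-- Half of the surplus exponent `β` pays for summability over the lattice; the other half remains
as a gain at high frequencies. -/
lemma weight_split {β : ℝ} (n : Fin 3 → ℤ) :
    (1 + ‖n‖) ^ (-(3 + β)) = (1 + ‖n‖) ^ (-(3 + β / 2)) * (1 + ‖n‖) ^ (-(β / 2)) := by
  rw [← Real.rpow_add (by positivity)]
  congr 1; ring

namespace HasSpectralDecay

variable {β C : ℝ} {g : ℝ × X3 → ℂ}

lemma lintegral_sq_le (h : HasSpectralDecay T β C g) (hβ : 0 < β) (hC : 0 ≤ C) :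
    ∫⁻ p, ‖g p‖ₑ ^ 2 ∂torusSlab T ≤ ENNReal.ofReal (C * weightSum β) := by
  rw [lintegral_slab_enorm_sq h.memLp, ← tsum_ofReal_weight hβ hC]
  refine ENNReal.tsum_le_tsum fun n => (h.decay n).trans (ENNReal.ofReal_le_ofReal ?_)
  gcongr
  · linarith [norm_nonneg n]
  · linarith

lemma lintegral_sub_trunc_le (h : HasSpectralDecay T β C g) (hβ : 0 < β) (hC : 0 ≤ C)
    (F : Finset (Fin 3 → ℤ)) {N : ℝ} (hN : 0 < N) (hF : ∀ n ∉ F, N ≤ 1 + ‖n‖) :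
    ∫⁻ p, ‖g p - trunc F g p‖ₑ ^ 2 ∂torusSlab T
      ≤ ENNReal.ofReal (C * N ^ (-(β / 2)) * weightSum β) := by
  rw [lintegral_slab_sub_trunc_sq h.memLp, ← tsum_ofReal_weight hβ (by positivity)]
  refine ENNReal.tsum_le_tsum fun n => ?_
  split_ifs with hn
  · exact zero_le
  · refine (h.decay n).trans (ENNReal.ofReal_le_ofReal ?_)
    rw [weight_split, mul_assoc, mul_comm ((1 + ‖n‖) ^ (-(3 + β / 2)))]
    gcongr ?_ * (?_ * ?_)
    exact Real.rpow_le_rpow_of_nonpos hN (hF n hn) (by linarith)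

lemma sub {g' : ℝ × X3 → ℂ} {C' : ℝ} (h : HasSpectralDecay T β C g)
    (h' : HasSpectralDecay T β C' g') :
    ∫⁻ p, ‖g p - g' p‖ₑ ^ 2 ∂torusSlab T
      = ∑' n, ∫⁻ t, ‖scoef g t n - scoef g' t n‖ₑ ^ 2 ∂timeMeasure T := by
  rw [lintegral_slab_enorm_sq (g := fun p => g p - g' p) (h.memLp.sub h'.memLp)]
  refine tsum_congr fun n => lintegral_congr_ae ?_
  filter_upwards [memLp_two_slice h.memLp, memLp_two_slice h'.memLp] with t ht ht'
  simp only [scoef]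
  rw [tcoef_sub (ht.integrable one_le_two) (ht'.integrable one_le_two)]

/-- The chord of the unit circle is shorter than the arc `2π |n·y|`, and in sup norms `|n·y| ≤ 3 ‖n‖
‖y‖`. -/
lemma norm_mFourier_sub_one_le (n : Fin 3 → ℤ) (y : Fin 3 → ℝ) :
    ‖mFourier (-n) (toTorus y) - 1‖ ≤ 6 * Real.pi * (‖n‖ * ‖y‖) := by
  have e : mFourier (-n) (toTorus y)
      = Complex.exp (Complex.I * ((-(2 * Real.pi * ∑ l, (n l : ℝ) * y l) : ℝ) : ℂ)) := by
    rw [mFourier_toTorus, ← Complex.exp_sum]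
    congr 1
    push_cast
    rw [Finset.mul_sum, ← Finset.sum_neg_distrib, Finset.mul_sum]
    refine Finset.sum_congr rfl fun l _ => ?_
    simp; ring
  rw [e]
  refine (Real.norm_exp_I_mul_ofReal_sub_one_le).trans ?_
  rw [norm_neg, norm_mul, Real.norm_of_nonneg (by positivity)]
  have : ‖∑ l, (n l : ℝ) * y l‖ ≤ ∑ _l : Fin 3, ‖n‖ * ‖y‖ := by
    refine (norm_sum_le _ _).trans (Finset.sum_le_sum fun l _ => ?_)
    rw [norm_mul]
    exact mul_le_mul (abs_le_norm n l) (norm_le_pi_norm y l) (norm_nonneg _) (norm_nonneg _)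
  simp only [Finset.sum_const, Finset.card_univ, Fintype.card_fin, nsmul_eq_mul] at this
  have hp := Real.pi_pos
  push_cast at this
  nlinarith [mul_le_mul_of_nonneg_left this (by positivity : 0 ≤ 2 * Real.pi)]

/-- Interpolates between the trivial bound `a ≤ 2`, used when `x ≥ 1`, and `a ≤ x`, used when `x ≤
1`. -/
lemma sq_le_rpow_of_le {a x γ : ℝ} (ha0 : 0 ≤ a) (ha2 : a ≤ 2) (hax : a ≤ x) (hγ0 : 0 ≤ γ)
    (hγ : γ ≤ 2) : a ^ 2 ≤ 4 * x ^ γ := by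
  have hx : 0 ≤ x := ha0.trans hax
  rcases le_total 1 x with h1 | h1
  · have := Real.one_le_rpow h1 hγ0
    nlinarith
  · calc a ^ 2 ≤ x ^ 2 := by gcongr
      _ = x ^ (2 : ℝ) := by norm_cast
      _ ≤ x ^ γ := by
        rcases hx.eq_or_lt with h0 | h0
        · subst h0
          rw [Real.zero_rpow two_ne_zero]
          exact Real.rpow_nonneg le_rfl _
        · exact Real.rpow_le_rpow_of_exponent_ge h0 h1 hγ
      _ ≤ 4 * x ^ γ := by linarith [Real.rpow_nonneg hx γ]

/-- By Parseval the squared difference carries weights `|e^{-2πi n·y} - 1|²`, at most a constant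
times `(‖n‖ ‖y‖)^{β/2}`. This growth in `n` uses half of the surplus, and the exponent `-(3 + β/2)`
that is left is still summable. -/
lemma lintegral_translate_le (h : HasSpectralDecay T β C g) (hβ : 0 < β) (hβ1 : β ≤ 1)
    (hC : 0 ≤ C) (hg : Measurable g) (y : Fin 3 → ℝ) :
    ∫⁻ p, ‖g (p.1, p.2 - toTorus y) - g p‖ₑ ^ 2 ∂torusSlab T
      ≤ ENNReal.ofReal (4 * (6 * Real.pi * ‖y‖) ^ (β / 2) * C * weightSum β) := by
  have hm : Measurable fun p : ℝ × X3 => g (p.1, p.2 - toTorus y) - g p :=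
    (hg.comp (measurable_fst.prodMk (measurable_snd.sub_const _))).sub hg
  rw [lintegral_torusSlab (hm.enorm.pow_const 2).aemeasurable]
  have e : ∀ᵐ t ∂timeMeasure T, ∫⁻ θ, ‖g (t, θ - toTorus y) - g (t, θ)‖ₑ ^ 2 ∂torusMeasure
      = ∑' n, ‖mFourier (-n) (toTorus y) - 1‖ₑ ^ 2 * ‖scoef g t n‖ₑ ^ 2 := by
    filter_upwards [memLp_two_slice h.memLp] with t ht
    have ht' : MemLp (fun θ => g (t, θ - toTorus y)) 2 torusMeasure :=
      ht.comp_measurePreserving (measurePreserving_sub_right torusMeasure (toTorus y))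
    rw [lintegral_enorm_sq_eq_tsum (g := fun θ => g (t, θ - toTorus y) - g (t, θ)) (ht'.sub ht)]
    refine tsum_congr fun n => ?_
    rw [tcoef_sub (ht'.integrable one_le_two) (ht.integrable one_le_two),
      tcoef_translate (fun θ => g (t, θ)), scoef, ← mul_pow, ← enorm_mul]
    congr 2
    ring
  simp only at e ⊢
  rw [lintegral_congr_ae e, lintegral_tsum fun n =>
    ((aestronglyMeasurable_scoef h.memLp.1 n).enorm.pow_const 2).const_mul _,
    ← tsum_ofReal_weight hβ (by positivity)]
  refine ENNReal.tsum_le_tsum fun n => ?_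
  rw [lintegral_const_mul'' _ ((aestronglyMeasurable_scoef h.memLp.1 n).enorm.pow_const 2),
    ← ofReal_norm, ← ENNReal.ofReal_pow (norm_nonneg _)]
  refine (mul_le_mul_right (h.decay n) _).trans ?_
  rw [← ENNReal.ofReal_mul (by positivity)]
  refine ENNReal.ofReal_le_ofReal ?_
  have h2 : ‖mFourier (-n) (toTorus y) - 1‖ ≤ 2 := by
    refine (norm_sub_le _ _).trans ?_
    rw [norm_mFourier_apply]
    norm_num
  have h3 := sq_le_rpow_of_le (norm_nonneg _) h2 (norm_mFourier_sub_one_le n y)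
    (by positivity : 0 ≤ β / 2) (by linarith)
  have h4 : (6 * Real.pi * (‖n‖ * ‖y‖)) ^ (β / 2)
      ≤ (6 * Real.pi * ‖y‖) ^ (β / 2) * (1 + ‖n‖) ^ (β / 2) := by
    rw [← Real.mul_rpow (by positivity) (by positivity)]
    refine Real.rpow_le_rpow (by positivity) ?_ (by positivity)
    have : 0 ≤ 6 * Real.pi * ‖y‖ := by positivity
    nlinarith
  have h5 : (1 + ‖n‖) ^ (β / 2) * (1 + ‖n‖) ^ (-(3 + β)) = (1 + ‖n‖) ^ (-(3 + β / 2)) := by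
    rw [← Real.rpow_add (by positivity)]
    congr 1; ring
  calc _ ≤ 4 * ((6 * Real.pi * ‖y‖) ^ (β / 2) * (1 + ‖n‖) ^ (β / 2))
        * (C * (1 + ‖n‖) ^ (-(3 + β))) := by gcongr; exact h3.trans (by gcongr)
    _ = 4 * (6 * Real.pi * ‖y‖) ^ (β / 2) * C
        * ((1 + ‖n‖) ^ (β / 2) * (1 + ‖n‖) ^ (-(3 + β))) := by ring
    _ = _ := by rw [h5]

end HasSpectralDecay

end

/-! ### Higher integrability from spectral decay, and a Cauchy criterion in `L²` -/

section

open UnitAddTorus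

variable {T : ℝ}

/-- The cube of frequencies of size `2^l`. -/
def freqCube (l : ℕ) : Finset (Fin 3 → ℤ) := Finset.Icc (fun _ => -(2 ^ l)) (fun _ => 2 ^ l)

lemma le_of_notMem_freqCube {l : ℕ} {n : Fin 3 → ℤ} (hn : n ∉ freqCube l) :
    (2 : ℝ) ^ l ≤ 1 + ‖n‖ := by
  by_contra! hlt
  refine hn (Finset.mem_Icc.2 ⟨fun j => ?_, fun j => ?_⟩)
  · have h := (neg_abs_le (n j : ℝ)).trans' (neg_le_neg (abs_le_norm n j))
    have : (-(2 ^ l) : ℝ) ≤ n j := by linarith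
    exact_mod_cast this
  · have h := (le_abs_self (n j : ℝ)).trans (abs_le_norm n j)
    have : (n j : ℝ) ≤ 2 ^ l := by linarith
    exact_mod_cast this

lemma card_freqCube_le (l : ℕ) : ((freqCube l).card : ℝ) ≤ 27 * 8 ^ l := by
  have h : (freqCube l).card = (2 * 2 ^ l + 1) ^ 3 := by
    rw [freqCube, Pi.card_Icc]
    simp only [Int.card_Icc, Finset.prod_const, Finset.card_univ, Fintype.card_fin]
    congr 1
    have : (2 ^ l + 1 - -2 ^ l : ℤ) = ((2 * 2 ^ l + 1 : ℕ) : ℤ) := by push_cast; ring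
    rw [this, Int.toNat_natCast]
  rw [h]
  push_cast
  have h1 : (1 : ℝ) ≤ 2 ^ l := one_le_pow₀ (by norm_num)
  -- The side `2·2^l + 1` is at most `3·2^l`, hence the factor `27·8^l`.
  calc ((2 * 2 ^ l + 1 : ℝ)) ^ 3 ≤ (3 * 2 ^ l) ^ 3 := by gcongr; linarith
    _ = 27 * 8 ^ l := by
      rw [mul_pow, ← pow_mul, mul_comm l 3, pow_mul]; norm_num

lemma norm_trunc_le {g : ℝ × X3 → ℂ} {M : ℝ} {p : ℝ × X3} (h : ∀ n, ‖scoef g p.1 n‖ ≤ M)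
    (F : Finset (Fin 3 → ℤ)) : ‖trunc F g p‖ ≤ F.card * M := by
  refine (norm_sum_le _ _).trans ?_
  rw [← nsmul_eq_mul, ← Finset.sum_const]
  refine Finset.sum_le_sum fun m _ => ?_
  rw [norm_mul, norm_mFourier_apply, mul_one]
  exact h m

/-- Amplitude thresholds. -/
def ampl (M : ℝ) (l : ℕ) : ℝ := 54 * 8 ^ l * M

/-- The threshold `54·8^l·M` is twice the largest possible value of the truncation to `freqCube l`.
Above it at least half of `|g|` comes from the tail, whose `L²` norm is controlled by spectral
decay. -/
lemma lintegral_large_values_le {β C M : ℝ} {g : ℝ × X3 → ℂ} (h : HasSpectralDecay T β C g)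
    (hβ : 0 < β) (hC : 0 ≤ C) (hM : 0 ≤ M) (hg : ∀ᵐ t ∂timeMeasure T, ∀ n, ‖scoef g t n‖ ≤ M)
    (l : ℕ) :
    ∫⁻ p, (if ampl M l < ‖g p‖ then ‖g p‖ₑ ^ 2 else 0) ∂torusSlab T
      ≤ ENNReal.ofReal (4 * (C * (2 ^ l) ^ (-(β / 2)) * weightSum β)) := by
  have hae : ∀ᵐ p ∂torusSlab T, ∀ n, ‖scoef g p.1 n‖ ≤ M :=
    Measure.quasiMeasurePreserving_fst.ae hg
  have h1 : ∀ᵐ p ∂torusSlab T, (if ampl M l < ‖g p‖ then ‖g p‖ₑ ^ 2 else 0)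
      ≤ ENNReal.ofReal 4 * ‖g p - trunc (freqCube l) g p‖ₑ ^ 2 := by
    filter_upwards [hae] with p hp
    split_ifs with hlt
    · have ht := norm_trunc_le hp (freqCube l)
      have hc := mul_le_mul_of_nonneg_right (card_freqCube_le l) hM
      rw [ampl] at hlt
      have h3 : ‖g p‖ ≤ 2 * ‖g p - trunc (freqCube l) g p‖ := by
        have := norm_le_norm_sub_add (g p) (trunc (freqCube l) g p)
        linarith
      rw [← ofReal_norm, ← ofReal_norm, ← ENNReal.ofReal_pow (norm_nonneg _),
        ← ENNReal.ofReal_pow (norm_nonneg _), ← ENNReal.ofReal_mul (by norm_num)]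
      refine ENNReal.ofReal_le_ofReal ?_
      calc ‖g p‖ ^ 2 ≤ (2 * ‖g p - trunc (freqCube l) g p‖) ^ 2 := by gcongr
        _ = _ := by ring
    · exact zero_le
  refine (lintegral_mono_ae h1).trans ?_
  rw [lintegral_const_mul' _ _ ENNReal.ofReal_ne_top, ENNReal.ofReal_mul (by norm_num)]
  gcongr
  exact h.lintegral_sub_trunc_le hβ hC _ (by positivity) fun n hn => le_of_notMem_freqCube hn

/-- If `l + 1` is the first index whose threshold is not exceeded by `‖z‖`, then `‖z‖^δ` is at most
the power of that threshold, and threshold `l` is exceeded. Since `M ≥ 1`, the thresholds are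
unbounded. -/
lemma enorm_rpow_le_layers {M δ : ℝ} (hM : 1 ≤ M) (hδ : 0 < δ) (z : ℂ) :
    ‖z‖ₑ ^ (2 + δ) ≤ ENNReal.ofReal (ampl M 0 ^ δ) * ‖z‖ₑ ^ 2
      + ∑' l, ENNReal.ofReal (ampl M (l + 1) ^ δ) * (if ampl M l < ‖z‖ then ‖z‖ₑ ^ 2 else 0) := by
  have hsplit : ‖z‖ₑ ^ (2 + δ) = ‖z‖ₑ ^ 2 * ENNReal.ofReal (‖z‖ ^ δ) := by
    rw [ENNReal.rpow_add_of_nonneg _ _ (by norm_num) hδ.le, ENNReal.rpow_ofNat,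
      ← ENNReal.ofReal_rpow_of_nonneg (norm_nonneg _) hδ.le, ofReal_norm]
  have key : ∀ l, ‖z‖ ≤ ampl M l →
      ‖z‖ₑ ^ (2 + δ) ≤ ENNReal.ofReal (ampl M l ^ δ) * ‖z‖ₑ ^ 2 := by
    intro l hl
    rw [hsplit, mul_comm]
    gcongr
  by_cases h0 : ‖z‖ ≤ ampl M 0
  · exact (key 0 h0).trans le_self_add
  have hex : ∃ l, ‖z‖ ≤ ampl M l := by
    obtain ⟨l, hl⟩ := pow_unbounded_of_one_lt ‖z‖ (by norm_num : (1 : ℝ) < 8)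
    refine ⟨l, hl.le.trans ?_⟩
    rw [ampl]
    have : (0 : ℝ) < 8 ^ l := by positivity
    nlinarith
  classical
  have hf0 : Nat.find hex ≠ 0 := fun h => h0 (h ▸ Nat.find_spec hex)
  obtain ⟨l, hl⟩ := Nat.exists_eq_succ_of_ne_zero hf0
  have hl1 : ‖z‖ ≤ ampl M (l + 1) := by
    have := Nat.find_spec hex
    rwa [hl] at this
  have hl2 : ampl M l < ‖z‖ := not_le.1 (Nat.find_min hex (by omega))
  refine (key _ hl1).trans (le_trans ?_ le_add_self)
  refine le_trans (le_of_eq ?_) (ENNReal.le_tsum l)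
  rw [if_pos hl2]

/-- Origin of the gain `β/12`: since `8^{lβ/12} = 2^{lβ/4}`, the amplitude costs only half of the
tail decay `2^{-lβ/2}`, and a geometric series of ratio `2^{-β/4}` remains. -/
lemma layer_term_eq {β C M K : ℝ} (hM : 1 ≤ M) (l : ℕ) :
    ampl M (l + 1) ^ (β / 12) * (4 * (C * (2 ^ l) ^ (-(β / 2)) * K))
      = (432 * M) ^ (β / 12) * 4 * C * K * ((2 : ℝ) ^ (-(β / 4))) ^ l := by
  have e1 : ampl M (l + 1) = (432 * M) * 8 ^ l := by rw [ampl, pow_succ]; ring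
  have e2 : ((8 : ℝ) ^ l) ^ (β / 12) = ((2 : ℝ) ^ (β / 4)) ^ l := by
    rw [← Real.rpow_natCast, ← Real.rpow_natCast, ← Real.rpow_mul (by norm_num),
      ← Real.rpow_mul (by norm_num), show (8 : ℝ) = 2 ^ (3 : ℝ) by norm_num,
      ← Real.rpow_mul (by norm_num)]
    congr 1; ring
  have e3 : ((2 : ℝ) ^ l) ^ (-(β / 2)) = ((2 : ℝ) ^ (-(β / 2))) ^ l := by
    rw [← Real.rpow_natCast, ← Real.rpow_natCast, ← Real.rpow_mul (by norm_num),
      ← Real.rpow_mul (by norm_num)]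
    congr 1; ring
  have e4 : ((2 : ℝ) ^ (β / 4)) ^ l * ((2 : ℝ) ^ (-(β / 2))) ^ l = ((2 : ℝ) ^ (-(β / 4))) ^ l := by
    rw [← mul_pow, ← Real.rpow_add (by norm_num)]
    congr 2; ring
  rw [e1, Real.mul_rpow (by positivity) (by positivity), e2, e3, ← e4]
  ring

/-- Spectral decay together with bounded coefficients gives a bound in a better Lebesgue space. -/
theorem exists_lintegral_rpow_bound (T : ℝ) {β C M : ℝ} (hβ : 0 < β) (hC : 0 ≤ C) (hM : 1 ≤ M) :
    ∃ B : ℝ≥0∞, B ≠ ⊤ ∧ ∀ g : ℝ × X3 → ℂ, HasSpectralDecay T β C g →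
      (∀ᵐ t ∂timeMeasure T, ∀ n, ‖scoef g t n‖ ≤ M) →
      ∫⁻ p, ‖g p‖ₑ ^ (2 + β / 12) ∂torusSlab T ≤ B := by
  set K := weightSum β
  have hK : 0 ≤ K := weightSum_nonneg β
  refine ⟨ENNReal.ofReal (ampl M 0 ^ (β / 12)) * ENNReal.ofReal (C * K)
    + ∑' l : ℕ, ENNReal.ofReal ((432 * M) ^ (β / 12) * 4 * C * K * ((2 : ℝ) ^ (-(β / 4))) ^ l),
    ?_, ?_⟩
  · refine ENNReal.add_ne_top.2 ⟨ENNReal.mul_ne_top ENNReal.ofReal_ne_top ENNReal.ofReal_ne_top, ?_⟩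
    rw [← ENNReal.ofReal_tsum_of_nonneg (fun _ => by positivity)]
    · exact ENNReal.ofReal_ne_top
    · refine (summable_geometric_of_lt_one (by positivity) ?_).mul_left _
      exact Real.rpow_lt_one_of_one_lt_of_neg (by norm_num) (by linarith)
  · intro g h hg
    have hmeas : ∀ l, AEMeasurable (fun p => if ampl M l < ‖g p‖ then ‖g p‖ₑ ^ 2 else 0)
        (torusSlab T) := fun l => by
      have h1 := h.memLp.1.aemeasurable
      have : Measurable fun z : ℂ => if ampl M l < ‖z‖ then ‖z‖ₑ ^ 2 else 0 :=
        Measurable.ite (measurableSet_lt measurable_const measurable_norm)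
          (measurable_enorm.pow_const 2) measurable_const
      exact this.comp_aemeasurable h1
    refine (lintegral_mono fun p => enorm_rpow_le_layers hM (by positivity : 0 < β / 12) (g p)).trans
      ?_
    rw [lintegral_add_left' ((h.memLp.1.enorm.pow_const 2).const_mul _),
      lintegral_const_mul' _ _ ENNReal.ofReal_ne_top,
      lintegral_tsum fun l => (hmeas l).const_mul _]
    refine add_le_add (mul_le_mul_right (h.lintegral_sq_le hβ hC) _)
      (ENNReal.tsum_le_tsum fun l => ?_)
    rw [lintegral_const_mul' _ _ ENNReal.ofReal_ne_top, ← layer_term_eq hM l,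
      ENNReal.ofReal_mul (by have : 0 ≤ ampl M (l + 1) := by rw [ampl]; positivity
                             positivity)]
    exact mul_le_mul_right (lintegral_large_values_le h hβ hC (by linarith) hg l) _

lemma enorm_sub_sq_le (x y w : ℂ) : ‖x - y‖ₑ ^ 2 ≤ 4 * (‖x - w‖ₑ ^ 2 + ‖y - w‖ₑ ^ 2) := by
  have h : ‖x - y‖ ^ 2 ≤ 4 * (‖x - w‖ ^ 2 + ‖y - w‖ ^ 2) := by
    have h1 : ‖x - y‖ ≤ ‖x - w‖ + ‖y - w‖ := by
      have := norm_sub_le (x - w) (y - w)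
      rwa [sub_sub_sub_cancel_right] at this
    nlinarith [norm_nonneg (x - y), sq_nonneg (‖x - w‖ - ‖y - w‖), norm_nonneg (x - w),
      norm_nonneg (y - w)]
  have e : ∀ z : ℂ, ‖z‖ₑ ^ 2 = ENNReal.ofReal (‖z‖ ^ 2) := fun z => by
    rw [ENNReal.ofReal_pow (norm_nonneg _), ofReal_norm]
  rw [e, e, e, ← ENNReal.ofReal_add (by positivity) (by positivity),
    show (4 : ℝ≥0∞) = ENNReal.ofReal 4 by norm_num, ← ENNReal.ofReal_mul (by norm_num)]
  exact ENNReal.ofReal_le_ofReal h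

/-- A sequence with uniform spectral decay whose Fourier coefficients converge in `L²(0,T)` is
Cauchy in `L²`. -/
theorem tendsto_lintegral_sub_sq {β C : ℝ} (hβ : 0 < β) (hC : 0 ≤ C) {g : ℕ → ℝ × X3 → ℂ}
    (h : ∀ k, HasSpectralDecay T β C (g k)) {w : (Fin 3 → ℤ) → ℝ → ℂ}
    (hw : ∀ n, AEStronglyMeasurable (w n) (timeMeasure T))
    (hlim : ∀ n, Tendsto (fun k => ∫⁻ t, ‖scoef (g k) t n - w n t‖ₑ ^ 2 ∂timeMeasure T)
      atTop (𝓝 0)) :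
    Tendsto (fun q : ℕ × ℕ => ∫⁻ p, ‖g q.1 p - g q.2 p‖ₑ ^ 2 ∂torusSlab T)
      (atTop ×ˢ atTop) (𝓝 0) := by
  -- The Parseval sum is read as an integral against counting measure on the frequencies. Spectral
  -- decay gives a summable majorant, so dominated convergence reduces the claim to each frequency
  -- separately.
  simp only [(h _).sub (h _), ← lintegral_count]
  have hz : (0 : ℝ≥0∞) = ∫⁻ _n : Fin 3 → ℤ, 0 ∂Measure.count := by simp
  rw [hz]
  have hsc : ∀ k n, AEMeasurable (fun t => scoef (g k) t n) (timeMeasure T) := fun k n =>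
    (aestronglyMeasurable_scoef (h k).memLp.1 n).aemeasurable
  refine tendsto_lintegral_filter_of_dominated_convergence
    (fun n => 4 * (ENNReal.ofReal (C * (1 + ‖n‖) ^ (-(3 + β)))
      + ENNReal.ofReal (C * (1 + ‖n‖) ^ (-(3 + β)))))
    (Eventually.of_forall fun q => measurable_of_countable _)
    (Eventually.of_forall fun q => Eventually.of_forall fun n => ?_) ?_
    (Eventually.of_forall fun n => ?_)
  · calc _ ≤ ∫⁻ t, 4 * (‖scoef (g q.1) t n - 0‖ₑ ^ 2 + ‖scoef (g q.2) t n - 0‖ₑ ^ 2)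
          ∂timeMeasure T := lintegral_mono fun t => enorm_sub_sq_le _ _ _
      _ ≤ _ := by
        rw [lintegral_const_mul' _ _ (by norm_num)]
        simp only [sub_zero]
        rw [lintegral_add_left' ((hsc q.1 n).enorm.pow_const 2)]
        gcongr
        · exact (h q.1).decay n
        · exact (h q.2).decay n
  · rw [lintegral_count, ENNReal.tsum_mul_left]
    refine ENNReal.mul_ne_top (by norm_num) ?_
    rw [ENNReal.tsum_add, ← ENNReal.ofReal_tsum_of_nonneg (fun _ => by positivity)
      ((summable_one_add_norm_rpow (by linarith)).mul_left C)]
    exact ENNReal.add_ne_top.2 ⟨ENNReal.ofReal_ne_top, ENNReal.ofReal_ne_top⟩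
  · have hb : ∀ q : ℕ × ℕ,
        ∫⁻ t, ‖scoef (g q.1) t n - scoef (g q.2) t n‖ₑ ^ 2 ∂timeMeasure T
        ≤ 4 * (∫⁻ t, ‖scoef (g q.1) t n - w n t‖ₑ ^ 2 ∂timeMeasure T
          + ∫⁻ t, ‖scoef (g q.2) t n - w n t‖ₑ ^ 2 ∂timeMeasure T) := fun q => by
      rw [← lintegral_add_left' (f := fun t => ‖scoef (g q.1) t n - w n t‖ₑ ^ 2)
          (((hsc q.1 n).sub (hw n).aemeasurable).enorm.pow_const 2),
        ← lintegral_const_mul' _ _ (by norm_num)]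
      exact lintegral_mono fun t => enorm_sub_sq_le _ _ _
    refine tendsto_of_tendsto_of_tendsto_of_le_of_le tendsto_const_nhds ?_
      (fun _ => zero_le) hb
    have := ((hlim n).comp tendsto_fst).add ((hlim n).comp (tendsto_snd (f := (atTop : Filter ℕ))))
    have h2 := ENNReal.Tendsto.const_mul this (a := 4) (Or.inr (by norm_num))
    simpa using h2

end

/-! ### Space-time `L¹` estimate for the pressure -/

section

open UnitAddTorus

variable {T : ℝ}

lemma lintegral_slab_translate {F : ℝ × X3 → ℝ≥0∞} (hF : Measurable F) (y : X3) :
    ∫⁻ p, F (p.1, p.2 - y) ∂torusSlab T = ∫⁻ p, F p ∂torusSlab T := by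
  have hm : Measurable fun p : ℝ × X3 => F (p.1, p.2 - y) :=
    hF.comp (measurable_fst.prodMk (measurable_snd.sub_const _))
  rw [lintegral_torusSlab hm.aemeasurable, lintegral_torusSlab hF.aemeasurable]
  refine lintegral_congr fun t => ?_
  exact lintegral_sub_right_eq_self (fun θ => F (t, θ)) y

lemma lintegral_enorm_mul_le {α : Type*} [MeasurableSpace α] {μ : Measure α} {f g : α → ℂ}
    (hf : AEMeasurable f μ) (hg : AEMeasurable g μ) {a b : ℝ≥0∞}
    (ha : ∫⁻ x, ‖f x‖ₑ ^ 2 ∂μ ≤ a) (hb : ∫⁻ x, ‖g x‖ₑ ^ 2 ∂μ ≤ b) :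
    ∫⁻ x, ‖f x * g x‖ₑ ∂μ ≤ (a * b) ^ (1 / 2 : ℝ) := by
  have h := ENNReal.lintegral_mul_le_Lp_mul_Lq μ Real.HolderConjugate.two_two hf.enorm hg.enorm
  simp only [enorm_mul]
  refine h.trans ?_
  rw [ENNReal.mul_rpow_of_nonneg _ _ (by norm_num)]
  simp only [ENNReal.rpow_ofNat]
  gcongr

/-- The difference of products is telescoped and each term estimated by Cauchy–Schwarz. The square
root halves the exponent `β/2` of the squared modulus to `β/4`. -/
lemma lintegral_translate_mul_le {β C : ℝ} (hβ : 0 < β) (hβ1 : β ≤ 1) (hC : 0 ≤ C)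
    {f g : ℝ × X3 → ℂ} (hf : HasSpectralDecay T β C f) (hg : HasSpectralDecay T β C g)
    (hfm : Measurable f) (hgm : Measurable g) (y : Fin 3 → ℝ) :
    ∫⁻ p, ‖f (p.1, p.2 - toTorus y) * g (p.1, p.2 - toTorus y) - f p * g p‖ₑ ∂torusSlab T
      ≤ ENNReal.ofReal (4 * C * weightSum β * (6 * Real.pi * ‖y‖) ^ (β / 4)) := by
  set K := weightSum β
  have hK : 0 ≤ K := weightSum_nonneg β
  have hsh : Measurable fun p : ℝ × X3 => (p.1, p.2 - toTorus y) :=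
    measurable_fst.prodMk (measurable_snd.sub_const _)
  have hft := hf.lintegral_translate_le hβ hβ1 hC hfm y
  have hgt := hg.lintegral_translate_le hβ hβ1 hC hgm y
  have hg2 : ∫⁻ p, ‖g (p.1, p.2 - toTorus y)‖ₑ ^ 2 ∂torusSlab T ≤ ENNReal.ofReal (C * K) := by
    rw [lintegral_slab_translate (F := fun p => ‖g p‖ₑ ^ 2) (hgm.enorm.pow_const 2)]
    exact hg.lintegral_sq_le hβ hC
  have hf2 := hf.lintegral_sq_le hβ hC
  have hdf : Measurable fun p : ℝ × X3 => f (p.1, p.2 - toTorus y) - f p := (hfm.comp hsh).sub hfm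
  have hdg : Measurable fun p : ℝ × X3 => g (p.1, p.2 - toTorus y) - g p := (hgm.comp hsh).sub hgm
  have h1 := lintegral_enorm_mul_le hdf.aemeasurable (hgm.comp hsh).aemeasurable hft hg2
  have h2 := lintegral_enorm_mul_le hfm.aemeasurable hdg.aemeasurable hf2 hgt
  set A := (6 * Real.pi * ‖y‖) ^ (β / 4) with hA
  have hA0 : 0 ≤ A := by positivity
  have hA2 : (6 * Real.pi * ‖y‖) ^ (β / 2) = A ^ 2 := by
    rw [hA, ← Real.rpow_natCast, ← Real.rpow_mul (by positivity)]
    congr 1; push_cast; ring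
  have hsq : (ENNReal.ofReal (4 * (6 * Real.pi * ‖y‖) ^ (β / 2) * C * K)
      * ENNReal.ofReal (C * K)) ^ (1 / 2 : ℝ) = ENNReal.ofReal (2 * C * K * A) := by
    rw [← ENNReal.ofReal_mul (by positivity), hA2,
      show 4 * A ^ 2 * C * K * (C * K) = (2 * C * K * A) ^ (2 : ℝ) by norm_cast; ring,
      ENNReal.ofReal_rpow_of_nonneg (by positivity) (by norm_num),
      ← Real.rpow_mul (by positivity)]
    norm_num
  rw [hsq] at h1
  rw [mul_comm (ENNReal.ofReal (C * K)), hsq] at h2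
  calc _ ≤ ∫⁻ p, (‖(f (p.1, p.2 - toTorus y) - f p) * g (p.1, p.2 - toTorus y)‖ₑ
        + ‖f p * (g (p.1, p.2 - toTorus y) - g p)‖ₑ) ∂torusSlab T := by
        refine lintegral_mono fun p => le_trans (le_of_eq ?_) (enorm_add_le _ _)
        congr 1; ring
    _ = _ := lintegral_add_left (hdf.mul (hgm.comp hsh)).enorm _
    _ ≤ ENNReal.ofReal (2 * C * K * A) + ENNReal.ofReal (2 * C * K * A) := add_le_add h1 h2
    _ = _ := by rw [← ENNReal.ofReal_add (by positivity) (by positivity)]; congr 1; ring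

lemma le_sqrt_mul_sqrt {x a b : ℝ≥0∞} (ha : x ≤ a) (hb : x ≤ b) :
    x ≤ a ^ (1 / 2 : ℝ) * b ^ (1 / 2 : ℝ) := by
  calc x = x ^ (1 / 2 : ℝ) * x ^ (1 / 2 : ℝ) := by
        rw [← ENNReal.rpow_add_of_nonneg _ _ (by norm_num) (by norm_num)]; norm_num
    _ ≤ _ := by gcongr

/-- Any positive power of the shift suffices: `|√s z|^γ` contributes `s^{γ/2}`, so `s^{-1+γ/2}` is
integrable at zero, while `|z|^γ ≤ 1 + |z|` is absorbed by the Gaussian. -/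
lemma lintegral_heatWeight_moment_ne_top {γ : ℝ} (hγ : 0 < γ) (hγ1 : γ ≤ 1) (i j : Fin 3) :
    ∫⁻ p, ‖heatWeight i j p‖ₑ * ENNReal.ofReal (‖√p.1 • p.2‖ ^ γ) ∂heatMeasure ≠ ⊤ := by
  have hs : Integrable (fun s : ℝ => s ^ (-1 + γ / 2)) (volume.restrict (Ioc 0 1)) := by
    rw [← IntegrableOn, ← intervalIntegrable_iff_integrableOn_Ioc_of_le zero_le_one]
    exact intervalIntegral.intervalIntegrable_rpow' (by linarith)
  have h := hs.mul_prod (integrable_one_add_norm_mul_heatKernel i j)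
  have h2 := h.2
  rw [hasFiniteIntegral_iff_enorm] at h2
  refine ne_top_of_le_ne_top h2.ne ?_
  rw [heatMeasure]
  refine lintegral_mono_ae ?_
  have hae : ∀ᵐ p ∂((volume.restrict (Ioc (0 : ℝ) 1)).prod (volume : Measure (Fin 3 → ℝ))),
      p.1 ∈ Ioc (0 : ℝ) 1 :=
    Measure.quasiMeasurePreserving_fst.ae (ae_restrict_mem measurableSet_Ioc)
  filter_upwards [hae] with p hp
  have hp0 := hp.1
  rw [← ofReal_norm, ← ofReal_norm, ← ENNReal.ofReal_mul (norm_nonneg _)]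
  refine ENNReal.ofReal_le_ofReal ?_
  have hz : ‖p.2‖ ^ γ ≤ 1 + ‖p.2‖ := by
    have h1 : ‖p.2‖ ^ γ ≤ (1 + ‖p.2‖) ^ γ := by gcongr; linarith
    refine h1.trans ?_
    calc (1 + ‖p.2‖) ^ γ ≤ (1 + ‖p.2‖) ^ (1 : ℝ) :=
          Real.rpow_le_rpow_of_exponent_le (by linarith [norm_nonneg p.2]) hγ1
      _ = _ := Real.rpow_one _
  have hsγ : ‖√p.1 • p.2‖ ^ γ = p.1 ^ (γ / 2) * ‖p.2‖ ^ γ := by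
    rw [norm_smul, Real.norm_of_nonneg (Real.sqrt_nonneg _),
      Real.mul_rpow (Real.sqrt_nonneg _) (norm_nonneg _), Real.sqrt_eq_rpow,
      ← Real.rpow_mul hp0.le]
    congr 2; ring
  rw [hsγ, heatWeight, norm_mul, norm_inv, Real.norm_of_nonneg hp0.le, norm_mul, norm_mul,
    Real.norm_of_nonneg (Real.rpow_nonneg hp0.le _),
    Real.norm_of_nonneg (by positivity : (0 : ℝ) ≤ 1 + ‖p.2‖), Real.rpow_add hp0, Real.rpow_neg_one]
  calc _ = p.1⁻¹ * p.1 ^ (γ / 2) * ‖heatKernel i j p.2‖ * ‖p.2‖ ^ γ := by ring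
    _ ≤ p.1⁻¹ * p.1 ^ (γ / 2) * ‖heatKernel i j p.2‖ * (1 + ‖p.2‖) := by gcongr
    _ = _ := by ring

lemma measurable_translate_diff {D : ℝ × X3 → ℂ} (hD : Measurable D) :
    Measurable fun q : (ℝ × (ℝ × (Fin 3 → ℝ))) × X3 =>
      ‖D (q.1.1, q.2 - heatShift q.1.2) - D (q.1.1, q.2)‖ₑ := by
  have h1 : Measurable fun q : (ℝ × (ℝ × (Fin 3 → ℝ))) × X3 => (q.1.1, q.2 - heatShift q.1.2) :=
    (measurable_fst.comp measurable_fst).prodMk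
      (measurable_snd.sub (measurable_heatShift.comp (measurable_snd.comp measurable_fst)))
  have h2 : Measurable fun q : (ℝ × (ℝ × (Fin 3 → ℝ))) × X3 => (q.1.1, q.2) :=
    (measurable_fst.comp measurable_fst).prodMk measurable_snd
  exact ((hD.comp h1).sub (hD.comp h2)).enorm

lemma measurable_heat_integrand (i j : Fin 3) {D : ℝ × X3 → ℂ} (hD : Measurable D) :
    Measurable fun q : ℝ × (ℝ × (Fin 3 → ℝ)) => ‖heatWeight i j q.2‖ₑ *
      ∫⁻ θ, ‖D (q.1, θ - heatShift q.2) - D (q.1, θ)‖ₑ ∂torusMeasure :=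
  ((measurable_heatWeight i j).comp measurable_snd).enorm.mul
    (measurable_translate_diff hD).lintegral_prod_right'

/-- Tonelli moves the time integral inside the heat parameter, where the space-time modulus of
continuity can be used. -/
lemma lintegral_diffMod (i j : Fin 3) {D : ℝ × X3 → ℂ} (hD : Measurable D) :
    ∫⁻ t, diffMod heatMeasure (heatWeight i j) heatShift (fun θ => D (t, θ)) ∂timeMeasure T
      = ∫⁻ p, ‖heatWeight i j p‖ₑ * ∫⁻ q, ‖D (q.1, q.2 - heatShift p) - D q‖ₑ ∂torusSlab T
          ∂heatMeasure := by
  simp only [diffMod]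
  rw [lintegral_lintegral_swap (measurable_heat_integrand i j hD).aemeasurable]
  refine lintegral_congr fun p => ?_
  rw [lintegral_const_mul' _ _ enorm_ne_top]
  have hm : Measurable fun q : ℝ × X3 => ‖D (q.1, q.2 - heatShift p) - D q‖ₑ :=
    ((hD.comp (measurable_fst.prodMk (measurable_snd.sub_const _))).sub hD).enorm
  rw [lintegral_torusSlab hm.aemeasurable]

/-- `L¹` stability of the pressure: uniform estimate for solutions of
`-Δr = ∂ᵢ∂ⱼ(UᵢUⱼ - VᵢVⱼ)` in terms of the `L¹` norm of `UᵢUⱼ - VᵢVⱼ`. -/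
theorem exists_pressure_bound (T : ℝ) {β C : ℝ} (hβ : 0 < β) (hβ1 : β ≤ 1) (hC : 0 ≤ C) :
    ∃ B : ℝ≥0∞, B ≠ ⊤ ∧ ∀ (U V : Fin 3 → ℝ × X3 → ℂ) (r : ℝ × X3 → ℂ),
      (∀ i, Measurable (U i)) → (∀ i, Measurable (V i)) →
      (∀ i, HasSpectralDecay T β C (U i)) → (∀ i, HasSpectralDecay T β C (V i)) →
      Integrable r (torusSlab T) →
      (∀ᵐ t ∂timeMeasure T, scoef r t 0 = 0 ∧ ∀ n, (nsq n : ℂ) * scoef r t n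
        = -∑ i, ∑ j, (n i * n j : ℂ) * scoef (fun p => U i p * U j p - V i p * V j p) t n) →
      ∫⁻ p, ‖r p‖ₑ ∂torusSlab T
        ≤ B * ((∑ i, ∑ j, ∫⁻ p, ‖U i p * U j p - V i p * V j p‖ₑ ∂torusSlab T)
          + (∑ i, ∑ j, ∫⁻ p, ‖U i p * U j p - V i p * V j p‖ₑ ∂torusSlab T) ^ (1 / 2 : ℝ)) := by
  set K := weightSum β with hKdef
  have hK : 0 ≤ K := weightSum_nonneg β
  set A : ℝ≥0∞ := (2 : ℝ≥0∞) ^ (1 / 2 : ℝ) *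
    ENNReal.ofReal ((8 * C * K * (6 * Real.pi) ^ (β / 4)) ^ (1 / 2 : ℝ)) with hA
  have hAt : A ≠ ⊤ := ENNReal.mul_ne_top (ENNReal.rpow_ne_top_of_nonneg (by norm_num) (by norm_num))
    ENNReal.ofReal_ne_top
  set Q : Fin 3 → Fin 3 → ℝ≥0∞ := fun i j =>
    ∫⁻ p, ‖heatWeight i j p‖ₑ * ENNReal.ofReal (‖√p.1 • p.2‖ ^ (β / 8)) ∂heatMeasure with hQ
  have hQt : ∀ i j, Q i j ≠ ⊤ := fun i j =>
    lintegral_heatWeight_moment_ne_top (by positivity) (by linarith) i j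
  refine ⟨ENNReal.ofReal lowFreqConst + A * ∑ i, ∑ j, Q i j, ?_, ?_⟩
  · refine ENNReal.add_ne_top.2 ⟨ENNReal.ofReal_ne_top, ENNReal.mul_ne_top hAt ?_⟩
    exact ENNReal.sum_ne_top.2 fun i _ => ENNReal.sum_ne_top.2 fun j _ => hQt i j
  intro U V r hU hV hUd hVd hr hrel
  set D : Fin 3 → Fin 3 → ℝ × X3 → ℂ := fun i j p => U i p * U j p - V i p * V j p with hD
  have hDm : ∀ i j, Measurable (D i j) := fun i j =>
    ((hU i).mul (hU j)).sub ((hV i).mul (hV j))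
  have hDi : ∀ i j, Integrable (D i j) (torusSlab T) := fun i j =>
    ((hUd i).memLp.integrable_mul (hUd j).memLp).sub ((hVd i).memLp.integrable_mul (hVd j).memLp)
  set d := ∑ i, ∑ j, ∫⁻ p, ‖D i j p‖ₑ ∂torusSlab T with hd
  have hdij : ∀ i j, ∫⁻ p, ‖D i j p‖ₑ ∂torusSlab T ≤ d := fun i j =>
    (Finset.single_le_sum (f := fun j => ∫⁻ p, ‖D i j p‖ₑ ∂torusSlab T) (fun _ _ => zero_le)
      (Finset.mem_univ j)).trans
    (Finset.single_le_sum (f := fun i => ∑ j, ∫⁻ p, ‖D i j p‖ₑ ∂torusSlab T) (fun _ _ => zero_le)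
      (Finset.mem_univ i))
  have hstatic : ∀ᵐ t ∂timeMeasure T, ∫⁻ θ, ‖r (t, θ)‖ₑ ∂torusMeasure ≤
      ENNReal.ofReal lowFreqConst * ∑ i, ∑ j, ∫⁻ θ, ‖D i j (t, θ)‖ₑ ∂torusMeasure
        + ∑ i, ∑ j, diffMod heatMeasure (heatWeight i j) heatShift (fun θ => D i j (t, θ)) := by
    have hr' : Integrable r ((timeMeasure T).prod torusMeasure) := hr
    have hDi' : ∀ᵐ t ∂timeMeasure T, ∀ i j, Integrable (fun θ => D i j (t, θ)) torusMeasure := by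
      rw [ae_all_iff]; intro i; rw [ae_all_iff]; intro j
      have : Integrable (D i j) ((timeMeasure T).prod torusMeasure) := hDi i j
      exact this.prod_right_ae
    filter_upwards [hrel, hr'.prod_right_ae, hDi'] with t ht hrt hDt
    exact lintegral_enorm_pressure_le hrt (fun i j => (hDm i j).comp measurable_prodMk_left) hDt
      ht.1 ht.2
  have hm1 : ∀ i j, Measurable fun t => ∫⁻ θ, ‖D i j (t, θ)‖ₑ ∂torusMeasure := fun i j =>
    (hDm i j).enorm.lintegral_prod_right'
  have hm2 : ∀ i j, Measurable fun t =>
      diffMod heatMeasure (heatWeight i j) heatShift (fun θ => D i j (t, θ)) := fun i j =>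
    (measurable_heat_integrand i j (hDm i j)).lintegral_prod_right'
  -- Two bounds are available: `2d` from the triangle inequality, small but without decay in the
  -- shift, and the modulus of order `‖y‖^{β/4}`, decaying but not small. Their geometric mean is
  -- small like `d^{1/2}` and keeps the power `‖y‖^{β/8}`, enough for the heat integral.
  have hN : ∀ i j p, ∫⁻ q, ‖D i j (q.1, q.2 - heatShift p) - D i j q‖ₑ ∂torusSlab T
      ≤ d ^ (1 / 2 : ℝ) * A * ENNReal.ofReal (‖√p.1 • p.2‖ ^ (β / 8)) := by
    intro i j p
    set y := √p.1 • p.2 with hy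
    have hsh : Measurable fun q : ℝ × X3 => (q.1, q.2 - toTorus y) :=
      measurable_fst.prodMk (measurable_snd.sub_const _)
    have b1 : ∫⁻ q, ‖D i j (q.1, q.2 - heatShift p) - D i j q‖ₑ ∂torusSlab T ≤ 2 * d := by
      calc _ ≤ ∫⁻ q, (‖D i j (q.1, q.2 - toTorus y)‖ₑ + ‖D i j q‖ₑ) ∂torusSlab T :=
            lintegral_mono fun q => enorm_sub_le
        _ = ∫⁻ q, ‖D i j (q.1, q.2 - toTorus y)‖ₑ ∂torusSlab T
              + ∫⁻ q, ‖D i j q‖ₑ ∂torusSlab T := lintegral_add_right _ (hDm i j).enorm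
        _ = 2 * ∫⁻ q, ‖D i j q‖ₑ ∂torusSlab T := by
            rw [lintegral_slab_translate (F := fun q => ‖D i j q‖ₑ) (hDm i j).enorm, two_mul]
        _ ≤ 2 * d := by gcongr; exact hdij i j
    have b2 : ∫⁻ q, ‖D i j (q.1, q.2 - heatShift p) - D i j q‖ₑ ∂torusSlab T
        ≤ ENNReal.ofReal (8 * C * K * (6 * Real.pi * ‖y‖) ^ (β / 4)) := by
      have hu := lintegral_translate_mul_le hβ hβ1 hC (hUd i) (hUd j) (hU i) (hU j) y
      have hv := lintegral_translate_mul_le hβ hβ1 hC (hVd i) (hVd j) (hV i) (hV j) y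
      have hmv : Measurable fun q : ℝ × X3 => V i (q.1, q.2 - toTorus y) *
          V j (q.1, q.2 - toTorus y) - V i q * V j q :=
        (((hV i).comp hsh).mul ((hV j).comp hsh)).sub ((hV i).mul (hV j))
      calc _ ≤ ∫⁻ q, (‖U i (q.1, q.2 - toTorus y) * U j (q.1, q.2 - toTorus y) - U i q * U j q‖ₑ
            + ‖V i (q.1, q.2 - toTorus y) * V j (q.1, q.2 - toTorus y) - V i q * V j q‖ₑ)
              ∂torusSlab T := by
            refine lintegral_mono fun q => le_trans (le_of_eq ?_) enorm_sub_le
            simp only [hD, heatShift, ← hy]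
            congr 1; ring
        _ = _ := lintegral_add_right _ hmv.enorm
        _ ≤ _ := add_le_add hu hv
        _ = _ := by rw [← ENNReal.ofReal_add (by positivity) (by positivity)]; congr 1; ring
    refine (le_sqrt_mul_sqrt b1 b2).trans (le_of_eq ?_)
    rw [ENNReal.mul_rpow_of_nonneg _ _ (by norm_num), hA,
      ENNReal.ofReal_rpow_of_nonneg (by positivity) (by norm_num),
      Real.mul_rpow (by positivity) (norm_nonneg y), ← mul_assoc (8 * C * K),
      Real.mul_rpow (by positivity) (by positivity), ← Real.rpow_mul (norm_nonneg y),
      ENNReal.ofReal_mul (by positivity), show β / 4 * (1 / 2) = β / 8 by ring]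
    ring
  rw [lintegral_torusSlab hr.1.enorm]
  refine (lintegral_mono_ae hstatic).trans ?_
  rw [lintegral_add_left (Measurable.const_mul (Finset.measurable_fun_sum _ fun i _ =>
      Finset.measurable_fun_sum _ fun j _ => hm1 i j) _),
    lintegral_const_mul' _ _ ENNReal.ofReal_ne_top,
    lintegral_finsetSum _ fun i _ => Finset.measurable_fun_sum _ fun j _ => hm1 i j,
    lintegral_finsetSum _ fun i _ => Finset.measurable_fun_sum _ fun j _ => hm2 i j]
  simp only [lintegral_finsetSum _ fun j _ => hm1 _ j, lintegral_finsetSum _ fun j _ => hm2 _ j,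
    lintegral_diffMod _ _ (hDm _ _)]
  have hds : ∑ i, ∑ j, ∫⁻ t, ∫⁻ θ, ‖D i j (t, θ)‖ₑ ∂torusMeasure ∂timeMeasure T = d := by
    simp only [hd]
    refine Finset.sum_congr rfl fun i _ => Finset.sum_congr rfl fun j _ => ?_
    rw [lintegral_torusSlab (hDm i j).enorm.aemeasurable]
  rw [hds]
  have hJ : ∑ i, ∑ j, ∫⁻ p, ‖heatWeight i j p‖ₑ *
      ∫⁻ q, ‖D i j (q.1, q.2 - heatShift p) - D i j q‖ₑ ∂torusSlab T ∂heatMeasure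
      ≤ A * (∑ i, ∑ j, Q i j) * d ^ (1 / 2 : ℝ) := by
    rw [Finset.mul_sum, Finset.sum_mul]
    refine Finset.sum_le_sum fun i _ => ?_
    rw [Finset.mul_sum, Finset.sum_mul]
    refine Finset.sum_le_sum fun j _ => ?_
    calc _ ≤ ∫⁻ p, A * d ^ (1 / 2 : ℝ) *
          (‖heatWeight i j p‖ₑ * ENNReal.ofReal (‖√p.1 • p.2‖ ^ (β / 8))) ∂heatMeasure := by
          refine lintegral_mono fun p => (mul_le_mul_right (hN i j p) _).trans (le_of_eq ?_)
          ring
      _ = A * d ^ (1 / 2 : ℝ) * Q i j := by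
          rw [lintegral_const_mul]
          refine (measurable_heatWeight i j).enorm.mul (Measurable.ennreal_ofReal ?_)
          exact ((measurable_fst.sqrt.smul measurable_snd).norm).pow_const _
      _ = _ := by ring
  refine (add_le_add le_rfl hJ).trans ?_
  rw [add_mul, mul_add, mul_add]
  exact add_le_add le_self_add le_add_self

end

/-! ### Distributional differential inequalities in time -/

section

/-- Smooth functions of time vanishing near `T` and later. -/
structure IsTimeTest (T : ℝ) (θ : ℝ → ℝ) : Prop where
  smooth : ContDiff ℝ ∞ θ
  support : ∃ T' < T, ∀ t, T' ≤ t → θ t = 0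

/-- A smooth approximation of the indicator function of `(-∞, t]`. -/
def timeCutoff (t δ s : ℝ) : ℝ := Real.smoothTransition ((t + δ - s) / δ)

lemma exists_bound_deriv_smoothTransition :
    ∃ K : ℝ, 0 ≤ K ∧ ∀ x, |deriv Real.smoothTransition x| ≤ K := by
  have hc : Continuous (deriv Real.smoothTransition) :=
    (Real.smoothTransition.contDiff (n := 1)).continuous_deriv le_rfl
  obtain ⟨K, hK⟩ := (isCompact_Icc (a := (0 : ℝ)) (b := 1)).exists_bound_of_continuousOn
    hc.continuousOn
  have hK0 : 0 ≤ K := (norm_nonneg _).trans (hK 0 (by simp))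
  refine ⟨K, hK0, fun x => ?_⟩
  by_cases hx : x ∈ Icc (0 : ℝ) 1
  · exact hK x hx
  · have hz : deriv Real.smoothTransition x = 0 := by
      rw [mem_Icc, not_and_or, not_le, not_le] at hx
      rcases hx with hx | hx
      · have : Real.smoothTransition =ᶠ[𝓝 x] fun _ => 0 := by
          filter_upwards [Iio_mem_nhds hx] with y hy
          exact Real.smoothTransition.zero_of_nonpos (le_of_lt hy)
        rw [this.deriv_eq]; simp
      · have : Real.smoothTransition =ᶠ[𝓝 x] fun _ => 1 := by
          filter_upwards [Ioi_mem_nhds hx] with y hy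
          exact Real.smoothTransition.one_of_one_le (le_of_lt hy)
        rw [this.deriv_eq]; simp
    rw [hz, abs_zero]; exact hK0

lemma timeCutoff_of_le {t δ s : ℝ} (hδ : 0 < δ) (hs : s ≤ t) : timeCutoff t δ s = 1 :=
  Real.smoothTransition.one_of_one_le (by rw [le_div_iff₀ hδ]; linarith)

lemma timeCutoff_of_ge {t δ s : ℝ} (hδ : 0 < δ) (hs : t + δ ≤ s) : timeCutoff t δ s = 0 :=
  Real.smoothTransition.zero_of_nonpos (div_nonpos_of_nonpos_of_nonneg (by linarith) hδ.le)

lemma contDiff_timeCutoff (t δ : ℝ) : ContDiff ℝ ∞ (timeCutoff t δ) :=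
  Real.smoothTransition.contDiff.comp (by fun_prop)

lemma deriv_timeCutoff (t δ s : ℝ) :
    deriv (timeCutoff t δ) s = deriv Real.smoothTransition ((t + δ - s) / δ) * (-1 / δ) := by
  have h1 : HasDerivAt (fun s : ℝ => (t + δ - s) / δ) (-1 / δ) s :=
    ((hasDerivAt_id s).const_sub (t + δ)).div_const δ
  have h2 : HasDerivAt Real.smoothTransition (deriv Real.smoothTransition ((t + δ - s) / δ))
      ((t + δ - s) / δ) :=
    ((Real.smoothTransition.contDiff (n := 1)).differentiable one_ne_zero _).hasDerivAt
  exact (h2.comp s h1).deriv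

lemma deriv_timeCutoff_eq_zero {t δ s : ℝ} (hδ : 0 < δ) (hs : s ∉ Icc t (t + δ)) :
    deriv (timeCutoff t δ) s = 0 := by
  rw [mem_Icc, not_and_or, not_le, not_le] at hs
  rcases hs with hs | hs
  · have : timeCutoff t δ =ᶠ[𝓝 s] fun _ => 1 := by
      filter_upwards [Iio_mem_nhds hs] with y hy using timeCutoff_of_le hδ (le_of_lt hy)
    rw [this.deriv_eq]; simp
  · have : timeCutoff t δ =ᶠ[𝓝 s] fun _ => 0 := by
      filter_upwards [Ioi_mem_nhds hs] with y hy using timeCutoff_of_ge hδ (le_of_lt hy)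
    rw [this.deriv_eq]; simp

/-- The derivative of the cutoff has integral `-1`, is supported in `[t, t + δ]` and is bounded by
`K/δ`; it is minus an approximate identity, which converges at Lebesgue points. One full-measure set
of times serves all sequences `δ`. -/
lemma integral_mul_deriv_timeCutoff_tendsto {G : ℝ → ℝ} (hG : Integrable G) :
    ∀ᵐ t, ∀ δ : ℕ → ℝ, (∀ k, 0 < δ k) → Tendsto δ atTop (𝓝 0) →
      Tendsto (fun k => ∫ s, G s * deriv (timeCutoff t (δ k)) s) atTop (𝓝 (-G t)) := by
  obtain ⟨K, hK0, hK⟩ := exists_bound_deriv_smoothTransition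
  filter_upwards [IsUnifLocDoublingMeasure.ae_tendsto_average_norm_sub volume
    hG.locallyIntegrable 1] with t ht δ hδ hδ0
  have hδ' : Tendsto δ atTop (𝓝[>] 0) :=
    tendsto_nhdsWithin_iff.2 ⟨hδ0, Eventually.of_forall hδ⟩
  have hav := ht (fun _ => t) δ hδ' (Eventually.of_forall fun k => by
    simp [(hδ k).le])
  rw [tendsto_iff_norm_sub_tendsto_zero]
  refine squeeze_zero (fun _ => norm_nonneg _) (fun k => ?_)
    (by simpa using hav.const_mul (2 * K))
  have hd := hδ k
  set B := Metric.closedBall t (δ k) with hB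
  have hBI : B = Icc (t - δ k) (t + δ k) := Real.closedBall_eq_Icc
  have hout : ∀ s ∉ B, deriv (timeCutoff t (δ k)) s = 0 := fun s hs =>
    deriv_timeCutoff_eq_zero hd fun h => hs (by rw [hBI]; exact ⟨by linarith [h.1], h.2⟩)
  have hcd : Continuous (deriv (timeCutoff t (δ k))) :=
    (contDiff_timeCutoff t (δ k)).continuous_deriv (by simp)
  have h1 : ∫ s, G s * deriv (timeCutoff t (δ k)) s
      = ∫ s in B, G s * deriv (timeCutoff t (δ k)) s :=
    (setIntegral_eq_integral_of_forall_compl_eq_zero fun s hs => by rw [hout s hs, mul_zero]).symm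
  have h2 : ∫ s in B, deriv (timeCutoff t (δ k)) s = -1 := by
    rw [hBI, integral_Icc_eq_integral_Ioc, ← intervalIntegral.integral_of_le (by linarith),
      intervalIntegral.integral_deriv_eq_sub
        (fun s _ => ((contDiff_timeCutoff t (δ k)).differentiable (by simp)) s)
        (hcd.intervalIntegrable _ _),
      timeCutoff_of_ge hd le_rfl, timeCutoff_of_le hd (by linarith)]
    norm_num
  have hb : ∀ s, ‖deriv (timeCutoff t (δ k)) s‖ ≤ K / δ k := fun s => by
    rw [deriv_timeCutoff, norm_mul, Real.norm_eq_abs, norm_div, norm_neg, norm_one,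
      Real.norm_of_nonneg hd.le, ← mul_div_assoc, mul_one]
    gcongr
    exact hK _
  have hi1 : IntegrableOn (fun s => G s * deriv (timeCutoff t (δ k)) s) B :=
    (hG.integrableOn).mul_bdd (c := K / δ k) hcd.aestronglyMeasurable (Eventually.of_forall hb)
  have hi2 : IntegrableOn (fun s => G t * deriv (timeCutoff t (δ k)) s) B := by
    refine ContinuousOn.integrableOn_compact (isCompact_closedBall _ _) ?_
    fun_prop
  have h3 : (∫ s, G s * deriv (timeCutoff t (δ k)) s) - -G t
      = ∫ s in B, (G s - G t) * deriv (timeCutoff t (δ k)) s := by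
    have : ∫ s in B, G t * deriv (timeCutoff t (δ k)) s = -G t := by
      rw [integral_const_mul, h2]; ring
    rw [h1, ← this, ← integral_sub hi1 hi2]
    simp only [sub_mul]
  rw [h3]
  have hvol : volume.real B = 2 * δ k := by
    rw [hBI, Real.volume_real_Icc_of_le (by linarith)]; ring
  have hic : IntegrableOn (fun s => ‖G s - G t‖) B := by
    refine (hG.integrableOn.sub ?_).norm
    exact integrableOn_const (by rw [hBI]; simp)
  calc ‖∫ s in B, (G s - G t) * deriv (timeCutoff t (δ k)) s‖
      ≤ ∫ s in B, K / δ k * ‖G s - G t‖ := by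
        refine norm_integral_le_of_norm_le (hic.const_mul _) (Eventually.of_forall fun s => ?_)
        rw [norm_mul, mul_comm]
        gcongr
        exact hb s
    _ = 2 * K * ⨍ s in B, ‖G s - G t‖ := by
        rw [integral_const_mul, setAverage_eq, hvol, smul_eq_mul]
        field_simp

/-- Testing with the cutoff at `t` gives in the limit `-g t` from its derivative, `∫₀ᵗ h` from its
plateau, and `c` because the cutoff equals `1` at time zero. -/
lemma le_add_integral_of_forall_test {T : ℝ} {g h : ℝ → ℝ} (hg : Integrable g (timeMeasure T))
    (hh : Integrable h (timeMeasure T)) (c : ℝ)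
    (H : ∀ θ, IsTimeTest T θ → (∀ t, 0 ≤ θ t) →
      0 ≤ (∫ t, (g t * deriv θ t + h t * θ t) ∂timeMeasure T) + c * θ 0) :
    ∀ᵐ t ∂timeMeasure T, g t ≤ c + ∫ s in Ico 0 t, h s := by
  set G := (Ico 0 T).indicator g with hGdef
  have hG : Integrable G := IntegrableOn.integrable_indicator hg measurableSet_Ico
  -- The widths `(T - t)/(k + 2)` are chosen so that `t + δ k < T`, as admissibility of the cutoffs
  -- requires.
  have h1 := ae_restrict_of_ae (s := Ico 0 T) (integral_mul_deriv_timeCutoff_tendsto hG)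
  filter_upwards [h1, ae_restrict_mem measurableSet_Ico] with t ht htm
  set δ : ℕ → ℝ := fun k => (T - t) / (k + 2) with hδ
  have hTt : 0 < T - t := by linarith [htm.2]
  have hδ0 : ∀ k, 0 < δ k := fun k => by positivity
  have hδT : ∀ k, t + δ k < T := fun k => by
    have : δ k < T - t := by
      simp only [hδ]
      rw [div_lt_iff₀ (by positivity)]
      have : (0 : ℝ) ≤ k := by positivity
      nlinarith
    linarith
  have hδlim : Tendsto δ atTop (𝓝 0) := by
    have := tendsto_const_nhds (x := T - t) (f := atTop (α := ℕ))
    refine this.div_atTop ?_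
    exact tendsto_atTop_add_const_right _ _ tendsto_natCast_atTop_atTop
  have hlim1 := ht δ hδ0 hδlim
  have hlim2 : Tendsto (fun k => ∫ s, h s * timeCutoff t (δ k) s ∂timeMeasure T) atTop
      (𝓝 (∫ s, (Iio t).indicator h s ∂timeMeasure T)) := by
    refine tendsto_integral_of_dominated_convergence (fun s => ‖h s‖) (fun k => ?_) hh.norm
      (fun k => Eventually.of_forall fun s => ?_) ?_
    · exact hh.1.mul (contDiff_timeCutoff t (δ k)).continuous.aestronglyMeasurable
    · rw [norm_mul]
      refine mul_le_of_le_one_right (norm_nonneg _) ?_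
      rw [timeCutoff, Real.norm_of_nonneg (Real.smoothTransition.nonneg _)]
      exact Real.smoothTransition.le_one _
    · have hne : ∀ᵐ s ∂timeMeasure T, s ≠ t := ae_restrict_of_ae (by
        simp [ae_iff, measure_singleton])
      filter_upwards [hne] with s hs
      rcases lt_or_gt_of_ne hs with hlt | hgt
      · rw [indicator_of_mem (by exact hlt)]
        refine tendsto_const_nhds.congr fun k => ?_
        rw [timeCutoff_of_le (hδ0 k) hlt.le, mul_one]
      · rw [indicator_of_notMem (by simp [hgt.le])]
        refine tendsto_const_nhds.congr' ?_
        have : ∀ᶠ k in atTop, δ k < s - t := hδlim.eventually_lt_const (by linarith)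
        filter_upwards [this] with k hk
        rw [timeCutoff_of_ge (hδ0 k) (by linarith), mul_zero]
  have e2 : ∫ s, (Iio t).indicator h s ∂timeMeasure T = ∫ s in Ico 0 t, h s := by
    rw [integral_indicator measurableSet_Iio, Measure.restrict_restrict measurableSet_Iio]
    congr 2
    ext s
    simp only [mem_inter_iff, mem_Iio, mem_Ico]
    constructor
    · rintro ⟨a, b, _⟩; exact ⟨b, a⟩
    · rintro ⟨a, b⟩; exact ⟨b, a, by linarith [htm.2]⟩
  have hsum := (hlim1.add hlim2).add_const c
  have hnn : 0 ≤ -G t + ∫ s, (Iio t).indicator h s ∂timeMeasure T + c := by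
    refine ge_of_tendsto' hsum fun k => ?_
    have hcd : Continuous (deriv (timeCutoff t (δ k))) :=
      (contDiff_timeCutoff t (δ k)).continuous_deriv (by simp)
    have hb : ∃ K, ∀ s, ‖deriv (timeCutoff t (δ k)) s‖ ≤ K := by
      obtain ⟨K, _, hK⟩ := exists_bound_deriv_smoothTransition
      refine ⟨K * ‖-1 / δ k‖, fun s => ?_⟩
      rw [deriv_timeCutoff, norm_mul]
      gcongr
      exact hK _
    obtain ⟨K, hK⟩ := hb
    have hH := H (timeCutoff t (δ k)) ⟨contDiff_timeCutoff t (δ k), t + δ k, hδT k,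
      fun s hs => timeCutoff_of_ge (hδ0 k) hs⟩ fun s => Real.smoothTransition.nonneg _
    rw [integral_add (hg.mul_bdd (c := K) hcd.aestronglyMeasurable (Eventually.of_forall hK))
      (hh.mul_bdd (c := 1) (contDiff_timeCutoff t (δ k)).continuous.aestronglyMeasurable
        (Eventually.of_forall fun s => by
          rw [timeCutoff, Real.norm_of_nonneg (Real.smoothTransition.nonneg _)]
          exact Real.smoothTransition.le_one _)),
      timeCutoff_of_le (hδ0 k) htm.1, mul_one] at hH
    have e1 : ∫ s, G s * deriv (timeCutoff t (δ k)) s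
        = ∫ s, g s * deriv (timeCutoff t (δ k)) s ∂timeMeasure T := by
      rw [← integral_indicator measurableSet_Ico]
      refine integral_congr_ae (Eventually.of_forall fun s => ?_)
      by_cases hs : s ∈ Ico 0 T <;> simp [hGdef, hs]
    rw [e1]
    exact hH
  rw [e2] at hnn
  have : G t = g t := indicator_of_mem htm g
  linarith

lemma eq_add_integral_of_forall_test {T : ℝ} {g h : ℝ → ℝ} (hg : Integrable g (timeMeasure T))
    (hh : Integrable h (timeMeasure T)) (c : ℝ)
    (H : ∀ θ, IsTimeTest T θ →
      (∫ t, (g t * deriv θ t + h t * θ t) ∂timeMeasure T) + c * θ 0 = 0) :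
    ∀ᵐ t ∂timeMeasure T, g t = c + ∫ s in Ico 0 t, h s := by
  have h1 := le_add_integral_of_forall_test hg hh c fun θ hθ _ => (H θ hθ).ge
  have h2 := le_add_integral_of_forall_test hg.neg hh.neg (-c) fun θ hθ _ => by
    have := H θ hθ
    simp only [Pi.neg_apply, neg_mul, ← neg_add]
    rw [integral_neg]
    linarith
  filter_upwards [h1, h2] with t h1 h2
  simp only [Pi.neg_apply, integral_neg] at h2
  linarith

lemma complex_eq_add_integral_of_forall_test {T : ℝ} {g h : ℝ → ℂ}
    (hg : Integrable g (timeMeasure T)) (hh : Integrable h (timeMeasure T)) (c : ℂ)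
    (H : ∀ θ, IsTimeTest T θ →
      (∫ t, (g t * deriv θ t + h t * θ t) ∂timeMeasure T) + c * θ 0 = 0) :
    ∀ᵐ t ∂timeMeasure T, g t = c + ∫ s in Ico 0 t, h s := by
  have h_int : ∀ θ, IsTimeTest T θ → Integrable (fun t => g t * deriv θ t + h t * θ t)
      (timeMeasure T) := by
    intro θ hθ
    have hb : ∀ φ : ℝ → ℝ, Continuous φ → ∀ g : ℝ → ℂ, Integrable g (timeMeasure T) →
        Integrable (fun t => g t * φ t) (timeMeasure T) := by
      intro φ hφ g hg
      obtain ⟨K, hK⟩ := (isCompact_Icc (a := (0 : ℝ)) (b := T)).exists_bound_of_continuousOn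
        hφ.continuousOn
      refine hg.mul_bdd (c := K) (by fun_prop) ?_
      filter_upwards [ae_restrict_mem measurableSet_Ico] with t ht
      rw [Complex.norm_real]
      exact hK t ⟨ht.1, ht.2.le⟩
    exact (hb _ (hθ.smooth.continuous_deriv (by simp)) g hg).add
      (hb _ hθ.smooth.continuous h hh)
  have hre := eq_add_integral_of_forall_test hg.re hh.re c.re fun θ hθ => by
    have := congrArg Complex.re (H θ hθ)
    rw [Complex.add_re, ← RCLike.re_eq_complex_re, ← integral_re (h_int θ hθ)] at this
    simpa using this
  have him := eq_add_integral_of_forall_test hg.im hh.im c.im fun θ hθ => by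
    have := congrArg Complex.im (H θ hθ)
    rw [Complex.add_im, ← RCLike.im_eq_complex_im, ← integral_im (h_int θ hθ)] at this
    simpa using this
  filter_upwards [hre, him, ae_restrict_mem measurableSet_Ico] with t h1 h2 ht
  have hht : Integrable h (volume.restrict (Ico 0 t)) :=
    hh.mono_measure (Measure.restrict_mono (Ico_subset_Ico_right ht.2.le) le_rfl)
  rw [integral_re hht] at h1
  rw [integral_im hht] at h2
  apply Complex.ext
  · simpa using h1
  · simpa using h2

lemma IsTimeTest.deriv {T : ℝ} {θ : ℝ → ℝ} (hθ : IsTimeTest T θ) : IsTimeTest T (deriv θ) := by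
  obtain ⟨T', hT', h0⟩ := hθ.support
  -- The cutoff time moves to the midpoint because `θ` has to vanish on a neighbourhood of each time
  -- considered.
  refine ⟨(contDiff_infty_iff_deriv.1 hθ.smooth).2, (T' + T) / 2, by linarith, fun t ht => ?_⟩
  have : θ =ᶠ[𝓝 t] fun _ => 0 := by
    filter_upwards [Ioi_mem_nhds (by linarith : T' < t)] with s hs using h0 s (le_of_lt hs)
  rw [this.deriv_eq]; simp

/-- Testing against derivatives `θ'` says that `h` has zero distributional derivative and zero
initial value, so the representation formula gives `h = 0`. -/
lemma ae_eq_zero_of_forall_test {T : ℝ} {h : ℝ → ℂ} (hh : Integrable h (timeMeasure T))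
    (H : ∀ θ, IsTimeTest T θ → ∫ t, h t * θ t ∂timeMeasure T = 0) :
    ∀ᵐ t ∂timeMeasure T, h t = 0 := by
  have := complex_eq_add_integral_of_forall_test (g := h) (h := fun _ => 0) hh
    (integrable_zero _ _ _) 0 fun θ hθ => by
      simpa using H _ hθ.deriv
  filter_upwards [this] with t ht
  simpa using ht

end

/-! ### Transfer between functions on the slab and on the torus -/

section

open UnitAddTorus

section CellAndTorus

lemma isCompact_cell (P : ℝ) : IsCompact (cell P) := by
  have h : cell P = Set.image (MeasurableEquiv.toLp 2 (Fin 3 → ℝ))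
      (Icc (fun _ => -(P / 2)) (fun _ => P / 2)) := by
    ext x
    simp only [cell, mem_ofPred_eq, mem_image, mem_Icc, Pi.le_def]
    constructor
    · intro hx
      exact ⟨fun j => x j, ⟨fun j => (hx j).1, fun j => (hx j).2⟩, rfl⟩
    · rintro ⟨y, hy, rfl⟩ j
      exact ⟨hy.1 j, hy.2 j⟩
  rw [h]
  exact isCompact_Icc.image (PiLp.continuous_toLp 2 _)

lemma measurableSet_cell (P : ℝ) : MeasurableSet (cell P) := (isCompact_cell P).measurableSet

instance (P : ℝ) : IsFiniteMeasure (cellMeasure P) := by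
  unfold cellMeasure
  exact ⟨by rw [Measure.restrict_apply_univ]; exact (isCompact_cell P).measure_lt_top⟩

instance (P T : ℝ) : IsFiniteMeasure (slabMeasure P T) := by unfold slabMeasure; infer_instance

lemma ae_mem_slab (P T : ℝ) :
    ∀ᵐ z ∂slabMeasure P T, z.1 ∈ Ico 0 T ∧ z.2 ∈ cell P := by
  have h1 : ∀ᵐ z ∂slabMeasure P T, z.1 ∈ Ico 0 T :=
    Measure.quasiMeasurePreserving_fst.ae (ae_restrict_mem measurableSet_Ico)
  have h2 : ∀ᵐ z ∂slabMeasure P T, z.2 ∈ cell P :=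
    Measure.quasiMeasurePreserving_snd.ae (ae_restrict_mem (measurableSet_cell P))
  filter_upwards [h1, h2] with z hz1 hz2 using ⟨hz1, hz2⟩

lemma exists_bound_slab {E : Type*} [SeminormedAddCommGroup E] (P T : ℝ) {w : ℝ × E3 → E}
    (hw : Continuous w) : ∃ K : ℝ, 0 ≤ K ∧ ∀ᵐ z ∂slabMeasure P T, ‖w z‖ ≤ K := by
  obtain ⟨K, hK⟩ := ((isCompact_Icc (a := (0 : ℝ)) (b := T)).prod
    (isCompact_cell P)).exists_bound_of_continuousOn hw.continuousOn
  refine ⟨max K 0, le_max_right _ _, ?_⟩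
  filter_upwards [ae_mem_slab P T] with z hz
  exact (hK z ⟨⟨hz.1.1, hz.1.2.le⟩, hz.2⟩).trans (le_max_left _ _)

lemma integrable_mul_continuous {𝕜 : Type*} [RCLike 𝕜] {P T : ℝ} {G w : ℝ × E3 → 𝕜}
    (hG : Integrable G (slabMeasure P T)) (hw : Continuous w) :
    Integrable (fun z => G z * w z) (slabMeasure P T) := by
  obtain ⟨K, _, hK⟩ := exists_bound_slab P T hw
  exact hG.mul_bdd (c := K) hw.aestronglyMeasurable hK

/-- The function on `ℝ × X3` corresponding to a function on the slab. -/
def lift (P : ℝ) (G : ℝ × E3 → ℝ) (p : ℝ × X3) : ℂ := (G (p.1, cellSection P p.2) : ℂ)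

/-- The normalisation factor `P⁻³`. -/
def volFactor (P : ℝ) : ℝ≥0∞ := ENNReal.ofReal (P ^ 3)⁻¹

lemma volFactor_ne_top (P : ℝ) : volFactor P ≠ ⊤ := ENNReal.ofReal_ne_top

lemma volFactor_ne_zero {P : ℝ} (hP : 0 < P) : volFactor P ≠ 0 := by
  rw [volFactor, Ne, ENNReal.ofReal_eq_zero, not_le]; positivity

variable {P T : ℝ}

lemma measurable_slabSection (P : ℝ) :
    Measurable fun p : ℝ × X3 => (p.1, cellSection P p.2) :=
  measurable_fst.prodMk ((measurable_cellSection P).comp measurable_snd)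

lemma map_slabSection (hP : 0 < P) (T : ℝ) :
    (torusSlab T).map (fun p : ℝ × X3 => (p.1, cellSection P p.2))
      = volFactor P • slabMeasure P T := by
  have h := Measure.map_prod_map (timeMeasure T) torusMeasure (f := id) measurable_id
    (measurable_cellSection P)
  rw [Measure.map_id, map_cellSection hP] at h
  rw [torusSlab, slabMeasure]
  refine h.symm.trans ?_
  rw [Measure.prod_smul_right, volFactor]

lemma aestronglyMeasurable_comp_slabSection (hP : 0 < P) {E : Type*} [TopologicalSpace E]
    {G : ℝ × E3 → E} (hG : AEStronglyMeasurable G (slabMeasure P T)) :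
    AEStronglyMeasurable (fun p : ℝ × X3 => G (p.1, cellSection P p.2)) (torusSlab T) := by
  have : AEStronglyMeasurable G ((torusSlab T).map fun p : ℝ × X3 => (p.1, cellSection P p.2)) := by
    rw [map_slabSection hP]
    exact hG.mono_ac Measure.smul_absolutelyContinuous
  exact this.comp_measurable (measurable_slabSection P)

lemma lintegral_comp_slabSection (hP : 0 < P) {F : ℝ × E3 → ℝ≥0∞}
    (hF : AEMeasurable F (slabMeasure P T)) :
    ∫⁻ p, F (p.1, cellSection P p.2) ∂torusSlab T = volFactor P * ∫⁻ z, F z ∂slabMeasure P T := by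
  have hF' : AEMeasurable F ((torusSlab T).map fun p : ℝ × X3 => (p.1, cellSection P p.2)) := by
    rw [map_slabSection hP]
    exact hF.mono_ac Measure.smul_absolutelyContinuous
  rw [← lintegral_map' hF' (measurable_slabSection P).aemeasurable, map_slabSection hP,
    lintegral_smul_measure, smul_eq_mul]

lemma integral_comp_slabSection (hP : 0 < P) {F : ℝ × E3 → ℂ}
    (hF : AEStronglyMeasurable F (slabMeasure P T)) :
    ∫ p, F (p.1, cellSection P p.2) ∂torusSlab T
      = ((P : ℂ) ^ 3)⁻¹ * ∫ z, F z ∂slabMeasure P T := by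
  have hF' : AEStronglyMeasurable F
      ((torusSlab T).map fun p : ℝ × X3 => (p.1, cellSection P p.2)) := by
    rw [map_slabSection hP]
    exact hF.mono_ac Measure.smul_absolutelyContinuous
  rw [← integral_map (measurable_slabSection P).aemeasurable hF', map_slabSection hP,
    integral_smul_measure, volFactor, ENNReal.toReal_ofReal (by positivity), Complex.real_smul]
  push_cast
  rfl

lemma integrable_lift (hP : 0 < P) {G : ℝ × E3 → ℝ} (hG : Integrable G (slabMeasure P T)) :
    Integrable (lift P G) (torusSlab T) := by
  have hm := aestronglyMeasurable_comp_slabSection hP hG.1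
  refine ⟨Complex.continuous_ofReal.comp_aestronglyMeasurable hm, ?_⟩
  have e : ∀ p, ‖lift P G p‖ₑ = ‖G (p.1, cellSection P p.2)‖ₑ := fun p => by
    rw [lift, ← ofReal_norm, Complex.norm_real, ofReal_norm]
  rw [hasFiniteIntegral_iff_enorm]
  simp only [e]
  rw [lintegral_comp_slabSection (F := fun z => ‖G z‖ₑ) hP hG.1.enorm]
  exact ENNReal.mul_lt_top (volFactor_ne_top P).lt_top hG.2

lemma memLp_two_lift (hP : 0 < P) {G : ℝ × E3 → ℝ} (hG : MemLp G 2 (slabMeasure P T)) :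
    MemLp (lift P G) 2 (torusSlab T) := by
  have hm := Complex.continuous_ofReal.comp_aestronglyMeasurable
    (aestronglyMeasurable_comp_slabSection hP hG.1)
  refine (memLp_two_iff_integrable_sq_norm hm).2 ?_
  have h := (integrable_lift hP ((memLp_two_iff_integrable_sq_norm hG.1).1 hG)).re
  refine h.congr (Eventually.of_forall fun p => ?_)
  simp only [lift, Real.norm_eq_abs, sq_abs, RCLike.re_to_complex, Complex.ofReal_re,
    Complex.norm_real]

lemma integrable_scoef {g : ℝ × X3 → ℂ} (hg : Integrable g (torusSlab T)) (n : Fin 3 → ℤ) :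
    Integrable (fun t => scoef g t n) (timeMeasure T) := by
  have : Integrable (fun p : ℝ × X3 => mFourier (-n) p.2 * g p)
      ((timeMeasure T).prod torusMeasure) :=
    hg.bdd_mul (c := 1)
      (((mFourier (-n)).continuous.comp continuous_snd).aestronglyMeasurable)
      (Eventually.of_forall fun p => (norm_mFourier_apply (-n) p.2).le)
  exact this.integral_prod_left

/-- The character `exp(-i k·x)`. -/
def charFn (P : ℝ) (n : Fin 3 → ℤ) (x : E3) : ℂ :=
  Complex.exp (-(Complex.I * ((inner ℝ (waveVec P n) x : ℝ) : ℂ)))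

lemma continuous_charFn (P : ℝ) (n : Fin 3 → ℤ) : Continuous (charFn P n) := by
  unfold charFn; fun_prop

lemma charFn_eq (P : ℝ) (n : Fin 3 → ℤ) (x : E3) :
    charFn P n x = (Real.cos (inner ℝ (waveVec P n) x) : ℂ)
      - Complex.I * (Real.sin (inner ℝ (waveVec P n) x) : ℂ) := by
  rw [charFn, show -(Complex.I * ((inner ℝ (waveVec P n) x : ℝ) : ℂ))
    = ((-(inner ℝ (waveVec P n) x) : ℝ) : ℂ) * Complex.I by push_cast; ring,
    Complex.exp_mul_I, ← Complex.ofReal_cos, ← Complex.ofReal_sin, Real.cos_neg, Real.sin_neg]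
  push_cast; ring

/-- Pairing of a function on the slab with `φ(t) exp(-i k·x)`. -/
def pairing (P T : ℝ) (n : Fin 3 → ℤ) (G : ℝ × E3 → ℝ) (φ : ℝ → ℝ) : ℂ :=
  ∫ z, (G z : ℂ) * ((φ z.1 : ℂ) * charFn P n z.2) ∂slabMeasure P T

lemma continuous_pairing_weight (n : Fin 3 → ℤ) {φ : ℝ → ℝ} (hφ : Continuous φ) :
    Continuous fun z : ℝ × E3 => (φ z.1 : ℂ) * charFn P n z.2 := by
  have := continuous_charFn P n
  fun_prop

/-- Coefficients tested in time on the torus become integrals over the slab; this allows the weak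
equations to be read frequency by frequency. -/
lemma integral_scoef_lift (hP : 0 < P) {G : ℝ × E3 → ℝ} (hG : Integrable G (slabMeasure P T))
    (n : Fin 3 → ℤ) {φ : ℝ → ℝ} (hφ : Continuous φ) :
    ∫ t, scoef (lift P G) t n * φ t ∂timeMeasure T
      = ((P : ℂ) ^ 3)⁻¹ * pairing P T n G φ := by
  have hGc : Integrable (fun z => (G z : ℂ)) (slabMeasure P T) := hG.ofReal
  have hI := integrable_mul_continuous hGc (continuous_pairing_weight (P := P) n hφ)
  rw [pairing, ← integral_comp_slabSection hP hI.1]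
  have e : ∀ p : ℝ × X3, ((G (p.1, cellSection P p.2) : ℝ) : ℂ)
      * ((φ p.1 : ℂ) * charFn P n (cellSection P p.2))
      = mFourier (-n) p.2 * lift P G p * φ p.1 := fun p => by
    rw [mFourier_neg_eq_exp hP, lift, charFn]; ring
  have hI2 : Integrable (fun p : ℝ × X3 => mFourier (-n) p.2 * lift P G p * φ p.1)
      ((timeMeasure T).prod torusMeasure) := by
    have h1 : Integrable (fun p : ℝ × X3 => mFourier (-n) p.2 * lift P G p)
        ((timeMeasure T).prod torusMeasure) :=
      (integrable_lift hP hG).bdd_mul (c := 1)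
        (((mFourier (-n)).continuous.comp continuous_snd).aestronglyMeasurable)
        (Eventually.of_forall fun p => (norm_mFourier_apply (-n) p.2).le)
    obtain ⟨K, hK⟩ := (isCompact_Icc (a := (0 : ℝ)) (b := T)).exists_bound_of_continuousOn
      hφ.continuousOn
    refine h1.mul_bdd (c := K) (by fun_prop) ?_
    have h2 : ∀ᵐ p ∂(timeMeasure T).prod torusMeasure, p.1 ∈ Ico 0 T :=
      Measure.quasiMeasurePreserving_fst.ae (ae_restrict_mem measurableSet_Ico)
    filter_upwards [h2] with p hp
    rw [Complex.norm_real]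
    exact hK _ ⟨hp.1, hp.2.le⟩
  rw [torusSlab]
  simp only [e]
  rw [integral_prod _ hI2]
  refine integral_congr_ae (Eventually.of_forall fun t => ?_)
  simp only [scoef, tcoef]
  rw [← integral_mul_const]

lemma tcoef_comp_cellSection (hP : 0 < P) {g : E3 → ℝ}
    (hg : AEStronglyMeasurable g (cellMeasure P)) (n : Fin 3 → ℤ) :
    tcoef (fun θ => (g (cellSection P θ) : ℂ)) n
      = ((P : ℂ) ^ 3)⁻¹ * ∫ x, charFn P n x * (g x : ℂ) ∂cellMeasure P := by
  have hF : AEStronglyMeasurable (fun x => charFn P n x * (g x : ℂ)) (cellMeasure P) :=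
    ((continuous_charFn P n).aestronglyMeasurable).mul
      (Complex.continuous_ofReal.comp_aestronglyMeasurable hg)
  have hF' : AEStronglyMeasurable (fun x => charFn P n x * (g x : ℂ))
      (torusMeasure.map (cellSection P)) := by
    rw [map_cellSection hP]
    exact hF.mono_ac Measure.smul_absolutelyContinuous
  have e : ∀ θ, mFourier (-n) θ * (g (cellSection P θ) : ℂ)
      = charFn P n (cellSection P θ) * (g (cellSection P θ) : ℂ) := fun θ => by
    rw [mFourier_neg_eq_exp hP, charFn]
  rw [tcoef]
  simp only [e]
  rw [← integral_map (measurable_cellSection P).aemeasurable hF', map_cellSection hP,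
    integral_smul_measure, ENNReal.toReal_ofReal (by positivity), Complex.real_smul]
  push_cast
  rfl

lemma scoef_lift_eq_fourierCoef (hP : 0 < P) {u : ℝ → E3 → E3} (n : Fin 3 → ℤ) (i : Fin 3)
    {t : ℝ} (ht : AEStronglyMeasurable (u t) (cellMeasure P)) :
    scoef (lift P fun z => u z.1 z.2 i) t n = fourierCoef P (u t) (waveVec P n) i := by
  have hm : AEStronglyMeasurable (fun x => u t x i) (cellMeasure P) :=
    (EuclideanSpace.proj (𝕜 := ℝ) i).continuous.comp_aestronglyMeasurable ht
  have := tcoef_comp_cellSection hP hm n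
  rw [scoef]
  simp only [lift]
  rw [this, fourierCoef, one_div]
  rfl

end CellAndTorus

end

/-! ### Weak equations tested with trigonometric functions -/

section

open UnitAddTorus

section TrigTests

/-- `θ(t) cos(k·x)`. -/
def cosTest (θ : ℝ → ℝ) (k : E3) (t : ℝ) (x : E3) : ℝ := θ t * Real.cos (inner ℝ k x)

/-- `θ(t) sin(k·x)`. -/
def sinTest (θ : ℝ → ℝ) (k : E3) (t : ℝ) (x : E3) : ℝ := θ t * Real.sin (inner ℝ k x)

variable {P T : ℝ} {θ : ℝ → ℝ}

lemma inner_waveVec_basisVec (hP : 0 < P) (n : Fin 3 → ℤ) (j : Fin 3) :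
    inner ℝ (waveVec P n) (P • basisVec j) = (n j : ℝ) * (2 * Real.pi) := by
  rw [inner_smul_right, EuclideanSpace.inner_single_right]
  simp [waveVec]
  field_simp

lemma isTest_cosTest (hP : 0 < P) (hθ : IsTimeTest T θ) (n : Fin 3 → ℤ) :
    IsTest P T (cosTest θ (waveVec P n)) where
  smooth := by
    exact (hθ.smooth.comp contDiff_fst).mul (Real.contDiff_cos.comp
      ((innerSL ℝ (waveVec P n)).contDiff.comp contDiff_snd))
  periodic t x j := by
    simp only [cosTest, inner_add_right, inner_waveVec_basisVec hP, Real.cos_add_int_mul_two_pi]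
  support := by
    obtain ⟨T', hT', h⟩ := hθ.support
    exact ⟨T', hT', fun t ht x => by simp [cosTest, h t ht]⟩

lemma isTest_sinTest (hP : 0 < P) (hθ : IsTimeTest T θ) (n : Fin 3 → ℤ) :
    IsTest P T (sinTest θ (waveVec P n)) where
  smooth := by
    exact (hθ.smooth.comp contDiff_fst).mul (Real.contDiff_sin.comp
      ((innerSL ℝ (waveVec P n)).contDiff.comp contDiff_snd))
  periodic t x j := by
    simp only [sinTest, inner_add_right, inner_waveVec_basisVec hP, Real.sin_add_int_mul_two_pi]
  support := by
    obtain ⟨T', hT', h⟩ := hθ.support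
    exact ⟨T', hT', fun t ht x => by simp [sinTest, h t ht]⟩

lemma dt_cosTest (hθ : IsTimeTest T θ) (k : E3) : dt (cosTest θ k) = cosTest (deriv θ) k := by
  funext t x
  simp only [dt, cosTest]
  exact deriv_mul_const ((hθ.smooth.differentiable (by simp)) t) _

lemma dt_sinTest (hθ : IsTimeTest T θ) (k : E3) : dt (sinTest θ k) = sinTest (deriv θ) k := by
  funext t x
  simp only [dt, sinTest]
  exact deriv_mul_const ((hθ.smooth.differentiable (by simp)) t) _

lemma hasFDerivAt_inner_left (k x : E3) :
    HasFDerivAt (fun x : E3 => inner ℝ k x) (innerSL ℝ k) x := (innerSL ℝ k).hasFDerivAt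

/-- The factor `-k j` is absorbed in the time profile, so the family of sine and cosine tests is
closed under differentiation. -/
lemma dx_cosTest (θ : ℝ → ℝ) (k : E3) (j : Fin 3) :
    dx j (cosTest θ k) = sinTest (fun t => -(k j) * θ t) k := by
  funext t x
  have h : HasFDerivAt (fun x : E3 => θ t * Real.cos (inner ℝ k x)) _ x :=
    ((hasFDerivAt_inner_left k x).cos).const_mul (θ t)
  simp only [dx, sinTest]
  change (fderiv ℝ (fun x : E3 => θ t * Real.cos (inner ℝ k x)) x) (basisVec j) = _
  rw [h.fderiv]
  simp [EuclideanSpace.inner_single_right]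
  ring

lemma dx_sinTest (θ : ℝ → ℝ) (k : E3) (j : Fin 3) :
    dx j (sinTest θ k) = cosTest (fun t => k j * θ t) k := by
  funext t x
  have h : HasFDerivAt (fun x : E3 => θ t * Real.sin (inner ℝ k x)) _ x :=
    ((hasFDerivAt_inner_left k x).sin).const_mul (θ t)
  simp only [dx, cosTest]
  change (fderiv ℝ (fun x : E3 => θ t * Real.sin (inner ℝ k x)) x) (basisVec j) = _
  rw [h.fderiv]
  simp [EuclideanSpace.inner_single_right]
  ring

/-- The square of the Euclidean norm of `k`. -/
def ksq (k : E3) : ℝ := ∑ j, k j ^ 2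

lemma lap_cosTest (θ : ℝ → ℝ) (k : E3) :
    lap (cosTest θ k) = cosTest (fun t => -(ksq k) * θ t) k := by
  funext t x
  simp only [lap, dx_cosTest, dx_sinTest, cosTest, ksq]
  simp only [Fin.sum_univ_three]
  ring

lemma lap_sinTest (θ : ℝ → ℝ) (k : E3) :
    lap (sinTest θ k) = sinTest (fun t => -(ksq k) * θ t) k := by
  funext t x
  simp only [lap, dx_cosTest, dx_sinTest, sinTest, ksq]
  simp only [Fin.sum_univ_three]
  ring

/-- Pairing with `φ(t) cos(k·x)`. -/
def cosPair (P T : ℝ) (n : Fin 3 → ℤ) (G : ℝ × E3 → ℝ) (φ : ℝ → ℝ) : ℝ :=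
  ∫ z, G z * cosTest φ (waveVec P n) z.1 z.2 ∂slabMeasure P T

/-- Pairing with `φ(t) sin(k·x)`. -/
def sinPair (P T : ℝ) (n : Fin 3 → ℤ) (G : ℝ × E3 → ℝ) (φ : ℝ → ℝ) : ℝ :=
  ∫ z, G z * sinTest φ (waveVec P n) z.1 z.2 ∂slabMeasure P T

lemma continuous_cosTest {φ : ℝ → ℝ} (hφ : Continuous φ) (k : E3) :
    Continuous fun z : ℝ × E3 => cosTest φ k z.1 z.2 := by unfold cosTest; fun_prop

lemma continuous_sinTest {φ : ℝ → ℝ} (hφ : Continuous φ) (k : E3) :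
    Continuous fun z : ℝ × E3 => sinTest φ k z.1 z.2 := by unfold sinTest; fun_prop

lemma pairing_eq {n : Fin 3 → ℤ} {G : ℝ × E3 → ℝ} (hG : Integrable G (slabMeasure P T))
    {φ : ℝ → ℝ} (hφ : Continuous φ) :
    pairing P T n G φ = (cosPair P T n G φ : ℂ) - Complex.I * (sinPair P T n G φ : ℂ) := by
  have h1 := (integrable_mul_continuous hG (continuous_cosTest hφ (waveVec P n)))
  have h2 := (integrable_mul_continuous hG (continuous_sinTest hφ (waveVec P n)))
  have h1' : Integrable (fun z => ((G z * cosTest φ (waveVec P n) z.1 z.2 : ℝ) : ℂ))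
    (slabMeasure P T) := h1.ofReal
  have h2' : Integrable (fun z => ((G z * sinTest φ (waveVec P n) z.1 z.2 : ℝ) : ℂ))
    (slabMeasure P T) := h2.ofReal
  rw [cosPair, sinPair, ← integral_complex_ofReal, ← integral_complex_ofReal,
    ← integral_const_mul, ← integral_sub h1' (h2'.const_mul _), pairing]
  refine integral_congr_ae (Eventually.of_forall fun z => ?_)
  simp only [charFn_eq, cosTest, sinTest]
  push_cast
  ring

lemma cosPair_const_mul (n : Fin 3 → ℤ) (G : ℝ × E3 → ℝ) (c : ℝ) (φ : ℝ → ℝ) :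
    cosPair P T n G (fun t => c * φ t) = c * cosPair P T n G φ := by
  rw [cosPair, cosPair, ← integral_const_mul]
  refine integral_congr_ae (Eventually.of_forall fun z => ?_)
  simp only [cosTest]; ring

lemma sinPair_const_mul (n : Fin 3 → ℤ) (G : ℝ × E3 → ℝ) (c : ℝ) (φ : ℝ → ℝ) :
    sinPair P T n G (fun t => c * φ t) = c * sinPair P T n G φ := by
  rw [sinPair, sinPair, ← integral_const_mul]
  refine integral_congr_ae (Eventually.of_forall fun z => ?_)
  simp only [sinTest]; ring

lemma integral_momentum_split {𝕜 α : Type*} [RCLike 𝕜] [MeasurableSpace α] {m : Measure α}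
    {a c d e : α → 𝕜} {b : Fin 3 → α → 𝕜} (μ : 𝕜) (ha : Integrable a m)
    (hb : ∀ j, Integrable (b j) m) (hc : Integrable c m) (hd : Integrable d m)
    (he : Integrable e m) :
    ∫ z, (a z + (∑ j, b j z) + c z + μ * d z + e z) ∂m
      = ∫ z, a z ∂m + ∑ j, ∫ z, b j z ∂m + ∫ z, c z ∂m + μ * ∫ z, d z ∂m + ∫ z, e z ∂m := by
  have hbs : Integrable (fun z => ∑ j, b j z) m := integrable_finsetSum _ fun j _ => hb j
  have h1 : Integrable (fun z => a z + ∑ j, b j z) m := ha.add hbs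
  have h2 : Integrable (fun z => a z + (∑ j, b j z) + c z) m := h1.add hc
  have h3 : Integrable (fun z => a z + (∑ j, b j z) + c z + μ * d z) m := h2.add (hd.const_mul μ)
  rw [integral_add h3 he, integral_add h2 (hd.const_mul μ), integral_add h1 hc,
    integral_add ha hbs, integral_finsetSum _ fun j _ => hb j, integral_const_mul]

section Momentum

variable {μ : ℝ} {u₀ : E3 → E3} {f u : ℝ → E3 → E3} {p : ℝ → E3 → ℝ}

lemma memLp_component {v : ℝ → E3 → E3} {q : ℝ≥0∞}
    (hv : MemLp (Function.uncurry v) q (slabMeasure P T)) (i : Fin 3) :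
    MemLp (fun z : ℝ × E3 => v z.1 z.2 i) q (slabMeasure P T) :=
  (EuclideanSpace.proj (𝕜 := ℝ) i).comp_memLp' hv

lemma integrable_component {v : ℝ → E3 → E3}
    (hv : MemLp (Function.uncurry v) 2 (slabMeasure P T)) (i : Fin 3) :
    Integrable (fun z : ℝ × E3 => v z.1 z.2 i) (slabMeasure P T) :=
  (memLp_component hv i).integrable one_le_two

lemma integrable_component_mul {v w : ℝ → E3 → E3}
    (hv : MemLp (Function.uncurry v) 2 (slabMeasure P T))
    (hw : MemLp (Function.uncurry w) 2 (slabMeasure P T)) (i j : Fin 3) :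
    Integrable (fun z : ℝ × E3 => v z.1 z.2 i * w z.1 z.2 j) (slabMeasure P T) :=
  (memLp_component hv i).integrable_mul (memLp_component hw j)

/-- The momentum equation tested with `θ(t) exp(-i k·x)`. -/
lemma momentum_pairing (hP : 0 < P) (hu₀ : MemLp u₀ 2 (cellMeasure P))
    (hf : MemLp (Function.uncurry f) 2 (slabMeasure P T))
    (hu : MemLp (Function.uncurry u) 2 (slabMeasure P T))
    (hp : Integrable (Function.uncurry p) (slabMeasure P T))
    (hm : Momentum P T μ u₀ f u p) (hθ : IsTimeTest T θ) (n : Fin 3 → ℤ) (i : Fin 3) :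
    pairing P T n (fun z => u z.1 z.2 i) (deriv θ)
      + ∑ j, (-Complex.I * waveVec P n j) *
          pairing P T n (fun z => u z.1 z.2 i * u z.1 z.2 j) θ
      + (-Complex.I * waveVec P n i) * pairing P T n (Function.uncurry p) θ
      + (-(μ * ksq (waveVec P n)) : ℂ) * pairing P T n (fun z => u z.1 z.2 i) θ
      + pairing P T n (fun z => f z.1 z.2 i) θ
      + (∫ x, charFn P n x * (u₀ x i : ℂ) ∂cellMeasure P) * θ 0 = 0 := by
  set k := waveVec P n with hk
  have hc := hm i _ (isTest_cosTest hP hθ n)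
  have hs := hm i _ (isTest_sinTest hP hθ n)
  have cθ := hθ.smooth.continuous
  have cθ' : Continuous (deriv θ) := hθ.deriv.smooth.continuous
  have hui := integrable_component hu i
  have huu := fun j => integrable_component_mul hu hu i j
  have hfi := integrable_component hf i
  have hp' : Integrable (fun z : ℝ × E3 => p z.1 z.2) (slabMeasure P T) := hp
  have cm : ∀ c : ℝ, Continuous fun t => c * θ t := fun c => by fun_prop
  simp only [dt_cosTest hθ, dx_cosTest, lap_cosTest] at hc
  simp only [dt_sinTest hθ, dx_sinTest, lap_sinTest] at hs
  rw [integral_momentum_split μ (integrable_mul_continuous hui (continuous_cosTest cθ' _))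
    (fun j => integrable_mul_continuous (huu j) (continuous_sinTest (cm _) _))
    (integrable_mul_continuous (w := fun z => sinTest (fun t => -(waveVec P n i) * θ t)
      (waveVec P n) z.1 z.2) hp' (continuous_sinTest (cm _) _))
    (integrable_mul_continuous hui (continuous_cosTest (cm _) _))
    (integrable_mul_continuous hfi (continuous_cosTest cθ _))] at hc
  rw [integral_momentum_split μ (integrable_mul_continuous hui (continuous_sinTest cθ' _))
    (fun j => integrable_mul_continuous (huu j) (continuous_cosTest (cm _) _))
    (integrable_mul_continuous (w := fun z => cosTest (fun t => (waveVec P n i) * θ t)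
      (waveVec P n) z.1 z.2) hp' (continuous_cosTest (cm _) _))
    (integrable_mul_continuous hui (continuous_sinTest (cm _) _))
    (integrable_mul_continuous hfi (continuous_sinTest cθ _))] at hs
  have hc' : cosPair P T n (fun z => u z.1 z.2 i) (deriv θ)
      + ∑ j, -(k j) * sinPair P T n (fun z => u z.1 z.2 i * u z.1 z.2 j) θ
      + -(k i) * sinPair P T n (Function.uncurry p) θ
      + μ * (-(ksq k) * cosPair P T n (fun z => u z.1 z.2 i) θ)
      + cosPair P T n (fun z => f z.1 z.2 i) θ
      + (∫ x, u₀ x i * cosTest θ k 0 x ∂cellMeasure P) = 0 := by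
    simp only [← cosPair_const_mul, ← sinPair_const_mul]
    rw [cosPair_const_mul n _ μ]
    exact hc
  have hs' : sinPair P T n (fun z => u z.1 z.2 i) (deriv θ)
      + ∑ j, (k j) * cosPair P T n (fun z => u z.1 z.2 i * u z.1 z.2 j) θ
      + (k i) * cosPair P T n (Function.uncurry p) θ
      + μ * (-(ksq k) * sinPair P T n (fun z => u z.1 z.2 i) θ)
      + sinPair P T n (fun z => f z.1 z.2 i) θ
      + (∫ x, u₀ x i * sinTest θ k 0 x ∂cellMeasure P) = 0 := by
    simp only [← cosPair_const_mul, ← sinPair_const_mul]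
    rw [sinPair_const_mul n _ μ]
    exact hs
  have h0i : Integrable (fun x => u₀ x i) (cellMeasure P) :=
    ((EuclideanSpace.proj (𝕜 := ℝ) i).comp_memLp' hu₀).integrable one_le_two
  have h0 : (∫ x, charFn P n x * (u₀ x i : ℂ) ∂cellMeasure P) * θ 0
      = ((∫ x, u₀ x i * cosTest θ k 0 x ∂cellMeasure P : ℝ) : ℂ)
        - Complex.I * ((∫ x, u₀ x i * sinTest θ k 0 x ∂cellMeasure P : ℝ) : ℂ) := by
    have i1 : Integrable (fun x => u₀ x i * cosTest θ k 0 x) (cellMeasure P) := by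
      refine h0i.mul_bdd (c := |θ 0|) (by unfold cosTest; fun_prop)
        (Eventually.of_forall fun x => ?_)
      rw [cosTest, norm_mul, Real.norm_eq_abs, Real.norm_eq_abs]
      exact mul_le_of_le_one_right (abs_nonneg _) (Real.abs_cos_le_one _)
    have i2 : Integrable (fun x => u₀ x i * sinTest θ k 0 x) (cellMeasure P) := by
      refine h0i.mul_bdd (c := |θ 0|) (by unfold sinTest; fun_prop)
        (Eventually.of_forall fun x => ?_)
      rw [sinTest, norm_mul, Real.norm_eq_abs, Real.norm_eq_abs]
      exact mul_le_of_le_one_right (abs_nonneg _) (Real.abs_sin_le_one _)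
    have i1' : Integrable (fun x => ((u₀ x i * cosTest θ k 0 x : ℝ) : ℂ)) (cellMeasure P) :=
      i1.ofReal
    have i2' : Integrable (fun x => ((u₀ x i * sinTest θ k 0 x : ℝ) : ℂ)) (cellMeasure P) :=
      i2.ofReal
    rw [← integral_complex_ofReal, ← integral_complex_ofReal, ← integral_const_mul,
      ← integral_sub i1' (i2'.const_mul _), ← integral_mul_const]
    refine integral_congr_ae (Eventually.of_forall fun x => ?_)
    simp only [charFn_eq, cosTest, sinTest, hk]
    push_cast
    ring
  rw [h0, pairing_eq hui cθ', pairing_eq hp cθ, pairing_eq hui cθ, pairing_eq hfi cθ]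
  simp only [pairing_eq (huu _) cθ]
  have hcC := congrArg (fun x : ℝ => (x : ℂ)) hc'
  have hsC := congrArg (fun x : ℝ => (x : ℂ)) hs'
  push_cast at hcC hsC
  simp only [Fin.sum_univ_three] at hcC hsC ⊢
  have hI := Complex.I_sq
  -- Test functions are real, so `e^{-ik·x}` is obtained as the cosine equation minus `i` times the
  -- sine equation; the remaining terms use `i² = -1`.
  linear_combination hcC - Complex.I * hsC + ((k 0 : ℂ) * sinPair P T n
    (fun z => u z.1 z.2 i * u z.1 z.2 0) θ + (k 1 : ℂ) * sinPair P T n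
    (fun z => u z.1 z.2 i * u z.1 z.2 1) θ + (k 2 : ℂ) * sinPair P T n
    (fun z => u z.1 z.2 i * u z.1 z.2 2) θ + (k i : ℂ) * sinPair P T n
    (Function.uncurry p) θ) * hI

lemma divFree_pairing (hP : 0 < P) (hu : MemLp (Function.uncurry u) 2 (slabMeasure P T))
    (hd : DivFree P T u) (hθ : IsTimeTest T θ) (n : Fin 3 → ℤ) :
    ∑ j, (waveVec P n j : ℂ) * pairing P T n (fun z => u z.1 z.2 j) θ = 0 := by
  have hc := hd _ (isTest_cosTest hP hθ n)
  have hs := hd _ (isTest_sinTest hP hθ n)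
  have cθ := hθ.smooth.continuous
  have hui := fun j => integrable_component hu j
  have cm : ∀ c : ℝ, Continuous fun t => c * θ t := fun c => by fun_prop
  simp only [dx_cosTest] at hc
  simp only [dx_sinTest] at hs
  rw [integral_finsetSum _ fun j _ => integrable_mul_continuous (hui j)
    (continuous_sinTest (cm _) _)] at hc
  rw [integral_finsetSum _ fun j _ => integrable_mul_continuous (hui j)
    (continuous_cosTest (cm _) _)] at hs
  have hc' : ∑ j, -(waveVec P n j) * sinPair P T n (fun z => u z.1 z.2 j) θ = 0 := by
    simp only [← sinPair_const_mul]
    exact hc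
  have hs' : ∑ j, (waveVec P n j) * cosPair P T n (fun z => u z.1 z.2 j) θ = 0 := by
    simp only [← cosPair_const_mul]
    exact hs
  simp only [pairing_eq (hui _) cθ]
  have hcC := congrArg (fun x : ℝ => (x : ℂ)) hc'
  have hsC := congrArg (fun x : ℝ => (x : ℂ)) hs'
  push_cast at hcC hsC
  simp only [Fin.sum_univ_three] at hcC hsC ⊢
  linear_combination hsC + Complex.I * hcC

end Momentum

end TrigTests

end

/-! ### The equations for the Fourier coefficients -/

section

open UnitAddTorus

section FourierEquation

variable {P T μ : ℝ} {u₀ : E3 → E3} {f u : ℝ → E3 → E3} {p : ℝ → E3 → ℝ}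

lemma integrable_mul_of_continuous_time {h : ℝ → ℂ} (hh : Integrable h (timeMeasure T))
    {φ : ℝ → ℝ} (hφ : Continuous φ) : Integrable (fun t => h t * φ t) (timeMeasure T) := by
  obtain ⟨K, hK⟩ := (isCompact_Icc (a := (0 : ℝ)) (b := T)).exists_bound_of_continuousOn
    hφ.continuousOn
  refine hh.mul_bdd (c := K) (by fun_prop) ?_
  filter_upwards [ae_restrict_mem measurableSet_Ico] with t ht
  rw [Complex.norm_real]
  exact hK t ⟨ht.1, ht.2.le⟩

/-- The `n`-th Fourier coefficient in space of a function on the slab. -/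
def fc (P : ℝ) (n : Fin 3 → ℤ) (G : ℝ × E3 → ℝ) (t : ℝ) : ℂ := scoef (lift P G) t n

lemma integrable_fc (hP : 0 < P) {G : ℝ × E3 → ℝ} (hG : Integrable G (slabMeasure P T))
    (n : Fin 3 → ℤ) : Integrable (fc P n G) (timeMeasure T) :=
  integrable_scoef (integrable_lift hP hG) n

/-- The `n`-th Fourier coefficient of the `i`-th component of the initial velocity. -/
def initCoef (P : ℝ) (u₀ : E3 → E3) (n : Fin 3 → ℤ) (i : Fin 3) : ℂ :=
  ((P : ℂ) ^ 3)⁻¹ * ∫ x, charFn P n x * (u₀ x i : ℂ) ∂cellMeasure P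

/-- The Fourier coefficient of `-∇·(u ⊗ u) - ∇p + μ Δu + f`. -/
def accel (P μ : ℝ) (f u : ℝ → E3 → E3) (p : ℝ → E3 → ℝ) (n : Fin 3 → ℤ) (i : Fin 3) (t : ℝ) :
    ℂ :=
  ∑ j, (-Complex.I * waveVec P n j) * fc P n (fun z => u z.1 z.2 i * u z.1 z.2 j) t
    + (-Complex.I * waveVec P n i) * fc P n (Function.uncurry p) t
    + (-(μ * ksq (waveVec P n)) : ℂ) * fc P n (fun z => u z.1 z.2 i) t
    + fc P n (fun z => f z.1 z.2 i) t

lemma integrable_accel (hP : 0 < P)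
    (hf : MemLp (Function.uncurry f) 2 (slabMeasure P T))
    (hu : MemLp (Function.uncurry u) 2 (slabMeasure P T))
    (hp : Integrable (Function.uncurry p) (slabMeasure P T)) (n : Fin 3 → ℤ) (i : Fin 3) :
    Integrable (accel P μ f u p n i) (timeMeasure T) := by
  unfold accel
  refine (((integrable_finsetSum _ fun j _ => ?_).add ?_).add ?_).add ?_
  · exact (integrable_fc hP (integrable_component_mul hu hu i j) n).const_mul _
  · exact (integrable_fc hP hp n).const_mul _
  · exact (integrable_fc hP (integrable_component hu i) n).const_mul _
  · exact integrable_fc hP (integrable_component hf i) n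

lemma momentum_fourier (hP : 0 < P) (hu₀ : MemLp u₀ 2 (cellMeasure P))
    (hf : MemLp (Function.uncurry f) 2 (slabMeasure P T))
    (hu : MemLp (Function.uncurry u) 2 (slabMeasure P T))
    (hp : Integrable (Function.uncurry p) (slabMeasure P T))
    (hm : Momentum P T μ u₀ f u p) {θ : ℝ → ℝ} (hθ : IsTimeTest T θ) (n : Fin 3 → ℤ)
    (i : Fin 3) :
    (∫ t, (fc P n (fun z => u z.1 z.2 i) t * deriv θ t + accel P μ f u p n i t * θ t)
      ∂timeMeasure T) + initCoef P u₀ n i * θ 0 = 0 := by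
  have hui := integrable_component hu i
  have huu := fun j => integrable_component_mul hu hu i j
  have hfi := integrable_component hf i
  have cθ := hθ.smooth.continuous
  have cθ' : Continuous (deriv θ) := hθ.deriv.smooth.continuous
  have I1 := fun (G : ℝ × E3 → ℝ) (hG : Integrable G (slabMeasure P T)) =>
    integrable_mul_of_continuous_time (integrable_fc hP hG n) cθ
  have hsplit := integral_momentum_split (m := timeMeasure T) (1 : ℂ)
    (integrable_mul_of_continuous_time (integrable_fc hP hui n) cθ')
    (fun j => (I1 _ (huu j)).const_mul (-Complex.I * waveVec P n j))
    ((I1 _ hp).const_mul (-Complex.I * waveVec P n i))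
    ((I1 _ hui).const_mul (-(μ * ksq (waveVec P n)) : ℂ)) (I1 _ hfi)
  have e : ∀ t, fc P n (fun z => u z.1 z.2 i) t * deriv θ t + accel P μ f u p n i t * θ t
      = fc P n (fun z => u z.1 z.2 i) t * deriv θ t
        + (∑ j, (-Complex.I * waveVec P n j) *
          (fc P n (fun z => u z.1 z.2 i * u z.1 z.2 j) t * θ t))
        + (-Complex.I * waveVec P n i) * (fc P n (Function.uncurry p) t * θ t)
        + 1 * ((-(μ * ksq (waveVec P n)) : ℂ) * (fc P n (fun z => u z.1 z.2 i) t * θ t))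
        + fc P n (fun z => f z.1 z.2 i) t * θ t := fun t => by
    simp only [accel, Fin.sum_univ_three]; ring
  simp only [e]
  rw [hsplit]
  simp only [integral_const_mul]
  have J : ∀ (G : ℝ × E3 → ℝ) (hG : Integrable G (slabMeasure P T)) (φ : ℝ → ℝ)
      (hφ : Continuous φ), ∫ t, fc P n G t * φ t ∂timeMeasure T
        = ((P : ℂ) ^ 3)⁻¹ * pairing P T n G φ := fun G hG φ hφ => integral_scoef_lift hP hG n hφ
  rw [J _ hui _ cθ', J _ hp _ cθ, J _ hui _ cθ, J _ hfi _ cθ]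
  simp only [J _ (huu _) _ cθ]
  have := momentum_pairing hP hu₀ hf hu hp hm hθ n i
  rw [initCoef]
  simp only [Fin.sum_univ_three] at this ⊢
  linear_combination ((P : ℂ) ^ 3)⁻¹ * this

lemma divFree_fourier (hP : 0 < P) (hu : MemLp (Function.uncurry u) 2 (slabMeasure P T))
    (hd : DivFree P T u) (n : Fin 3 → ℤ) :
    ∀ᵐ t ∂timeMeasure T, ∑ j, (waveVec P n j : ℂ) * fc P n (fun z => u z.1 z.2 j) t = 0 := by
  have hui := fun j => integrable_component hu j
  refine ae_eq_zero_of_forall_test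
    (integrable_finsetSum _ fun j _ => (integrable_fc hP (hui j) n).const_mul _) fun θ hθ => ?_
  have cθ := hθ.smooth.continuous
  have h := divFree_pairing hP hu hd hθ n
  simp only [Finset.sum_mul, mul_assoc]
  rw [integral_finsetSum _ fun j _ =>
    (integrable_mul_of_continuous_time (integrable_fc hP (hui j) n) cθ).const_mul _]
  simp only [integral_const_mul]
  have J : ∀ j, ∫ t, fc P n (fun z => u z.1 z.2 j) t * θ t ∂timeMeasure T
        = ((P : ℂ) ^ 3)⁻¹ * pairing P T n (fun z => u z.1 z.2 j) θ :=
    fun j => integral_scoef_lift hP (hui j) n cθ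
  simp only [J, Fin.sum_univ_three] at h ⊢
  linear_combination ((P : ℂ) ^ 3)⁻¹ * h

/-- The pressure equation for the difference of two solutions with the same data. -/
lemma pressure_fourier {μ' : ℝ} {u' : ℝ → E3 → E3} {p' : ℝ → E3 → ℝ} (hP : 0 < P)
    (hu₀ : MemLp u₀ 2 (cellMeasure P)) (hf : MemLp (Function.uncurry f) 2 (slabMeasure P T))
    (hu : MemLp (Function.uncurry u) 2 (slabMeasure P T))
    (hp : Integrable (Function.uncurry p) (slabMeasure P T))
    (hm : Momentum P T μ u₀ f u p) (hd : DivFree P T u)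
    (hu' : MemLp (Function.uncurry u') 2 (slabMeasure P T))
    (hp' : Integrable (Function.uncurry p') (slabMeasure P T))
    (hm' : Momentum P T μ' u₀ f u' p') (hd' : DivFree P T u') (n : Fin 3 → ℤ) :
    ∀ᵐ t ∂timeMeasure T, (ksq (waveVec P n) : ℂ) *
        (fc P n (Function.uncurry p) t - fc P n (Function.uncurry p') t)
      = -∑ i, ∑ j, ((waveVec P n i : ℂ) * waveVec P n j) *
        (fc P n (fun z => u z.1 z.2 i * u z.1 z.2 j) t
          - fc P n (fun z => u' z.1 z.2 i * u' z.1 z.2 j) t) := by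
  -- The divergence of the difference of the two equations. The time derivatives disappear because
  -- both fields are divergence free, and the initial terms cancel because the data agree; hence `A
  -- = 0` almost everywhere.
  set A : ℝ → ℂ := fun t => ∑ i, (waveVec P n i : ℂ) *
    (accel P μ f u p n i t - accel P μ' f u' p' n i t) with hA
  have hAi : Integrable A (timeMeasure T) := integrable_finsetSum _ fun i _ =>
    ((integrable_accel hP hf hu hp n i).sub (integrable_accel hP hf hu' hp' n i)).const_mul _
  have hd1 := divFree_fourier hP hu hd n
  have hd2 := divFree_fourier hP hu' hd' n
  have key := ae_eq_zero_of_forall_test hAi fun θ hθ => by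
    have cθ := hθ.smooth.continuous
    have cθ' : Continuous (deriv θ) := hθ.deriv.smooth.continuous
    have h1 := fun i => momentum_fourier hP hu₀ hf hu hp hm hθ n i
    have h2 := fun i => momentum_fourier hP hu₀ hf hu' hp' hm' hθ n i
    have i1 : ∀ i, Integrable (fun t => fc P n (fun z => u z.1 z.2 i) t * deriv θ t
        + accel P μ f u p n i t * θ t) (timeMeasure T) := fun i =>
      (integrable_mul_of_continuous_time (integrable_fc hP (integrable_component hu i) n) cθ').add
        (integrable_mul_of_continuous_time (integrable_accel hP hf hu hp n i) cθ)
    have i2 : ∀ i, Integrable (fun t => fc P n (fun z => u' z.1 z.2 i) t * deriv θ t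
        + accel P μ' f u' p' n i t * θ t) (timeMeasure T) := fun i =>
      (integrable_mul_of_continuous_time (integrable_fc hP (integrable_component hu' i) n)
        cθ').add (integrable_mul_of_continuous_time (integrable_accel hP hf hu' hp' n i) cθ)
    have e : ∫ t, A t * θ t ∂timeMeasure T = ∫ t, ∑ i, (waveVec P n i : ℂ) *
        ((fc P n (fun z => u z.1 z.2 i) t * deriv θ t + accel P μ f u p n i t * θ t)
          - (fc P n (fun z => u' z.1 z.2 i) t * deriv θ t + accel P μ' f u' p' n i t * θ t))
        ∂timeMeasure T := by
      refine integral_congr_ae ?_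
      filter_upwards [hd1, hd2] with t h1 h2
      simp only [hA, Fin.sum_univ_three] at h1 h2 ⊢
      linear_combination (-((deriv θ t : ℝ) : ℂ)) * h1 + ((deriv θ t : ℝ) : ℂ) * h2
    have i3 : ∀ i, Integrable (fun t => (waveVec P n i : ℂ) *
        ((fc P n (fun z => u z.1 z.2 i) t * deriv θ t + accel P μ f u p n i t * θ t)
          - (fc P n (fun z => u' z.1 z.2 i) t * deriv θ t + accel P μ' f u' p' n i t * θ t)))
        (timeMeasure T) := fun i => ((i1 i).sub (i2 i)).const_mul _
    rw [e, integral_finsetSum _ fun i _ => i3 i]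
    refine Finset.sum_eq_zero fun i _ => ?_
    rw [integral_const_mul, integral_sub (i1 i) (i2 i)]
    linear_combination (waveVec P n i : ℂ) * h1 i - (waveVec P n i : ℂ) * h2 i
  filter_upwards [key, hd1, hd2] with t h h1 h2
  simp only [hA, accel, Fin.sum_univ_three, ksq] at h h1 h2 ⊢
  push_cast at h ⊢
  -- Each spatial derivative contributes `-i k`. After removal of one factor `i`, the viscous terms
  -- vanish by incompressibility even though the two viscosities differ.
  refine mul_left_cancel₀ Complex.I_ne_zero ?_
  linear_combination (-1 : ℂ) * h
    - μ * ((waveVec P n 0 : ℂ) ^ 2 + (waveVec P n 1 : ℂ) ^ 2 + (waveVec P n 2 : ℂ) ^ 2) * h1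
    + μ' * ((waveVec P n 0 : ℂ) ^ 2 + (waveVec P n 1 : ℂ) ^ 2 + (waveVec P n 2 : ℂ) ^ 2) * h2

end FourierEquation

end

/-! ### Leray projection, and time primitives uniform in the viscosity -/

section

open UnitAddTorus

section Equicontinuity

variable {P T μ : ℝ} {u₀ : E3 → E3} {f u : ℝ → E3 → E3} {p : ℝ → E3 → ℝ}

/-- The `l`-th component of the projection of the `i`-th basis vector on the plane orthogonal
to `k`; for `k = 0` the projection is the identity. -/
def lerayWeight (k : E3) (i l : Fin 3) : ℝ := (if l = i then 1 else 0) - k i * k l / ksq k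

lemma ksq_eq_zero {k : E3} (h : ksq k = 0) (j : Fin 3) : k j = 0 := by
  have := (Finset.sum_eq_zero_iff_of_nonneg fun j _ => sq_nonneg (k j)).1 h j (Finset.mem_univ j)
  exact pow_eq_zero_iff (two_ne_zero) |>.1 this

/-- The projection annihilates `k`, hence the pressure gradient. For `k = 0` the convention `x / 0 =
0` makes the identity trivial. -/
lemma sum_lerayWeight_mul (k : E3) (i : Fin 3) : ∑ l, lerayWeight k i l * k l = 0 := by
  have e : ∑ l, lerayWeight k i l * k l = k i - k i * (ksq k / ksq k) := by
    simp only [lerayWeight, sub_mul, Finset.sum_sub_distrib, ite_mul, one_mul, zero_mul,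
      Finset.sum_ite_eq', Finset.mem_univ, if_true]
    congr 1
    rw [ksq, Finset.sum_div, Finset.mul_sum]
    exact Finset.sum_congr rfl fun l _ => by ring
  rw [e]
  rcases eq_or_ne (ksq k) 0 with h | h
  · rw [ksq_eq_zero h i]; simp
  · rw [div_self h]; ring

lemma sum_lerayWeight_of_orthogonal (k : E3) (i : Fin 3) {w : Fin 3 → ℂ}
    (hw : ∑ j, (k j : ℂ) * w j = 0) : ∑ l, (lerayWeight k i l : ℂ) * w l = w i := by
  have : ∑ l, (lerayWeight k i l : ℂ) * w l
      = w i - (k i / ksq k : ℂ) * ∑ j, (k j : ℂ) * w j := by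
    simp only [lerayWeight, Complex.ofReal_sub, sub_mul, Finset.sum_sub_distrib]
    congr 1
    · simp [apply_ite Complex.ofReal]
    · rw [Finset.mul_sum]
      refine Finset.sum_congr rfl fun l _ => ?_
      push_cast; ring
  rw [this, hw]; ring

/-- Up to a null set of times, the Fourier coefficients of the velocity are primitives of functions
that are bounded independently of the viscosity. -/
lemma exists_primitive_fc (hP : 0 < P) {L M : ℝ} (hM : 0 ≤ M) (n : Fin 3 → ℤ) (i : Fin 3) :
    ∃ K : ℝ, 0 ≤ K ∧ ∀ (μ : ℝ) (u₀ : E3 → E3) (f u : ℝ → E3 → E3) (p : ℝ → E3 → ℝ),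
      |μ| ≤ L → MemLp u₀ 2 (cellMeasure P) →
      MemLp (Function.uncurry f) 2 (slabMeasure P T) →
      MemLp (Function.uncurry u) 2 (slabMeasure P T) →
      Integrable (Function.uncurry p) (slabMeasure P T) →
      Momentum P T μ u₀ f u p → DivFree P T u →
      (∀ᵐ t ∂timeMeasure T, ∀ j, ‖fc P n (fun z => u z.1 z.2 j) t‖ ≤ M) →
      (∀ᵐ t ∂timeMeasure T, ∀ l j, ‖fc P n (fun z => u z.1 z.2 l * u z.1 z.2 j) t‖ ≤ M) →
      ∃ (c : ℂ) (h : ℝ → ℂ), Integrable h (timeMeasure T) ∧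
        (∀ᵐ t ∂timeMeasure T, fc P n (fun z => u z.1 z.2 i) t = c + ∫ s in Ico 0 t, h s) ∧
        ∀ᵐ t ∂timeMeasure T, ‖h t‖ ≤ K * (1 + ∑ l, ‖fc P n (fun z => f z.1 z.2 l) t‖) := by
  set k := waveVec P n with hk
  -- The summands bound the convective term, the viscous term and the force, weighted by the
  -- projection. The maximum with `0` covers a negative `L`, for which no `μ` is admissible.
  refine ⟨(∑ l, |lerayWeight k i l| * (∑ j, |k j| * M + L * ksq k * M + 1)) ⊔ 0,
    le_max_right _ _, ?_⟩
  intro μ u₀ f u p hμ hu₀ hf hu hp hm hd hb1 hb2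
  have hacc := fun l => integrable_accel (μ := μ) hP hf hu hp n l
  have hode : ∀ l, ∀ᵐ t ∂timeMeasure T, fc P n (fun z => u z.1 z.2 l) t
      = initCoef P u₀ n l + ∫ s in Ico 0 t, accel P μ f u p n l s := fun l =>
    complex_eq_add_integral_of_forall_test (integrable_fc hP (integrable_component hu l) n)
      (hacc l) _ fun θ hθ => momentum_fourier hP hu₀ hf hu hp hm hθ n l
  refine ⟨∑ l, (lerayWeight k i l : ℂ) * initCoef P u₀ n l,
    fun t => ∑ l, (lerayWeight k i l : ℂ) * accel P μ f u p n l t,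
    integrable_finsetSum _ fun l _ => (hacc l).const_mul _, ?_, ?_⟩
  · filter_upwards [ae_all_iff.2 hode, divFree_fourier hP hu hd n,
      ae_restrict_mem measurableSet_Ico] with t h1 h2 h3
    have hsub : Ico 0 t ⊆ Ico 0 T := Ico_subset_Ico_right h3.2.le
    rw [integral_finsetSum _ fun l _ => ((hacc l).mono_measure
      (Measure.restrict_mono hsub le_rfl)).const_mul _,
      ← sum_lerayWeight_of_orthogonal k i h2, ← Finset.sum_add_distrib]
    refine Finset.sum_congr rfl fun l _ => ?_
    rw [integral_const_mul, h1 l]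
    ring
  · filter_upwards [hb1, hb2] with t h1 h2
    set F := ∑ l, ‖fc P n (fun z => f z.1 z.2 l) t‖ with hF
    have hF0 : 0 ≤ F := Finset.sum_nonneg fun _ _ => norm_nonneg _
    have hq : 0 ≤ ksq k := Finset.sum_nonneg fun j _ => sq_nonneg _
    -- The pressure is removed before taking norms, since its coefficients have no bound independent
    -- of the viscosity.
    have e : ∑ l, (lerayWeight k i l : ℂ) * accel P μ f u p n l t
        = ∑ l, (lerayWeight k i l : ℂ) *
          (∑ j, (-Complex.I * k j) * fc P n (fun z => u z.1 z.2 l * u z.1 z.2 j) t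
            + (-(μ * ksq k) : ℂ) * fc P n (fun z => u z.1 z.2 l) t
            + fc P n (fun z => f z.1 z.2 l) t) := by
      have h0 := congrArg (fun x : ℝ => (x : ℂ)) (sum_lerayWeight_mul k i)
      push_cast at h0
      rw [← sub_eq_zero, ← Finset.sum_sub_distrib]
      rw [← mul_zero (-Complex.I * fc P n (Function.uncurry p) t), ← h0, Finset.mul_sum]
      refine Finset.sum_congr rfl fun l _ => ?_
      rw [accel]
      ring
    change ‖∑ l, (lerayWeight k i l : ℂ) * accel P μ f u p n l t‖ ≤ _
    rw [e]
    set B := ∑ j, |k j| * M + L * ksq k * M + 1 with hB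
    have hL : 0 ≤ L := (abs_nonneg μ).trans hμ
    have hB1 : 1 ≤ B := by
      have : 0 ≤ ∑ j, |k j| * M := Finset.sum_nonneg fun j _ => by positivity
      have : 0 ≤ L * ksq k * M := by positivity
      linarith
    have hterm : ∀ l, ‖∑ j, (-Complex.I * k j) * fc P n (fun z => u z.1 z.2 l * u z.1 z.2 j) t
            + (-(μ * ksq k) : ℂ) * fc P n (fun z => u z.1 z.2 l) t
            + fc P n (fun z => f z.1 z.2 l) t‖ ≤ B * (1 + F) := fun l => by
      have a1 : ‖∑ j, (-Complex.I * k j) * fc P n (fun z => u z.1 z.2 l * u z.1 z.2 j) t‖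
          ≤ ∑ j, |k j| * M := by
        refine norm_sum_le_of_le _ fun j _ => ?_
        rw [norm_mul, norm_mul, norm_neg, Complex.norm_I, one_mul, Complex.norm_real,
          Real.norm_eq_abs]
        exact mul_le_mul_of_nonneg_left (h2 l j) (abs_nonneg _)
      have a2 : ‖(-(μ * ksq k) : ℂ) * fc P n (fun z => u z.1 z.2 l) t‖ ≤ L * ksq k * M := by
        rw [norm_mul, norm_neg, norm_mul, Complex.norm_real, Complex.norm_real,
          Real.norm_eq_abs, Real.norm_eq_abs, abs_of_nonneg hq]
        gcongr
        exact h1 l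
      have a3 : ‖fc P n (fun z => f z.1 z.2 l) t‖ ≤ F :=
        Finset.single_le_sum (f := fun l => ‖fc P n (fun z => f z.1 z.2 l) t‖)
          (fun _ _ => norm_nonneg _) (Finset.mem_univ l)
      calc _ ≤ (∑ j, |k j| * M + L * ksq k * M) + F := by
            refine (norm_add_le _ _).trans (add_le_add ((norm_add_le _ _).trans
              (add_le_add a1 a2)) a3)
        _ ≤ B * (1 + F) := by nlinarith
    refine le_trans ?_ (mul_le_mul_of_nonneg_right (le_max_left _ _) (by linarith))
    rw [Finset.sum_mul]
    refine norm_sum_le_of_le _ fun l _ => ?_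
    rw [norm_mul, Complex.norm_real, Real.norm_eq_abs, mul_assoc]
    exact mul_le_mul_of_nonneg_left (hterm l) (abs_nonneg _)

end Equicontinuity

/-! ### Global energy inequality and uniform bounds -/

section Energy

variable {P T μ : ℝ} {u₀ : E3 → E3} {f u : ℝ → E3 → E3} {p : ℝ → E3 → ℝ}

lemma isTest_time (P : ℝ) {θ : ℝ → ℝ} (hθ : IsTimeTest T θ) : IsTest P T fun t _ => θ t where
  smooth := hθ.smooth.comp contDiff_fst
  periodic _ _ _ := rfl
  support := by
    obtain ⟨T', hT', h⟩ := hθ.support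
    exact ⟨T', hT', fun t ht _ => h t ht⟩

lemma dx_time (θ : ℝ → ℝ) (j : Fin 3) : dx j (fun t _ => θ t) = fun _ _ => 0 := by
  funext t x
  simp [dx]

lemma lap_time (θ : ℝ → ℝ) : lap (fun t _ => θ t) = fun _ _ => 0 := by
  funext t x
  simp [lap, dx_time]

/-- The kinetic energy at time `t`, up to the factor `1/2`. -/
def kinetic (P : ℝ) (u : ℝ → E3 → E3) (t : ℝ) : ℝ := ∫ x, ‖u t x‖ ^ 2 ∂cellMeasure P

/-- The power of the force at time `t`. -/
def power (P : ℝ) (f u : ℝ → E3 → E3) (t : ℝ) : ℝ := ∫ x, inner ℝ (f t x) (u t x) ∂cellMeasure P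

lemma integrable_norm_sq_slab (hu : MemLp (Function.uncurry u) 2 (slabMeasure P T)) :
    Integrable (fun z : ℝ × E3 => ‖u z.1 z.2‖ ^ 2) (slabMeasure P T) :=
  (memLp_two_iff_integrable_sq_norm hu.1).1 hu

lemma integrable_inner_slab (hf : MemLp (Function.uncurry f) 2 (slabMeasure P T))
    (hu : MemLp (Function.uncurry u) 2 (slabMeasure P T)) :
    Integrable (fun z : ℝ × E3 => inner ℝ (f z.1 z.2) (u z.1 z.2)) (slabMeasure P T) := by
  refine ((integrable_norm_sq_slab hf).add (integrable_norm_sq_slab hu)).mono'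
    (hf.1.inner (𝕜 := ℝ) hu.1) (Eventually.of_forall fun z => ?_)
  refine (norm_inner_le_norm _ _).trans ?_
  simp only [Pi.add_apply]
  nlinarith [sq_nonneg (‖f z.1 z.2‖ - ‖u z.1 z.2‖), sq_nonneg ‖f z.1 z.2‖, sq_nonneg ‖u z.1 z.2‖]

lemma integrable_kinetic (hu : MemLp (Function.uncurry u) 2 (slabMeasure P T)) :
    Integrable (kinetic P u) (timeMeasure T) :=
  (integrable_norm_sq_slab hu).integral_prod_left

lemma integrable_power (hf : MemLp (Function.uncurry f) 2 (slabMeasure P T))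
    (hu : MemLp (Function.uncurry u) 2 (slabMeasure P T)) :
    Integrable (power P f u) (timeMeasure T) :=
  (integrable_inner_slab hf hu).integral_prod_left

lemma integral_slab {F : ℝ × E3 → ℝ} (hF : Integrable F (slabMeasure P T)) :
    ∫ z, F z ∂slabMeasure P T = ∫ t, ∫ x, F (t, x) ∂cellMeasure P ∂timeMeasure T :=
  integral_prod _ hF

/-- Test functions depending on time alone make the flux and the Laplacian disappear, and the
dissipation has a sign and can be discarded. -/
lemma energy_inequality (hμ : 0 ≤ μ) (hf : MemLp (Function.uncurry f) 2 (slabMeasure P T))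
    (hu : MemLp (Function.uncurry u) 2 (slabMeasure P T)) {G : Fin 3 → Fin 3 → ℝ → E3 → ℝ}
    (hG : LocalEnergyIneq P T μ u₀ f u p G) :
    ∀ᵐ t ∂timeMeasure T, kinetic P u t
      ≤ ∫ x, ‖u₀ x‖ ^ 2 ∂cellMeasure P + 2 * ∫ s in Ico 0 t, power P f u s := by
  have h := le_add_integral_of_forall_test (T := T) (g := fun t => kinetic P u t / 2)
    (h := power P f u) ((integrable_kinetic hu).div_const 2) (integrable_power hf hu)
    ((∫ x, ‖u₀ x‖ ^ 2 ∂cellMeasure P) / 2) fun θ hθ h0 => by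
      have h := hG _ (isTest_time P hθ) (fun t _ => h0 t)
      have hl : 0 ≤ μ * ∫ z, (∑ i, ∑ j, G i j z.1 z.2 ^ 2) * θ z.1 ∂(slabMeasure P T) :=
        mul_nonneg hμ (integral_nonneg fun z => mul_nonneg
          (Finset.sum_nonneg fun i _ => Finset.sum_nonneg fun j _ => sq_nonneg _) (h0 _))
      have h2 := hl.trans h
      simp only [dx_time, lap_time, dt, mul_zero, Finset.sum_const_zero, add_zero] at h2
      have cθ : Continuous fun z : ℝ × E3 => θ z.1 := hθ.smooth.continuous.comp continuous_fst
      have cθ' : Continuous fun z : ℝ × E3 => deriv θ z.1 :=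
        hθ.deriv.smooth.continuous.comp continuous_fst
      have i1 : Integrable (fun z : ℝ × E3 => ‖u z.1 z.2‖ ^ 2 / 2 * deriv θ z.1)
          (slabMeasure P T) :=
        integrable_mul_continuous ((integrable_norm_sq_slab hu).div_const 2) cθ'
      have i2 : Integrable (fun z : ℝ × E3 => inner ℝ (f z.1 z.2) (u z.1 z.2) * θ z.1)
          (slabMeasure P T) :=
        integrable_mul_continuous (integrable_inner_slab hf hu) cθ
      have i3 : Integrable (fun z : ℝ × E3 => ‖u z.1 z.2‖ ^ 2 / 2 * deriv (fun s => θ s) z.1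
          + inner ℝ (f z.1 z.2) (u z.1 z.2) * θ z.1) (slabMeasure P T) := i1.add i2
      rw [integral_slab i3] at h2
      have e : ∫ t, (kinetic P u t / 2 * deriv θ t + power P f u t * θ t) ∂timeMeasure T
          = ∫ t, ∫ x, (‖u t x‖ ^ 2 / 2 * deriv θ t + inner ℝ (f t x) (u t x) * θ t)
            ∂cellMeasure P ∂timeMeasure T := by
        have j1 : ∀ᵐ t ∂timeMeasure T, Integrable (fun x => ‖u t x‖ ^ 2 / 2 * deriv θ t)
          (cellMeasure P) := i1.prod_right_ae
        have j2 : ∀ᵐ t ∂timeMeasure T, Integrable (fun x => inner ℝ (f t x) (u t x) * θ t)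
          (cellMeasure P) := i2.prod_right_ae
        refine integral_congr_ae ?_
        filter_upwards [j1, j2] with t h1 h2
        rw [integral_add h1 h2, integral_mul_const, integral_mul_const, integral_div, kinetic,
          power]
      rw [e]
      rw [integral_mul_const, integral_div] at h2
      exact h2
  filter_upwards [h] with t ht
  linarith

/-- A bound for the kinetic energy that depends only on the data. -/
def energyBound (P T : ℝ) (u₀ : E3 → E3) (f : ℝ → E3 → E3) : ℝ :=
  2 * ∫ x, ‖u₀ x‖ ^ 2 ∂cellMeasure P + 4 * T * ∫ z, ‖f z.1 z.2‖ ^ 2 ∂slabMeasure P T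

lemma energyBound_nonneg (hT : 0 < T) (u₀ : E3 → E3) (f : ℝ → E3 → E3) :
    0 ≤ energyBound P T u₀ f := by
  have h1 : 0 ≤ ∫ x, ‖u₀ x‖ ^ 2 ∂cellMeasure P := integral_nonneg fun _ => by positivity
  have h2 : 0 ≤ ∫ z, ‖f z.1 z.2‖ ^ 2 ∂slabMeasure P T := integral_nonneg fun _ => by positivity
  unfold energyBound
  positivity

/-- Young's inequality with weight `2T` bounds the work of the force by `2TF + X/(2T)`, where `X` is
the kinetic energy integrated in time. Integration over `[0,T)` turns the last term into `X/2`,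
which is absorbed. -/
lemma kinetic_le_energyBound (hT : 0 < T) (hf : MemLp (Function.uncurry f) 2 (slabMeasure P T))
    (hu : MemLp (Function.uncurry u) 2 (slabMeasure P T))
    (h : ∀ᵐ t ∂timeMeasure T, kinetic P u t
      ≤ ∫ x, ‖u₀ x‖ ^ 2 ∂cellMeasure P + 2 * ∫ s in Ico 0 t, power P f u s) :
    ∀ᵐ t ∂timeMeasure T, kinetic P u t ≤ energyBound P T u₀ f := by
  set E₀ := ∫ x, ‖u₀ x‖ ^ 2 ∂cellMeasure P with hE₀
  set F := ∫ z, ‖f z.1 z.2‖ ^ 2 ∂slabMeasure P T with hF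
  set X := ∫ t, kinetic P u t ∂timeMeasure T with hX
  have hXs : X = ∫ z, ‖u z.1 z.2‖ ^ 2 ∂slabMeasure P T :=
    (integral_slab (integrable_norm_sq_slab hu)).symm
  have hyoung : ∀ t ∈ Ico 0 T, 2 * ∫ s in Ico 0 t, power P f u s ≤ 2 * T * F + X / (2 * T) := by
    intro t ht
    have hsub : Ico 0 t ⊆ Ico 0 T := Ico_subset_Ico_right ht.2.le
    have hle := Measure.restrict_mono hsub (le_refl (volume : Measure ℝ))
    have iQ : Integrable (fun s => 2 * T * kinetic P f s + kinetic P u s / (2 * T))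
        (timeMeasure T) :=
      ((integrable_kinetic hf).const_mul _).add ((integrable_kinetic hu).div_const _)
    have hk0 : ∀ (w : ℝ → E3 → E3) s, 0 ≤ kinetic P w s := fun w s =>
      integral_nonneg fun _ => by positivity
    have hpt : ∀ᵐ s ∂timeMeasure T, 2 * power P f u s
        ≤ 2 * T * kinetic P f s + kinetic P u s / (2 * T) := by
      have j1 : ∀ᵐ s ∂timeMeasure T, Integrable (fun x => ‖f s x‖ ^ 2) (cellMeasure P) :=
        (integrable_norm_sq_slab hf).prod_right_ae
      have j2 : ∀ᵐ s ∂timeMeasure T, Integrable (fun x => ‖u s x‖ ^ 2) (cellMeasure P) :=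
        (integrable_norm_sq_slab hu).prod_right_ae
      have j3 : ∀ᵐ s ∂timeMeasure T, Integrable (fun x => inner ℝ (f s x) (u s x))
        (cellMeasure P) := (integrable_inner_slab hf hu).prod_right_ae
      filter_upwards [j1, j2, j3] with s h1 h2 h3
      rw [power, kinetic, kinetic, ← integral_const_mul, ← integral_const_mul, ← integral_div,
        ← integral_add (h1.const_mul _) (h2.div_const _)]
      refine integral_mono (h3.const_mul 2) ((h1.const_mul _).add (h2.div_const _)) fun x => ?_
      have hi : inner ℝ (f s x) (u s x) ≤ ‖f s x‖ * ‖u s x‖ := real_inner_le_norm _ _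
      have hT2 : 0 < 2 * T := by positivity
      have : 0 ≤ (2 * T * ‖f s x‖ - ‖u s x‖) ^ 2 / (2 * T) := by positivity
      have e : (2 * T * ‖f s x‖ - ‖u s x‖) ^ 2 / (2 * T)
          = 2 * T * ‖f s x‖ ^ 2 + ‖u s x‖ ^ 2 / (2 * T) - 2 * (‖f s x‖ * ‖u s x‖) := by
        field_simp
        ring
      beta_reduce
      linarith
    calc 2 * ∫ s in Ico 0 t, power P f u s = ∫ s in Ico 0 t, 2 * power P f u s :=
          (integral_const_mul _ _).symm
      _ ≤ ∫ s in Ico 0 t, (2 * T * kinetic P f s + kinetic P u s / (2 * T)) :=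
          integral_mono_ae (((integrable_power hf hu).const_mul 2).mono_measure hle)
            (iQ.mono_measure hle) (ae_mono hle hpt)
      _ ≤ ∫ s, (2 * T * kinetic P f s + kinetic P u s / (2 * T)) ∂timeMeasure T :=
          integral_mono_measure hle (Eventually.of_forall fun s => by
            have := hk0 f s
            have := hk0 u s
            simp only [Pi.zero_apply]
            positivity) iQ
      _ = 2 * T * F + X / (2 * T) := by
          rw [integral_add ((integrable_kinetic hf).const_mul _)
            ((integrable_kinetic hu).div_const _), integral_const_mul, integral_div, hF,
            integral_slab (integrable_norm_sq_slab hf)]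
          rfl
  have h1 : ∀ᵐ t ∂timeMeasure T, kinetic P u t ≤ E₀ + (2 * T * F + X / (2 * T)) := by
    filter_upwards [h, ae_restrict_mem measurableSet_Ico] with t ht htm
    linarith [hyoung t htm]
  have h2 : X ≤ T * (E₀ + (2 * T * F + X / (2 * T))) := by
    have := integral_mono_ae (integrable_kinetic hu) (integrable_const _) h1
    simpa [hT.le] using this
  have h3 : X ≤ 2 * T * E₀ + 4 * T ^ 2 * F := by
    have : T * (E₀ + (2 * T * F + X / (2 * T))) = T * E₀ + 2 * T ^ 2 * F + X / 2 := by
      field_simp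
      try ring
    linarith
  have h4 : X / (2 * T) ≤ E₀ + 2 * T * F := by
    rw [div_le_iff₀ (by positivity)]
    nlinarith
  filter_upwards [h1] with t ht
  rw [energyBound]
  linarith

end Energy

end

/-! ### From (K41w) and the energy bound to uniform spectral decay -/

section

open UnitAddTorus

section UniformBounds

variable {P T : ℝ}

lemma fc_eq (hP : 0 < P) {G : ℝ × E3 → ℝ} {t : ℝ}
    (hG : AEStronglyMeasurable (fun x => G (t, x)) (cellMeasure P)) (n : Fin 3 → ℤ) :
    fc P n G t = ((P : ℂ) ^ 3)⁻¹ * ∫ x, charFn P n x * (G (t, x) : ℂ) ∂cellMeasure P :=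
  tcoef_comp_cellSection hP hG n

lemma norm_charFn (P : ℝ) (n : Fin 3 → ℤ) (x : E3) : ‖charFn P n x‖ = 1 := by
  rw [charFn, show -(Complex.I * ((inner ℝ (waveVec P n) x : ℝ) : ℂ))
    = ((-(inner ℝ (waveVec P n) x) : ℝ) : ℂ) * Complex.I by push_cast; ring,
    Complex.norm_exp_ofReal_mul_I]

/-- A bound for all Fourier coefficients of the velocity and its products. -/
def coefBound (P M : ℝ) : ℝ := (P ^ 3)⁻¹ * ((cellMeasure P).real univ + M) + 1

lemma one_le_coefBound (hP : 0 < P) {M : ℝ} (hM : 0 ≤ M) : 1 ≤ coefBound P M := by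
  have : 0 ≤ (P ^ 3)⁻¹ * ((cellMeasure P).real univ + M) := by positivity
  unfold coefBound
  linarith

/-- The majorant `1 + ‖u‖²` covers both the components of the velocity and their products. -/
lemma norm_fc_le (hP : 0 < P) {u : ℝ → E3 → E3} {G : ℝ × E3 → ℝ} {t M : ℝ}
    (hu : MemLp (u t) 2 (cellMeasure P))
    (hG : AEStronglyMeasurable (fun x => G (t, x)) (cellMeasure P))
    (hb : ∀ x, |G (t, x)| ≤ 1 + ‖u t x‖ ^ 2) (hM : kinetic P u t ≤ M) (n : Fin 3 → ℤ) :
    ‖fc P n G t‖ ≤ coefBound P M := by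
  have hi : Integrable (fun x => ‖u t x‖ ^ 2) (cellMeasure P) :=
    (memLp_two_iff_integrable_sq_norm hu.1).1 hu
  have h1 : ‖∫ x, charFn P n x * (G (t, x) : ℂ) ∂cellMeasure P‖
      ≤ ∫ x, (1 + ‖u t x‖ ^ 2) ∂cellMeasure P := by
    refine norm_integral_le_of_norm_le ((integrable_const 1).add hi)
      (Eventually.of_forall fun x => ?_)
    rw [norm_mul, norm_charFn, one_mul, Complex.norm_real]
    exact hb x
  rw [integral_add (integrable_const 1) hi, integral_const, smul_eq_mul, mul_one] at h1
  rw [fc_eq hP hG, norm_mul, norm_inv, norm_pow, Complex.norm_real, Real.norm_of_nonneg hP.le,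
    coefBound]
  have : (P ^ 3)⁻¹ * ‖∫ x, charFn P n x * (G (t, x) : ℂ) ∂cellMeasure P‖
      ≤ (P ^ 3)⁻¹ * ((cellMeasure P).real univ + M) := by
    refine mul_le_mul_of_nonneg_left (h1.trans ?_) (by positivity)
    exact add_le_add_right hM _
  linarith

lemma abs_apply_le_norm (x : E3) (i : Fin 3) : |x i| ≤ ‖x‖ := PiLp.norm_apply_le x i

lemma ae_norm_fc_le (hP : 0 < P) {u : ℝ → E3 → E3} {M : ℝ}
    (hu : ∀ t ∈ Icc 0 T, MemLp (u t) 2 (cellMeasure P))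
    (hM : ∀ᵐ t ∂timeMeasure T, kinetic P u t ≤ M) :
    ∀ᵐ t ∂timeMeasure T, ∀ n, (∀ i, ‖fc P n (fun z => u z.1 z.2 i) t‖ ≤ coefBound P M) ∧
      ∀ i j, ‖fc P n (fun z => u z.1 z.2 i * u z.1 z.2 j) t‖ ≤ coefBound P M := by
  filter_upwards [hM, ae_restrict_mem measurableSet_Ico] with t ht htm n
  have hut := hu t ⟨htm.1, htm.2.le⟩
  have hc : ∀ i, AEStronglyMeasurable (fun x => u t x i) (cellMeasure P) := fun i =>
    (EuclideanSpace.proj (𝕜 := ℝ) i).continuous.comp_aestronglyMeasurable hut.1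
  refine ⟨fun i => norm_fc_le hP hut (hc i) (fun x => ?_) ht n,
    fun i j => norm_fc_le hP hut ((hc i).mul (hc j)) (fun x => ?_) ht n⟩
  · have := abs_apply_le_norm (u t x) i
    nlinarith [sq_nonneg (‖u t x‖ - 1)]
  · rw [abs_mul]
    have := abs_apply_le_norm (u t x) i
    have h2 := abs_apply_le_norm (u t x) j
    have h3 := mul_le_mul this h2 (abs_nonneg _) (norm_nonneg _)
    nlinarith

lemma norm_le_norm_waveVec (hP : 0 < P) (n : Fin 3 → ℤ) :
    ‖n‖ ≤ P / (2 * Real.pi) * ‖waveVec P n‖ := by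
  refine (pi_norm_le_iff_of_nonneg (by positivity)).2 fun j => ?_
  have h := abs_apply_le_norm (waveVec P n) j
  simp only [waveVec, abs_mul] at h
  rw [abs_of_pos (by positivity : 0 < 2 * Real.pi / P)] at h
  rw [Int.norm_eq_abs, div_mul_eq_mul_div, le_div_iff₀ (by positivity)]
  have h2 := mul_le_mul_of_nonneg_left h hP.le
  calc |(n j : ℝ)| * (2 * Real.pi) = P * (2 * Real.pi / P * |(n j : ℝ)|) := by field_simp
    _ ≤ _ := h2

/-- A nonzero integer vector satisfies `1 + ‖n‖ ≤ 2‖n‖`; this halves the constant `2π/P`. -/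
lemma one_add_norm_le_norm_waveVec (hP : 0 < P) {n : Fin 3 → ℤ} (hn : n ≠ 0) :
    Real.pi / P * (1 + ‖n‖) ≤ ‖waveVec P n‖ := by
  have h1 : 1 ≤ ‖n‖ := by
    obtain ⟨j, hj⟩ := Function.ne_iff.1 hn
    refine le_trans ?_ (norm_le_pi_norm n j)
    rw [Int.norm_eq_abs]
    exact_mod_cast Int.one_le_abs hj
  have h2 := norm_le_norm_waveVec hP n
  have hπ := Real.pi_pos
  rw [div_mul_eq_mul_div, le_div_iff₀ (by positivity)] at h2
  rw [div_mul_eq_mul_div, div_le_iff₀ hP]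
  nlinarith

/-- The Kolmogorov bound for large wavevectors and a bound for all coefficients give spectral
decay. -/
lemma exists_hasSpectralDecay (hP : 0 < P) (hT : 0 < T) {β C M : ℝ} (kStar : ℝ) (hβ : 0 < β)
    (hC : 0 ≤ C) : ∃ C' : ℝ, 0 ≤ C' ∧ ∀ u : ℝ → E3 → E3,
      MemLp (Function.uncurry u) 2 (slabMeasure P T) →
      (∀ t ∈ Icc 0 T, MemLp (u t) 2 (cellMeasure P)) →
      (∀ᵐ t ∂timeMeasure T, ∀ n i, ‖fc P n (fun z => u z.1 z.2 i) t‖ ≤ M) →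
      (∀ n : Fin 3 → ℤ, kStar ≤ ‖waveVec P n‖ → ‖waveVec P n‖ ^ (3 + β) *
        ∫ t in Ico 0 T, (∑ i, ‖fourierCoef P (u t) (waveVec P n) i‖ ^ 2) ≤ C) →
      ∀ i, HasSpectralDecay T (min β 1) C' (lift P fun z => u z.1 z.2 i) := by
  set β' := min β 1 with hβ'
  have hβ'0 : 0 < β' := lt_min hβ one_pos
  -- `R` bounds `1 + ‖n‖` at all frequencies outside the scope of (K41w), including zero. There the
  -- coefficient bound `M` gives at most `T M²`, and `R^{3+β'}` compensates the weight.
  set R : ℝ := 1 + P / (2 * Real.pi) * max kStar 0 with hR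
  have hR1 : 1 ≤ R := by
    have : 0 ≤ P / (2 * Real.pi) * max kStar 0 := by positivity
    linarith
  set C1 := C * (Real.pi / P) ^ (-(3 + β)) with hC1
  set C2 := T * M ^ 2 * R ^ (3 + β') with hC2
  have hC1' : 0 ≤ C1 := by positivity
  have hC2' : 0 ≤ C2 := by positivity
  refine ⟨C1 + C2, by positivity, fun u hu hut hb hK i => ⟨memLp_two_lift hP
    (memLp_component hu i), fun n => ?_⟩⟩
  have hfc := fun j => integrable_fc hP (integrable_component hu j) n
  have hsq : ∀ j, Integrable (fun t => ‖fc P n (fun z => u z.1 z.2 j) t‖ ^ 2)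
      (timeMeasure T) := fun j => by
    refine (integrable_const (M ^ 2)).mono' ((hfc j).1.norm.pow 2) ?_
    filter_upwards [hb] with t ht
    rw [norm_pow, norm_norm]
    exact pow_le_pow_left₀ (norm_nonneg _) (ht n j) 2
  have e1 : ∫⁻ t, ‖scoef (lift P fun z => u z.1 z.2 i) t n‖ₑ ^ 2 ∂timeMeasure T
      = ENNReal.ofReal (∫ t, ‖fc P n (fun z => u z.1 z.2 i) t‖ ^ 2 ∂timeMeasure T) := by
    rw [ofReal_integral_eq_lintegral_ofReal (hsq i) (Eventually.of_forall fun _ => sq_nonneg _)]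
    refine lintegral_congr fun t => ?_
    rw [ENNReal.ofReal_pow (norm_nonneg _), ofReal_norm, fc]
  rw [e1]
  refine ENNReal.ofReal_le_ofReal ?_
  have hw : 0 < 1 + ‖n‖ := by positivity
  rw [add_mul]
  by_cases hn : n ≠ 0 ∧ kStar ≤ ‖waveVec P n‖
  · have hK' := hK n hn.2
    have hle : ∫ t, ‖fc P n (fun z => u z.1 z.2 i) t‖ ^ 2 ∂timeMeasure T
        ≤ ∫ t in Ico 0 T, (∑ i, ‖fourierCoef P (u t) (waveVec P n) i‖ ^ 2) := by
      have e2 : ∫ t in Ico 0 T, (∑ i, ‖fourierCoef P (u t) (waveVec P n) i‖ ^ 2)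
          = ∫ t, (∑ j, ‖fc P n (fun z => u z.1 z.2 j) t‖ ^ 2) ∂timeMeasure T := by
        refine integral_congr_ae ?_
        filter_upwards [ae_restrict_mem measurableSet_Ico] with t ht
        refine Finset.sum_congr rfl fun j _ => ?_
        rw [fc, scoef_lift_eq_fourierCoef hP n j (hut t ⟨ht.1, ht.2.le⟩).1]
      rw [e2]
      refine integral_mono (hsq i) (integrable_finsetSum _ fun j _ => hsq j) fun t => ?_
      exact Finset.single_le_sum (f := fun j => ‖fc P n (fun z => u z.1 z.2 j) t‖ ^ 2)
        (fun _ _ => sq_nonneg _) (Finset.mem_univ i)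
    have hkpos : 0 < Real.pi / P * (1 + ‖n‖) := by positivity
    have hk := one_add_norm_le_norm_waveVec hP hn.1
    have hk0 : 0 < ‖waveVec P n‖ := hkpos.trans_le hk
    have h1 : ∫ t, ‖fc P n (fun z => u z.1 z.2 i) t‖ ^ 2 ∂timeMeasure T
        ≤ C * ‖waveVec P n‖ ^ (-(3 + β)) := by
      rw [Real.rpow_neg hk0.le, ← div_eq_mul_inv, le_div_iff₀ (by positivity), mul_comm]
      exact (mul_le_mul_of_nonneg_left hle (by positivity)).trans hK'
    have h2 : ‖waveVec P n‖ ^ (-(3 + β)) ≤ (Real.pi / P) ^ (-(3 + β)) * (1 + ‖n‖) ^ (-(3 + β')) := by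
      calc _ ≤ (Real.pi / P * (1 + ‖n‖)) ^ (-(3 + β)) :=
            Real.rpow_le_rpow_of_nonpos hkpos hk (by linarith)
        _ = (Real.pi / P) ^ (-(3 + β)) * (1 + ‖n‖) ^ (-(3 + β)) :=
            Real.mul_rpow (by positivity) hw.le
        _ ≤ _ := by
            gcongr
            · linarith [norm_nonneg n]
            · exact min_le_left _ _
    have h3 : 0 ≤ C2 * (1 + ‖n‖) ^ (-(3 + β')) := by positivity
    have h4 : C * ‖waveVec P n‖ ^ (-(3 + β)) ≤ C1 * (1 + ‖n‖) ^ (-(3 + β')) := by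
      rw [hC1, mul_assoc]
      exact mul_le_mul_of_nonneg_left h2 hC
    linarith
  · have hnR : 1 + ‖n‖ ≤ R := by
      rw [hR]
      by_cases hn0 : n = 0
      · rw [hn0, norm_zero]
        have : 0 ≤ P / (2 * Real.pi) * max kStar 0 := by positivity
        linarith
      · have : ‖waveVec P n‖ < kStar := by
          by_contra hcon
          exact hn ⟨hn0, not_lt.1 hcon⟩
        refine add_le_add le_rfl ((norm_le_norm_waveVec hP n).trans ?_)
        gcongr
        exact this.le.trans (le_max_left _ _)
    have h1 : ∫ t, ‖fc P n (fun z => u z.1 z.2 i) t‖ ^ 2 ∂timeMeasure T ≤ T * M ^ 2 := by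
      have : ∫ t, ‖fc P n (fun z => u z.1 z.2 i) t‖ ^ 2 ∂timeMeasure T
          ≤ ∫ _, M ^ 2 ∂timeMeasure T := by
        refine integral_mono_ae (hsq i) (integrable_const _) ?_
        filter_upwards [hb] with t ht
        exact pow_le_pow_left₀ (norm_nonneg _) (ht n i) 2
      simpa [hT.le] using this
    have h2 : 1 ≤ R ^ (3 + β') * (1 + ‖n‖) ^ (-(3 + β')) := by
      rw [Real.rpow_neg hw.le, ← div_eq_mul_inv, one_le_div (by positivity)]
      gcongr
    have h3 : 0 ≤ C1 * (1 + ‖n‖) ^ (-(3 + β')) := by positivity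
    have h4 : T * M ^ 2 ≤ C2 * (1 + ‖n‖) ^ (-(3 + β')) := by
      rw [hC2, mul_assoc]
      exact le_mul_of_one_le_right (by positivity) h2
    linarith

end UniformBounds

end

/-! ### Compactness: convergence of coefficients and strong `L²` convergence -/

section

open UnitAddTorus

section Compactness

variable {T : ℝ}

/-- A diagonal Arzelà–Ascoli argument for functions of time with dominated derivatives. -/
lemma exists_subseq_tendsto_of_primitive {ι : Type*} [Countable ι] (hT : 0 < T)
    {g : ℕ → ι → ℝ → ℂ} {D : ι → ℝ → ℝ} {M : ℝ} (hD : ∀ a, Integrable (D a) (timeMeasure T))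
    (hg : ∀ k a, ∃ (c : ℂ) (h : ℝ → ℂ), Integrable h (timeMeasure T) ∧
      (∀ᵐ t ∂timeMeasure T, g k a t = c + ∫ s in Ico 0 t, h s) ∧
      ∀ᵐ t ∂timeMeasure T, ‖h t‖ ≤ D a t)
    (hM : ∀ k a, ∀ᵐ t ∂timeMeasure T, ‖g k a t‖ ≤ M) :
    ∃ σ : ℕ → ℕ, StrictMono σ ∧ ∃ w : ι → ℝ → ℂ,
      (∀ a, AEStronglyMeasurable (w a) (timeMeasure T)) ∧
      ∀ a, ∀ᵐ t ∂timeMeasure T, Tendsto (fun k => g (σ k) a t) atTop (𝓝 (w a t)) := by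
  choose c h hi heq hle using hg
  set D' : ι → ℝ → ℝ := fun a => (Ico 0 T).indicator (D a) with hD'
  set h' : ℕ → ι → ℝ → ℂ := fun k a => (Ico 0 T).indicator (h k a) with hh'
  have iD' : ∀ a, Integrable (D' a) := fun a =>
    IntegrableOn.integrable_indicator (hD a) measurableSet_Ico
  have ih' : ∀ k a, Integrable (h' k a) := fun k a =>
    IntegrableOn.integrable_indicator (hi k a) measurableSet_Ico
  have hle' : ∀ k a, ∀ᵐ t, ‖h' k a t‖ ≤ D' a t := fun k a => by
    filter_upwards [(ae_restrict_iff' measurableSet_Ico).1 (hle k a)] with t ht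
    by_cases htm : t ∈ Ico 0 T
    · simpa [hh', hD', htm] using ht htm
    · simp [hh', hD', htm]
  -- Continuous representatives of the coefficients. The primitive `N` of the common majorant serves
  -- as a modulus of continuity independent of `k`.
  set Φ : ℕ → ι → ℝ → ℂ := fun k a t => c k a + ∫ s in (0 : ℝ)..t, h' k a s with hΦ
  set N : ι → ℝ → ℝ := fun a t => ∫ s in (0 : ℝ)..t, D' a s with hN
  have cN : ∀ a, Continuous (N a) := fun a =>
    intervalIntegral.continuous_primitive (fun _ _ => (iD' a).intervalIntegrable) 0
  have cΦ : ∀ k a, Continuous (Φ k a) := fun k a => continuous_const.add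
    (intervalIntegral.continuous_primitive (fun _ _ => (ih' k a).intervalIntegrable) 0)
  have hmod : ∀ k a s t, ‖Φ k a t - Φ k a s‖ ≤ |N a t - N a s| := fun k a s t => by
    simp only [hΦ, hN, add_sub_add_left_eq_sub]
    rw [intervalIntegral.integral_interval_sub_left (ih' k a).intervalIntegrable
      (ih' k a).intervalIntegrable, intervalIntegral.integral_interval_sub_left
      (iD' a).intervalIntegrable (iD' a).intervalIntegrable]
    exact intervalIntegral.norm_integral_le_abs_of_norm_le
      (ae_restrict_of_ae (hle' k a)) (iD' a).intervalIntegrable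
  have hgΦ : ∀ k a, ∀ᵐ t ∂timeMeasure T, g k a t = Φ k a t := fun k a => by
    filter_upwards [heq k a, ae_restrict_mem measurableSet_Ico] with t ht htm
    rw [ht, hΦ]
    simp only
    rw [intervalIntegral.integral_of_le htm.1, ← integral_Ico_eq_integral_Ioc]
    congr 1
    refine setIntegral_congr_fun measurableSet_Ico fun s hs => ?_
    have : s ∈ Ico 0 T := ⟨hs.1, hs.2.trans htm.2⟩
    simp [hh', indicator_of_mem this]
  have hne : (ae (timeMeasure T)).NeBot := by
    rw [ae_neBot, Ne, Measure.restrict_eq_zero, Real.volume_Ico, sub_zero]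
    simpa using hT
  have hNb : ∀ a s, |N a s| ≤ ∫ t, |D' a t| := fun a s => by
    simp only [hN]
    refine (intervalIntegral.norm_integral_le_integral_norm_uIoc (f := D' a)).trans ?_
    exact setIntegral_le_integral (iD' a).abs (Eventually.of_forall fun _ => abs_nonneg _)
  -- The bound `M` holds only almost everywhere; one good time `s` and the modulus extend it to
  -- every time.
  have hB : ∀ k a t, ‖Φ k a t‖ ≤ M + 2 * ∫ t, |D' a t| := fun k a t => by
    obtain ⟨s, hs1, hs2⟩ := ((hgΦ k a).and (hM k a)).exists
    have h1 := hmod k a s t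
    have h2 : |N a t - N a s| ≤ |N a t| + |N a s| := abs_sub _ _
    have h3 := norm_sub_norm_le (Φ k a t) (Φ k a s)
    rw [hs1] at hs2
    linarith [hNb a t, hNb a s]
  -- Compactness of the countable product of discs, indexed by rational times and by `ι`, replaces
  -- an explicit diagonal extraction.
  have hcpt : IsCompact (Set.pi univ fun b : ℚ × ι =>
      Metric.closedBall (0 : ℂ) (M + 2 * ∫ t, |D' b.2 t|)) :=
    isCompact_univ_pi fun b => isCompact_closedBall _ _
  obtain ⟨x, -, σ, hσ, hx⟩ := hcpt.tendsto_subseq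
    (x := fun k (b : ℚ × ι) => Φ k b.2 (b.1 : ℝ)) fun k b _ => by
      simpa using hB k b.2 b.1
  have hlim : ∀ a t, ∃ w, Tendsto (fun k => Φ (σ k) a t) atTop (𝓝 w) := fun a t => by
    refine cauchySeq_tendsto_of_complete (Metric.cauchySeq_iff'.2 fun ε hε => ?_)
    -- Convergence at a nearby rational time passes to `t`: two oscillations and one Cauchy
    -- difference, each controlled by `ε/4`.
    obtain ⟨δ, hδ, hδN⟩ := Metric.continuous_iff.1 (cN a) t (ε / 4) (by positivity)
    obtain ⟨q, hq1, hq2⟩ := exists_rat_btwn (show t < t + δ by linarith)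
    have hqN : |N a t - N a q| < ε / 4 := by
      have := hδN q (by rw [Real.dist_eq, abs_of_pos (by linarith)]; linarith)
      rwa [Real.dist_eq, abs_sub_comm] at this
    have hxq : CauchySeq fun k => Φ (σ k) a q := (tendsto_pi_nhds.1 hx (q, a)).cauchySeq
    obtain ⟨K, hK⟩ := Metric.cauchySeq_iff'.1 hxq (ε / 4) (by positivity)
    refine ⟨K, fun k hk => ?_⟩
    have h1 := hmod (σ k) a q t
    have h2 := hmod (σ K) a q t
    have h3 := hK k hk
    rw [dist_eq_norm] at h3 ⊢
    have : Φ (σ k) a t - Φ (σ K) a t = (Φ (σ k) a t - Φ (σ k) a q)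
      - (Φ (σ K) a t - Φ (σ K) a q) + (Φ (σ k) a q - Φ (σ K) a q) := by ring
    rw [this]
    refine (norm_add_le _ _).trans_lt ?_
    have := norm_sub_le (Φ (σ k) a t - Φ (σ k) a q) (Φ (σ K) a t - Φ (σ K) a q)
    linarith
  choose w hw using hlim
  refine ⟨σ, hσ, w, fun a => ?_, fun a => ?_⟩
  · exact aestronglyMeasurable_of_tendsto_ae atTop
      (fun k => (cΦ (σ k) a).aestronglyMeasurable) (Eventually.of_forall fun t => hw a t)
  · filter_upwards [ae_all_iff.2 fun k => hgΦ k a] with t ht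
    simpa only [ht] using hw a t

/-- Functions with uniform spectral decay whose Fourier coefficients are equicontinuous in time
have a subsequence that is Cauchy in `L²`. -/
lemma exists_subseq_cauchy {β C M : ℝ} (hT : 0 < T) (hβ : 0 < β) (hC : 0 ≤ C)
    {g : ℕ → Fin 3 → ℝ × X3 → ℂ} (hg : ∀ k i, HasSpectralDecay T β C (g k i))
    {D : (Fin 3 → ℤ) × Fin 3 → ℝ → ℝ} (hD : ∀ a, Integrable (D a) (timeMeasure T))
    (hp : ∀ k n i, ∃ (c : ℂ) (h : ℝ → ℂ), Integrable h (timeMeasure T) ∧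
      (∀ᵐ t ∂timeMeasure T, scoef (g k i) t n = c + ∫ s in Ico 0 t, h s) ∧
      ∀ᵐ t ∂timeMeasure T, ‖h t‖ ≤ D (n, i) t)
    (hM : ∀ k n i, ∀ᵐ t ∂timeMeasure T, ‖scoef (g k i) t n‖ ≤ M) :
    ∃ σ : ℕ → ℕ, StrictMono σ ∧ ∀ i, Tendsto (fun q : ℕ × ℕ =>
      ∫⁻ z, ‖g (σ q.1) i z - g (σ q.2) i z‖ₑ ^ 2 ∂torusSlab T) (atTop ×ˢ atTop) (𝓝 0) := by
  obtain ⟨σ, hσ, w, hwm, hw⟩ := exists_subseq_tendsto_of_primitive hT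
    (g := fun k (a : (Fin 3 → ℤ) × Fin 3) t => scoef (g k a.2) t a.1) hD
    (fun k a => hp k a.1 a.2) (fun k a => hM k a.1 a.2)
  suffices key : ∀ i n, Tendsto (fun k =>
      ∫⁻ t, ‖scoef (g (σ k) i) t n - w (n, i) t‖ₑ ^ 2 ∂timeMeasure T) atTop (𝓝 0) from
    ⟨σ, hσ, fun i => tendsto_lintegral_sub_sq (g := fun k => g (σ k) i)
      (w := fun n => w (n, i)) hβ hC (fun k => hg (σ k) i) (fun n => hwm (n, i)) (key i)⟩
  intro i n
  have hwM : ∀ᵐ t ∂timeMeasure T, ‖w (n, i) t‖ ≤ M := by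
    filter_upwards [hw (n, i), ae_all_iff.2 fun k => hM (σ k) n i] with t ht1 ht2
    exact le_of_tendsto ht1.norm (Eventually.of_forall ht2)
  have h0 : Tendsto (fun k => ∫⁻ t, ‖scoef (g (σ k) i) t n - w (n, i) t‖ₑ ^ 2 ∂timeMeasure T)
      atTop (𝓝 (∫⁻ _, 0 ∂timeMeasure T)) → Tendsto (fun k =>
        ∫⁻ t, ‖scoef (g (σ k) i) t n - w (n, i) t‖ₑ ^ 2 ∂timeMeasure T) atTop (𝓝 0) := by
    rw [lintegral_zero]
    exact id
  refine h0 ?_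
  -- The uniform bound on the coefficients turns almost everywhere convergence at a fixed frequency
  -- into convergence in `L²(0,T)`.
  refine tendsto_lintegral_of_dominated_convergence' (fun _ => ENNReal.ofReal (2 * M) ^ 2)
    (fun k => ?_) (fun k => ?_) ?_ ?_
  · have : AEStronglyMeasurable (fun t => scoef (g (σ k) i) t n - w (n, i) t) (timeMeasure T) :=
      (aestronglyMeasurable_scoef (hg (σ k) i).memLp.1 n).sub (hwm (n, i))
    exact this.enorm.pow_const 2
  · filter_upwards [hM (σ k) n i, hwM] with t h1 h2
    gcongr
    rw [← ofReal_norm]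
    exact ENNReal.ofReal_le_ofReal ((norm_sub_le _ _).trans (by linarith))
  · rw [lintegral_const]
    exact ENNReal.mul_ne_top (ENNReal.pow_ne_top ENNReal.ofReal_ne_top) (measure_ne_top _ _)
  · filter_upwards [hw (n, i)] with t ht
    have h1 : Tendsto (fun k => ‖scoef (g (σ k) i) t n - w (n, i) t‖) atTop (𝓝 0) :=
      tendsto_iff_norm_sub_tendsto_zero.1 ht
    have h2 := ENNReal.tendsto_ofReal (h1.pow 2)
    rw [zero_pow two_ne_zero, ENNReal.ofReal_zero] at h2
    refine h2.congr fun k => ?_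
    rw [ENNReal.ofReal_pow (norm_nonneg _), ofReal_norm]

end Compactness

end

/-! ### Limits in Lebesgue spaces -/

section

open UnitAddTorus

section LpLimits

/-- Completeness of `L^p`; the subsequence is needed only for almost everywhere convergence, the
norm convergence being that of the whole sequence. -/
lemma exists_limit_of_cauchy {α E : Type*} [MeasurableSpace α] {μ : Measure α}
    [NormedAddCommGroup E] [CompleteSpace E] {p : ℝ≥0∞} [hp : Fact (1 ≤ p)] {F : ℕ → α → E}
    (hF : ∀ k, MemLp (F k) p μ)
    (hc : Tendsto (fun q : ℕ × ℕ => eLpNorm (F q.1 - F q.2) p μ) (atTop ×ˢ atTop) (𝓝 0)) :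
    ∃ (σ : ℕ → ℕ) (V : α → E), StrictMono σ ∧ MemLp V p μ ∧
      Tendsto (fun k => eLpNorm (F k - V) p μ) atTop (𝓝 0) ∧
      ∀ᵐ x ∂μ, Tendsto (fun k => F (σ k) x) atTop (𝓝 (V x)) := by
  have hcs : CauchySeq fun k => (hF k).toLp (F k) := by
    rw [Lp.cauchySeq_Lp_iff_cauchySeq_eLpNorm, ← prod_atTop_atTop_eq]
    refine hc.congr fun q => eLpNorm_congr_ae ?_
    filter_upwards [(hF q.1).coeFn_toLp, (hF q.2).coeFn_toLp] with x h1 h2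
    simp only [Pi.sub_apply, h1, h2]
  obtain ⟨V, hV⟩ := cauchySeq_tendsto_of_complete hcs
  have hV' : Tendsto (fun k => eLpNorm (F k - (V : α → E)) p μ) atTop (𝓝 0) := by
    rw [← Lp.tendsto_Lp_iff_tendsto_eLpNorm'' F hF V (Lp.memLp V), Lp.toLp_coeFn]
    exact hV
  obtain ⟨σ, hσ, h⟩ := (tendstoInMeasure_of_tendsto_eLpNorm
    (zero_lt_one.trans_le hp.out).ne' (fun k => (hF k).1) (Lp.memLp V).1 hV').exists_seq_tendsto_ae
  exact ⟨σ, V, hσ, Lp.memLp V, hV', h⟩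

lemma eLpNorm_ofReal {α E : Type*} [MeasurableSpace α] {μ : Measure α} [NormedAddCommGroup E]
    {q : ℝ} (hq : 0 < q) (g : α → E) :
    eLpNorm g (ENNReal.ofReal q) μ = (∫⁻ x, ‖g x‖ₑ ^ q ∂μ) ^ (1 / q) := by
  rw [eLpNorm_eq_lintegral_rpow_enorm_toReal (by simpa using hq) ENNReal.ofReal_ne_top,
    ENNReal.toReal_ofReal hq.le]

/-- Cauchy–Schwarz applied to `|w|^{2+δ} = |w| · |w|^{1+δ}`; the square of the second factor has
exactly the bounded exponent `2 + 2δ`. -/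
lemma tendsto_eLpNorm_interpolate {α E : Type*} [MeasurableSpace α] {μ : Measure α}
    [NormedAddCommGroup E] {w : ℕ → α → E} (hw : ∀ k, AEStronglyMeasurable (w k) μ) {δ : ℝ}
    (hδ : 0 < δ) {B : ℝ≥0∞} (hB : B ≠ ⊤)
    (hb : ∀ k, eLpNorm (w k) (ENNReal.ofReal (2 + 2 * δ)) μ ≤ B)
    (h : Tendsto (fun k => eLpNorm (w k) 2 μ) atTop (𝓝 0)) :
    Tendsto (fun k => eLpNorm (w k) (ENNReal.ofReal (2 + δ)) μ) atTop (𝓝 0) := by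
  have e2 : ∀ k, eLpNorm (w k) 2 μ = (∫⁻ x, ‖w k x‖ₑ ^ (2 : ℝ) ∂μ) ^ (1 / 2 : ℝ) := fun k => by
    have := eLpNorm_ofReal (μ := μ) two_pos (w k)
    simpa using this
  have hle : ∀ k, eLpNorm (w k) (ENNReal.ofReal (2 + δ)) μ
      ≤ (eLpNorm (w k) 2 μ * B ^ (1 + δ)) ^ (1 / (2 + δ)) := fun k => by
    rw [eLpNorm_ofReal (by positivity), e2]
    refine ENNReal.rpow_le_rpow ?_ (by positivity)
    have hs := ENNReal.lintegral_mul_le_Lp_mul_Lq μ Real.HolderConjugate.two_two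
      (hw k).enorm ((hw k).enorm.pow_const (1 + δ))
    have e : ∀ x, ((fun x => ‖w k x‖ₑ) * fun x => ‖w k x‖ₑ ^ (1 + δ)) x = ‖w k x‖ₑ ^ (2 + δ) :=
      fun x => by
        simp only [Pi.mul_apply]
        have := ENNReal.rpow_add_of_nonneg (x := ‖w k x‖ₑ) 1 (1 + δ) zero_le_one (by positivity)
        rw [ENNReal.rpow_one] at this
        rw [← this]
        congr 1
        ring
    simp only [e] at hs
    refine hs.trans ?_
    gcongr
    have hb' := hb k
    rw [eLpNorm_ofReal (by positivity)] at hb'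
    have e3 : ∀ x, (‖w k x‖ₑ ^ (1 + δ)) ^ (2 : ℝ) = ‖w k x‖ₑ ^ (2 + 2 * δ) := fun x => by
      rw [← ENNReal.rpow_mul]; congr 1; ring
    simp only [e3]
    calc (∫⁻ x, ‖w k x‖ₑ ^ (2 + 2 * δ) ∂μ) ^ (1 / 2 : ℝ)
        = ((∫⁻ x, ‖w k x‖ₑ ^ (2 + 2 * δ) ∂μ) ^ (1 / (2 + 2 * δ))) ^ (1 + δ) := by
          rw [← ENNReal.rpow_mul]; congr 1; field_simp
      _ ≤ B ^ (1 + δ) := ENNReal.rpow_le_rpow hb' (by positivity)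
  have hB' : B ^ (1 + δ) ≠ ⊤ := ENNReal.rpow_ne_top_of_nonneg (by positivity) hB
  have hlim : Tendsto (fun k => (eLpNorm (w k) 2 μ * B ^ (1 + δ)) ^ (1 / (2 + δ))) atTop
      (𝓝 0) := by
    have h1 := ENNReal.Tendsto.mul_const h (Or.inr hB')
    rw [zero_mul] at h1
    have h2 := (ENNReal.continuous_rpow_const (y := 1 / (2 + δ))).continuousAt.tendsto.comp h1
    rw [ENNReal.zero_rpow_of_pos (by positivity)] at h2
    exact h2
  exact tendsto_of_tendsto_of_tendsto_of_le_of_le tendsto_const_nhds hlim (fun _ => zero_le)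
    hle

lemma norm_le_sum_abs (x : E3) : ‖x‖ ≤ ∑ i, |x i| := by
  have h0 : 0 ≤ ∑ i, |x i| := Finset.sum_nonneg fun _ _ => abs_nonneg _
  refine (sq_le_sq₀ (norm_nonneg _) h0).1 ?_
  rw [EuclideanSpace.norm_sq_eq]
  simp only [Fin.sum_univ_three, Real.norm_eq_abs]
  nlinarith [abs_nonneg (x 0), abs_nonneg (x 1), abs_nonneg (x 2),
    mul_nonneg (abs_nonneg (x 0)) (abs_nonneg (x 1)),
    mul_nonneg (abs_nonneg (x 0)) (abs_nonneg (x 2)),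
    mul_nonneg (abs_nonneg (x 1)) (abs_nonneg (x 2))]

lemma eLpNorm_le_sum_component {α : Type*} [MeasurableSpace α] {μ : Measure α} {w : α → E3}
    (hw : AEStronglyMeasurable w μ) {q : ℝ≥0∞} (hq : 1 ≤ q) :
    eLpNorm w q μ ≤ ∑ i, eLpNorm (fun x => w x i) q μ := by
  have hm : ∀ i, AEStronglyMeasurable (fun x => |w x i|) μ := fun i =>
    ((EuclideanSpace.proj (𝕜 := ℝ) i).continuous.comp_aestronglyMeasurable hw).norm
  calc eLpNorm w q μ ≤ eLpNorm (∑ i, fun x => |w x i|) q μ := by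
        refine eLpNorm_mono fun x => ?_
        rw [Finset.sum_apply, Real.norm_of_nonneg (Finset.sum_nonneg fun _ _ => abs_nonneg _)]
        exact norm_le_sum_abs _
    _ ≤ ∑ i, eLpNorm (fun x => |w x i|) q μ := eLpNorm_sum_le (fun i _ => hm i) hq
    _ = _ := Finset.sum_congr rfl fun i _ => eLpNorm_norm (fun x => w x i)

variable {P T : ℝ}

lemma enorm_lift (P : ℝ) (G : ℝ × E3 → ℝ) (p : ℝ × X3) :
    ‖lift P G p‖ₑ = ‖G (p.1, cellSection P p.2)‖ₑ := by
  rw [lift, ← ofReal_norm, Complex.norm_real, ofReal_norm]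

lemma eLpNorm_slab_eq (hP : 0 < P) {q : ℝ} (hq : 0 < q) {G : ℝ × E3 → ℝ}
    (hG : AEStronglyMeasurable G (slabMeasure P T)) :
    eLpNorm G (ENNReal.ofReal q) (slabMeasure P T)
      = ((volFactor P)⁻¹ * ∫⁻ p, ‖lift P G p‖ₑ ^ q ∂torusSlab T) ^ (1 / q) := by
  rw [eLpNorm_ofReal hq]
  simp only [enorm_lift]
  rw [lintegral_comp_slabSection (F := fun z => ‖G z‖ₑ ^ q) hP (hG.enorm.pow_const q),
    ← mul_assoc, ENNReal.inv_mul_cancel (volFactor_ne_zero hP) (volFactor_ne_top P), one_mul]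

/-- The uniform higher integrability bound. -/
lemma exists_eLpNorm_bound (hP : 0 < P) (T : ℝ) {β C M : ℝ} (hβ : 0 < β) (hC : 0 ≤ C)
    (hM : 1 ≤ M) : ∃ B : ℝ≥0∞, B ≠ ⊤ ∧ ∀ u : ℝ → E3 → E3,
      MemLp (Function.uncurry u) 2 (slabMeasure P T) →
      (∀ i, HasSpectralDecay T β C (lift P fun z => u z.1 z.2 i)) →
      (∀ᵐ t ∂timeMeasure T, ∀ n i, ‖fc P n (fun z => u z.1 z.2 i) t‖ ≤ M) →
      eLpNorm (Function.uncurry u) (ENNReal.ofReal (2 + β / 12)) (slabMeasure P T) ≤ B := by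
  obtain ⟨B, hB, h⟩ := exists_lintegral_rpow_bound T hβ hC hM
  have hq : 0 < 2 + β / 12 := by positivity
  refine ⟨3 * ((volFactor P)⁻¹ * B) ^ (1 / (2 + β / 12)), ?_, fun u hu hd hb => ?_⟩
  · refine ENNReal.mul_ne_top (by simp) (ENNReal.rpow_ne_top_of_nonneg (by positivity)
      (ENNReal.mul_ne_top (ENNReal.inv_ne_top.2 (volFactor_ne_zero hP)) hB))
  · have h1 : 1 ≤ ENNReal.ofReal (2 + β / 12) := by
      rw [ENNReal.one_le_ofReal]; linarith
    refine (eLpNorm_le_sum_component hu.1 h1).trans ?_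
    have h2 : ∀ i, eLpNorm (fun z : ℝ × E3 => u z.1 z.2 i) (ENNReal.ofReal (2 + β / 12))
        (slabMeasure P T) ≤ ((volFactor P)⁻¹ * B) ^ (1 / (2 + β / 12)) := fun i => by
      rw [eLpNorm_slab_eq hP hq (memLp_component hu i).1]
      gcongr
      refine h _ (hd i) ?_
      filter_upwards [hb] with t ht n using ht n i
    refine (Finset.sum_le_sum fun i _ => h2 i).trans ?_
    simp

lemma tendsto_eLpNorm_slab_of_torus (hP : 0 < P) {U : ℕ → ℝ → E3 → E3}
    (hU : ∀ k, MemLp (Function.uncurry (U k)) 2 (slabMeasure P T))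
    (h : ∀ i, Tendsto (fun q : ℕ × ℕ => ∫⁻ z, ‖lift P (fun z => U q.1 z.1 z.2 i) z
      - lift P (fun z => U q.2 z.1 z.2 i) z‖ₑ ^ 2 ∂torusSlab T) (atTop ×ˢ atTop) (𝓝 0)) :
    Tendsto (fun q : ℕ × ℕ => eLpNorm (Function.uncurry (U q.1) - Function.uncurry (U q.2)) 2
      (slabMeasure P T)) (atTop ×ˢ atTop) (𝓝 0) := by
  have hle : ∀ q : ℕ × ℕ, eLpNorm (Function.uncurry (U q.1) - Function.uncurry (U q.2)) 2
      (slabMeasure P T) ≤ ∑ i, ((volFactor P)⁻¹ * ∫⁻ z, ‖lift P (fun z => U q.1 z.1 z.2 i) z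
      - lift P (fun z => U q.2 z.1 z.2 i) z‖ₑ ^ 2 ∂torusSlab T) ^ (1 / 2 : ℝ) := fun q => by
    refine (eLpNorm_le_sum_component ((hU q.1).sub (hU q.2)).1 one_le_two).trans
      (Finset.sum_le_sum fun i _ => ?_)
    have hm : AEStronglyMeasurable (fun z : ℝ × E3 => U q.1 z.1 z.2 i - U q.2 z.1 z.2 i)
      (slabMeasure P T) := ((memLp_component (hU q.1) i).sub (memLp_component (hU q.2) i)).1
    have e := eLpNorm_slab_eq (T := T) hP two_pos hm
    have e0 : ∀ z, lift P (fun z => U q.1 z.1 z.2 i - U q.2 z.1 z.2 i) z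
        = lift P (fun z => U q.1 z.1 z.2 i) z - lift P (fun z => U q.2 z.1 z.2 i) z := fun z => by
      simp [lift]
    rw [ENNReal.ofReal_ofNat] at e
    simp only [e0, ENNReal.rpow_ofNat] at e
    exact e.le
  refine tendsto_of_tendsto_of_tendsto_of_le_of_le tendsto_const_nhds ?_ (fun _ => zero_le) hle
  have : Tendsto (fun q : ℕ × ℕ => ∑ i, ((volFactor P)⁻¹ * ∫⁻ z, ‖lift P (fun z => U q.1 z.1 z.2 i) z
      - lift P (fun z => U q.2 z.1 z.2 i) z‖ₑ ^ 2 ∂torusSlab T) ^ (1 / 2 : ℝ)) (atTop ×ˢ atTop)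
      (𝓝 (∑ _i : Fin 3, 0)) := by
    refine tendsto_finsetSum _ fun i _ => ?_
    have h1 := ENNReal.Tendsto.const_mul (h i)
      (Or.inr (ENNReal.inv_ne_top.2 (volFactor_ne_zero hP)))
    rw [mul_zero] at h1
    have h2 := (ENNReal.continuous_rpow_const (y := (1 / 2 : ℝ))).continuousAt.tendsto.comp h1
    rw [ENNReal.zero_rpow_of_pos (by positivity)] at h2
    exact h2
  simpa using this

end LpLimits

end

/-! ### Mean-free pressures and quadratic differences -/

section

open UnitAddTorus

section MeanFreePressure

variable {P T : ℝ}

/-- The pressure normalised to have mean zero at every time. -/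
def meanFree (P : ℝ) (p : ℝ → E3 → ℝ) (t : ℝ) (x : E3) : ℝ :=
  p t x - (P ^ 3)⁻¹ * ∫ y, p t y ∂cellMeasure P

lemma integrable_mean {p : ℝ → E3 → ℝ} (hp : Integrable (Function.uncurry p) (slabMeasure P T)) :
    Integrable (fun z : ℝ × E3 => (P ^ 3)⁻¹ * ∫ y, p z.1 y ∂cellMeasure P)
      (slabMeasure P T) := by
  have h : Integrable (fun t => ∫ y, p t y ∂cellMeasure P) (timeMeasure T) :=
    hp.integral_prod_left
  have h2 : Integrable (fun z : ℝ × E3 => ∫ y, p z.1 y ∂cellMeasure P) (slabMeasure P T) :=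
    h.comp_fst (cellMeasure P)
  exact h2.const_mul _

lemma integrable_meanFree {p : ℝ → E3 → ℝ}
    (hp : Integrable (Function.uncurry p) (slabMeasure P T)) :
    Integrable (Function.uncurry (meanFree P p)) (slabMeasure P T) :=
  hp.sub (integrable_mean hp)

lemma ae_integrable_slice {g : ℝ × X3 → ℂ} (hg : Integrable g (torusSlab T)) :
    ∀ᵐ t ∂timeMeasure T, Integrable (fun θ => g (t, θ)) torusMeasure :=
  Integrable.prod_right_ae hg

lemma scoef_congr_ae {g h : ℝ × X3 → ℂ} (H : g =ᵐ[torusSlab T] h) :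
    ∀ᵐ t ∂timeMeasure T, ∀ n, scoef g t n = scoef h t n := by
  have := Measure.ae_ae_of_ae_prod H
  filter_upwards [this] with t ht n
  exact tcoef_congr_ae ht n

lemma scoef_sub_ae {g h : ℝ × X3 → ℂ} (hg : Integrable g (torusSlab T))
    (hh : Integrable h (torusSlab T)) :
    ∀ᵐ t ∂timeMeasure T, ∀ n, scoef (fun z => g z - h z) t n = scoef g t n - scoef h t n := by
  filter_upwards [ae_integrable_slice hg, ae_integrable_slice hh] with t h1 h2 n
  exact tcoef_sub h1 h2 n

lemma tcoef_const (c : ℂ) (n : Fin 3 → ℤ) : tcoef (fun _ => c) n = if n = 0 then c else 0 := by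
  have h := tcoef_const_mul c (fun θ => mFourier 0 θ) n
  rw [tcoef_mFourier] at h
  simp only [mFourier_zero, ContinuousMap.one_apply, mul_one, mul_ite, mul_zero] at h
  exact h

lemma charFn_zero (P : ℝ) (x : E3) : charFn P 0 x = 1 := by
  have : waveVec P 0 = 0 := by
    ext j; simp [waveVec]
  simp [charFn, this]

lemma fc_meanFree (hP : 0 < P) {p : ℝ → E3 → ℝ}
    (hp : Integrable (Function.uncurry p) (slabMeasure P T)) :
    ∀ᵐ t ∂timeMeasure T, ∀ n, fc P n (Function.uncurry (meanFree P p)) t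
      = if n = 0 then 0 else fc P n (Function.uncurry p) t := by
  have hm : ∀ᵐ t ∂timeMeasure T, Integrable (fun x => p t x) (cellMeasure P) := hp.prod_right_ae
  filter_upwards [ae_integrable_slice (integrable_lift hP hp), hm] with t h1 h2 n
  set c : ℝ := (P ^ 3)⁻¹ * ∫ y, p t y ∂cellMeasure P with hc
  have e : fc P n (Function.uncurry (meanFree P p)) t
      = fc P n (Function.uncurry p) t - tcoef (fun _ => (c : ℂ)) n := by
    have := tcoef_sub h1 (integrable_const (c : ℂ)) n
    rw [fc, fc, scoef, scoef, ← this]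
    congr 1
    funext θ
    simp only [lift, Function.uncurry, meanFree]
    push_cast
    rw [hc]
    push_cast
    rfl
  rw [e, tcoef_const]
  split_ifs with hn
  · subst hn
    rw [fc_eq (G := Function.uncurry p) hP h2.1, hc]
    simp only [charFn_zero, one_mul, Function.uncurry]
    rw [integral_complex_ofReal]
    push_cast
    ring
  · ring

lemma lift_mul (P : ℝ) (F G : ℝ × E3 → ℝ) (z : ℝ × X3) :
    lift P (fun z => F z * G z) z = lift P F z * lift P G z := by
  simp [lift]

lemma HasSpectralDecay.congr {β C : ℝ} {g h : ℝ × X3 → ℂ} (hg : HasSpectralDecay T β C g)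
    (H : g =ᵐ[torusSlab T] h) : HasSpectralDecay T β C h := by
  refine ⟨hg.memLp.ae_eq H, fun n => ?_⟩
  refine le_trans (le_of_eq ?_) (hg.decay n)
  refine lintegral_congr_ae ?_
  filter_upwards [scoef_congr_ae H] with t ht
  rw [ht n]

lemma ksq_waveVec (P : ℝ) (n : Fin 3 → ℤ) : ksq (waveVec P n) = (2 * Real.pi / P) ^ 2 * nsq n := by
  simp only [ksq, nsq, waveVec, mul_pow, Finset.mul_sum]

/-- The pressure is controlled by the quadratic terms, for differences of solutions. -/
theorem exists_pressure_diff_bound (hP : 0 < P) (T : ℝ) {β C : ℝ} (hβ : 0 < β) (hβ1 : β ≤ 1)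
    (hC : 0 ≤ C) : ∃ B : ℝ≥0∞, B ≠ ⊤ ∧ ∀ (μ μ' : ℝ) (u₀ : E3 → E3) (f u u' : ℝ → E3 → E3)
      (p p' : ℝ → E3 → ℝ), MemLp u₀ 2 (cellMeasure P) →
      MemLp (Function.uncurry f) 2 (slabMeasure P T) →
      MemLp (Function.uncurry u) 2 (slabMeasure P T) →
      Integrable (Function.uncurry p) (slabMeasure P T) →
      Momentum P T μ u₀ f u p → DivFree P T u →
      (∀ i, HasSpectralDecay T β C (lift P fun z => u z.1 z.2 i)) →
      MemLp (Function.uncurry u') 2 (slabMeasure P T) →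
      Integrable (Function.uncurry p') (slabMeasure P T) →
      Momentum P T μ' u₀ f u' p' → DivFree P T u' →
      (∀ i, HasSpectralDecay T β C (lift P fun z => u' z.1 z.2 i)) →
      ∫⁻ z, ‖meanFree P p z.1 z.2 - meanFree P p' z.1 z.2‖ₑ ∂slabMeasure P T
        ≤ B * ((volFactor P * ∑ i, ∑ j, ∫⁻ z, ‖u z.1 z.2 i * u z.1 z.2 j
            - u' z.1 z.2 i * u' z.1 z.2 j‖ₑ ∂slabMeasure P T)
          + (volFactor P * ∑ i, ∑ j, ∫⁻ z, ‖u z.1 z.2 i * u z.1 z.2 j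
            - u' z.1 z.2 i * u' z.1 z.2 j‖ₑ ∂slabMeasure P T) ^ (1 / 2 : ℝ)) := by
  obtain ⟨B, hB, H⟩ := exists_pressure_bound T hβ hβ1 hC
  refine ⟨(volFactor P)⁻¹ * B, ENNReal.mul_ne_top
    (ENNReal.inv_ne_top.2 (volFactor_ne_zero hP)) hB, ?_⟩
  intro μ μ' u₀ f u u' p p' hu₀ hf hu hp hm hd hsd hu' hp' hm' hd' hsd'
  set r : ℝ × X3 → ℂ := fun z => lift P (Function.uncurry (meanFree P p)) z
    - lift P (Function.uncurry (meanFree P p')) z with hr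
  have hq := integrable_lift hP (integrable_meanFree hp)
  have hq' := integrable_lift hP (integrable_meanFree hp')
  -- Strictly measurable representatives are required, because the torus estimate evaluates the
  -- functions at translated points.
  set U : Fin 3 → ℝ × X3 → ℂ := fun i => (hsd i).memLp.1.mk _ with hU
  set V : Fin 3 → ℝ × X3 → ℂ := fun i => (hsd' i).memLp.1.mk _ with hV
  have hUe : ∀ i, lift P (fun z => u z.1 z.2 i) =ᵐ[torusSlab T] U i := fun i =>
    (hsd i).memLp.1.ae_eq_mk
  have hVe : ∀ i, lift P (fun z => u' z.1 z.2 i) =ᵐ[torusSlab T] V i := fun i =>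
    (hsd' i).memLp.1.ae_eq_mk
  have hUVe : ∀ i j, (fun z => U i z * U j z - V i z * V j z) =ᵐ[torusSlab T] fun z =>
      lift P (fun z => u z.1 z.2 i * u z.1 z.2 j) z
        - lift P (fun z => u' z.1 z.2 i * u' z.1 z.2 j) z := fun i j => by
    filter_upwards [hUe i, hUe j, hVe i, hVe j] with z h1 h2 h3 h4
    rw [lift_mul P (fun z => u z.1 z.2 i) (fun z => u z.1 z.2 j),
      lift_mul P (fun z => u' z.1 z.2 i) (fun z => u' z.1 z.2 j), h1, h2, h3, h4]
  have huu := fun i j => integrable_lift hP (integrable_component_mul hu hu i j)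
  have huu' := fun i j => integrable_lift hP (integrable_component_mul hu' hu' i j)
  have hdint : ∀ i j, ∫⁻ z, ‖U i z * U j z - V i z * V j z‖ₑ ∂torusSlab T
      = volFactor P * ∫⁻ z, ‖u z.1 z.2 i * u z.1 z.2 j - u' z.1 z.2 i * u' z.1 z.2 j‖ₑ
        ∂slabMeasure P T := fun i j => by
    have hmeas : AEMeasurable (fun z : ℝ × E3 => ‖u z.1 z.2 i * u z.1 z.2 j
        - u' z.1 z.2 i * u' z.1 z.2 j‖ₑ) (slabMeasure P T) :=
      ((integrable_component_mul hu hu i j).sub (integrable_component_mul hu' hu' i j)).1.enorm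
    rw [← lintegral_comp_slabSection hP hmeas]
    refine lintegral_congr_ae ?_
    filter_upwards [hUVe i j] with z hz
    rw [hz]
    rw [lift, lift, ← Complex.ofReal_sub, ← ofReal_norm, Complex.norm_real, ofReal_norm]
  have hrint : ∫⁻ z, ‖r z‖ₑ ∂torusSlab T = volFactor P *
      ∫⁻ z, ‖meanFree P p z.1 z.2 - meanFree P p' z.1 z.2‖ₑ ∂slabMeasure P T := by
    have hmeas : AEMeasurable (fun z : ℝ × E3 => ‖meanFree P p z.1 z.2
        - meanFree P p' z.1 z.2‖ₑ) (slabMeasure P T) :=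
      ((integrable_meanFree hp).sub (integrable_meanFree hp')).1.enorm
    rw [← lintegral_comp_slabSection hP hmeas]
    refine lintegral_congr fun z => ?_
    simp only [hr, lift, Function.uncurry]
    rw [← Complex.ofReal_sub, ← ofReal_norm, Complex.norm_real, ofReal_norm]
  have hrel : ∀ᵐ t ∂timeMeasure T, scoef r t 0 = 0 ∧ ∀ n, (nsq n : ℂ) * scoef r t n
      = -∑ i, ∑ j, (n i * n j : ℂ) * scoef (fun p => U i p * U j p - V i p * V j p) t n := by
    have h1 := ae_all_iff.2 fun n => pressure_fourier hP hu₀ hf hu hp hm hd hu' hp' hm' hd' n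
    have h2 := ae_all_iff.2 fun i => ae_all_iff.2 fun j => scoef_congr_ae (hUVe i j)
    have h3 := ae_all_iff.2 fun i => ae_all_iff.2 fun j => scoef_sub_ae (huu i j) (huu' i j)
    filter_upwards [h1, h2, h3, scoef_sub_ae hq hq', fc_meanFree hP hp, fc_meanFree hP hp']
      with t h1 h2 h3 h4 h5 h6
    have hrn : ∀ n, scoef r t n = (if n = 0 then 0 else fc P n (Function.uncurry p) t)
        - if n = 0 then 0 else fc P n (Function.uncurry p') t := fun n => by
      rw [← h5, ← h6]
      exact h4 n
    refine ⟨by rw [hrn]; simp, fun n => ?_⟩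
    simp only [h2, h3]
    by_cases hn : n = 0
    · subst hn
      simp [nsq]
    · rw [hrn, if_neg hn, if_neg hn]
      have hk := h1 n
      -- The relation is homogeneous in the wavevector, so the scale `(2π/P)²` cancels when passing
      -- to integer frequencies.
      have hκ : ((2 * Real.pi / P : ℝ) : ℂ) ^ 2 ≠ 0 := by
        refine pow_ne_zero 2 (Complex.ofReal_ne_zero.2 ?_)
        positivity
      refine mul_left_cancel₀ hκ ?_
      rw [ksq_waveVec] at hk
      simp only [waveVec, fc, Fin.sum_univ_three] at hk ⊢
      push_cast at hk ⊢
      linear_combination hk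
  have hmain := H U V r (fun i => (hsd i).memLp.1.stronglyMeasurable_mk.measurable)
    (fun i => (hsd' i).memLp.1.stronglyMeasurable_mk.measurable)
    (fun i => (hsd i).congr (hUe i)) (fun i => (hsd' i).congr (hVe i)) (hq.sub hq') hrel
  simp only [hdint, ← Finset.mul_sum] at hmain
  rw [hrint] at hmain
  calc _ = (volFactor P)⁻¹ * (volFactor P *
      ∫⁻ z, ‖meanFree P p z.1 z.2 - meanFree P p' z.1 z.2‖ₑ ∂slabMeasure P T) := by
        rw [← mul_assoc, ENNReal.inv_mul_cancel (volFactor_ne_zero hP) (volFactor_ne_top P),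
          one_mul]
    _ ≤ _ := by
        rw [mul_assoc]
        gcongr

end MeanFreePressure

section Quadratic

variable {α : Type*} [MeasurableSpace α] {m : Measure α}

lemma lintegral_enorm_mul_enorm_le {E F : Type*} [NormedAddCommGroup E] [NormedAddCommGroup F]
    {a : α → E} {b : α → F} (ha : AEStronglyMeasurable a m) (hb : AEStronglyMeasurable b m) :
    ∫⁻ x, ‖a x‖ₑ * ‖b x‖ₑ ∂m ≤ eLpNorm a 2 m * eLpNorm b 2 m := by
  have h := ENNReal.lintegral_mul_le_Lp_mul_Lq m Real.HolderConjugate.two_two ha.enorm hb.enorm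
  have e1 := eLpNorm_ofReal (μ := m) two_pos a
  have e2 := eLpNorm_ofReal (μ := m) two_pos b
  rw [ENNReal.ofReal_ofNat] at e1 e2
  rw [e1, e2]
  exact h

lemma enorm_apply_le (x : E3) (i : Fin 3) : ‖x i‖ₑ ≤ ‖x‖ₑ := by
  rw [← ofReal_norm, ← ofReal_norm]
  exact ENNReal.ofReal_le_ofReal (PiLp.norm_apply_le x i)

/-- Products are telescoped and each term is estimated by Cauchy–Schwarz; strong `L²` convergence
thus gives `L¹` convergence of the quadratic terms. -/
lemma lintegral_quadratic_diff_le {v w : α → E3} (hv : AEStronglyMeasurable v m)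
    (hw : AEStronglyMeasurable w m) (i j : Fin 3) :
    ∫⁻ x, ‖v x i * v x j - w x i * w x j‖ₑ ∂m
      ≤ (eLpNorm v 2 m + eLpNorm w 2 m) * eLpNorm (v - w) 2 m := by
  have hpt : ∀ x, ‖v x i * v x j - w x i * w x j‖ₑ
      ≤ ‖v x‖ₑ * ‖(v - w) x‖ₑ + ‖w x‖ₑ * ‖(v - w) x‖ₑ := fun x => by
    have e : v x i * v x j - w x i * w x j = v x i * (v x - w x) j + w x j * (v x - w x) i := by
      simp only [PiLp.sub_apply]; ring
    rw [e]
    refine (enorm_add_le _ _).trans ?_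
    rw [enorm_mul, enorm_mul]
    exact add_le_add (mul_le_mul' (enorm_apply_le _ _) (enorm_apply_le _ _))
      (mul_le_mul' (enorm_apply_le _ _) (enorm_apply_le _ _))
  refine (lintegral_mono hpt).trans ?_
  rw [lintegral_add_left' (f := fun x => ‖v x‖ₑ * ‖(v - w) x‖ₑ)
    (hv.enorm.mul (hv.sub hw).enorm), add_mul]
  exact add_le_add (lintegral_enorm_mul_enorm_le hv (hv.sub hw))
    (lintegral_enorm_mul_enorm_le hw (hv.sub hw))

end Quadratic

end

/-! ### Periodic test functions and passage to the limit in the equations -/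

section

section TestFunctions

variable {P T : ℝ}

lemma fderiv_slice {ψ : ℝ → E3 → ℝ} (h : ContDiff ℝ ∞ (Function.uncurry ψ)) (t : ℝ) (x v : E3) :
    fderiv ℝ (ψ t) x v = fderiv ℝ (Function.uncurry ψ) (t, x) (0, v) := by
  have h1 : HasFDerivAt (Function.uncurry ψ) (fderiv ℝ (Function.uncurry ψ) (t, x)) (t, x) :=
    (h.differentiable (by simp) (t, x)).hasFDerivAt
  have h2 : HasFDerivAt (fun y : E3 => (t, y)) (ContinuousLinearMap.inr ℝ ℝ E3) x :=
    hasFDerivAt_prodMk_right t x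
  have h3 : HasFDerivAt (ψ t) _ x := h1.comp x h2
  rw [h3.fderiv]
  simp

lemma deriv_slice {ψ : ℝ → E3 → ℝ} (h : ContDiff ℝ ∞ (Function.uncurry ψ)) (t : ℝ) (x : E3) :
    deriv (fun s => ψ s x) t = fderiv ℝ (Function.uncurry ψ) (t, x) (1, 0) := by
  have h1 : HasFDerivAt (Function.uncurry ψ) (fderiv ℝ (Function.uncurry ψ) (t, x)) (t, x) :=
    (h.differentiable (by simp) (t, x)).hasFDerivAt
  have h2 : HasDerivAt (fun s : ℝ => (s, x)) (1, 0) t :=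
    (hasDerivAt_id t).prodMk (hasDerivAt_const t x)
  exact (h1.comp_hasDerivAt t h2).deriv

lemma contDiff_dx {ψ : ℝ → E3 → ℝ} (h : ContDiff ℝ ∞ (Function.uncurry ψ)) (j : Fin 3) :
    ContDiff ℝ ∞ (Function.uncurry (dx j ψ)) := by
  have e : Function.uncurry (dx j ψ)
      = fun z => fderiv ℝ (Function.uncurry ψ) z (0, basisVec j) := by
    funext z
    exact fderiv_slice h z.1 z.2 _
  rw [e]
  exact (h.fderiv_right (m := ∞) (by simp)).clm_apply contDiff_const

lemma continuous_dx {ψ : ℝ → E3 → ℝ} (h : ContDiff ℝ ∞ (Function.uncurry ψ)) (j : Fin 3) :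
    Continuous fun z : ℝ × E3 => dx j ψ z.1 z.2 := (contDiff_dx h j).continuous

lemma continuous_dt {ψ : ℝ → E3 → ℝ} (h : ContDiff ℝ ∞ (Function.uncurry ψ)) :
    Continuous fun z : ℝ × E3 => dt ψ z.1 z.2 := by
  have e : (fun z : ℝ × E3 => dt ψ z.1 z.2)
      = fun z => fderiv ℝ (Function.uncurry ψ) z (1, 0) := by
    funext z
    exact deriv_slice h z.1 z.2
  rw [e]
  exact ((h.fderiv_right (m := ∞) (by simp)).clm_apply contDiff_const).continuous

lemma continuous_lap {ψ : ℝ → E3 → ℝ} (h : ContDiff ℝ ∞ (Function.uncurry ψ)) :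
    Continuous fun z : ℝ × E3 => lap ψ z.1 z.2 :=
  continuous_finsetSum _ fun j _ => continuous_dx (contDiff_dx h j) j

lemma toLp_insertNth (i : Fin 3) (y : Fin 2 → ℝ) (P : ℝ) :
    WithLp.toLp 2 (i.insertNth (P / 2) y : Fin 3 → ℝ)
      = WithLp.toLp 2 (i.insertNth (-(P / 2)) y : Fin 3 → ℝ) + P • basisVec i := by
  ext l
  refine Fin.succAboveCases i ?_ (fun m => ?_) l
  · simp
    ring
  · simp [Fin.succAbove_ne]

/-- The divergence theorem for the field `g eᵢ`: the contributions of opposite faces cancel by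
periodicity. -/
lemma integral_fderiv_eq_zero (hP : 0 < P) {g : E3 → ℝ} (hg : ContDiff ℝ 1 g)
    (hper : IsPeriodic P g) (i : Fin 3) :
    ∫ x, fderiv ℝ g x (basisVec i) ∂cellMeasure P = 0 := by
  set L : (Fin 3 → ℝ) →L[ℝ] E3 :=
    ((PiLp.continuousLinearEquiv 2 ℝ (fun _ : Fin 3 => ℝ)).symm : (Fin 3 → ℝ) →L[ℝ] E3) with hL
  have hLa : ∀ y, L y = WithLp.toLp 2 y := fun y => rfl
  set a : Fin 3 → ℝ := fun _ => -(P / 2) with ha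
  set b : Fin 3 → ℝ := fun _ => P / 2 with hb
  have hle : a ≤ b := fun _ => by simp only [ha, hb]; linarith
  have hcd : Continuous fun x => fderiv ℝ g x := hg.continuous_fderiv one_ne_zero
  have hsum : ∀ y, ∑ j, (if j = i then (fderiv ℝ g (L y)).comp L else 0) (Pi.single j (1 : ℝ))
      = fderiv ℝ g (L y) (basisVec i) := fun y => by
    rw [Finset.sum_eq_single i (fun j _ hj => by simp [hj]) (by simp)]
    simp only [if_true, ContinuousLinearMap.comp_apply]
    rfl
  have h := integral_divergence_of_hasFDerivAt_off_countable' a b hle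
    (fun j y => if j = i then g (L y) else 0)
    (fun j y => if j = i then (fderiv ℝ g (L y)).comp L else 0) ∅ countable_empty
    (fun j => by
      split_ifs
      · exact (hg.continuous.comp L.continuous).continuousOn
      · exact continuousOn_const)
    (fun y _ j => by
      by_cases hj : j = i
      · simp only [hj, if_true]
        exact ((hg.differentiable one_ne_zero (L y)).hasFDerivAt).comp y L.hasFDerivAt
      · simp only [hj, if_false]
        exact hasFDerivAt_const _ _)
    (by
      simp only [hsum]
      have : Continuous fun y => fderiv ℝ g (L y) (basisVec i) :=
        (hcd.comp L.continuous).clm_apply continuous_const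
      exact this.continuousOn.integrableOn_compact isCompact_Icc)
  simp only [hsum] at h
  have hface : ∀ j : Fin 3, ((∫ y in Icc (a ∘ Fin.succAbove j) (b ∘ Fin.succAbove j),
        (if j = i then g (L (j.insertNth (b j) y)) else 0))
      - ∫ y in Icc (a ∘ Fin.succAbove j) (b ∘ Fin.succAbove j),
        (if j = i then g (L (j.insertNth (a j) y)) else 0)) = 0 := fun j => by
    rw [sub_eq_zero]
    refine integral_congr_ae (Eventually.of_forall fun y => ?_)
    by_cases hj : j = i
    · subst hj
      simp only [if_true, hLa, hb, ha]
      rw [toLp_insertNth]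
      exact hper _ _
    · simp [hj]
  rw [Finset.sum_eq_zero fun j _ => hface j] at h
  rw [← h, cellMeasure]
  have hmp := PiLp.volume_preserving_toLp (Fin 3)
  have hme : MeasurableEmbedding (WithLp.toLp 2 : (Fin 3 → ℝ) → E3) :=
    (MeasurableEquiv.toLp 2 (Fin 3 → ℝ)).measurableEmbedding
  have hpre : (WithLp.toLp 2 : (Fin 3 → ℝ) → E3) ⁻¹' cell P = Icc a b := by
    ext y
    simp only [cell, mem_preimage, mem_ofPred_eq, mem_Icc, Pi.le_def, ha, hb]
    exact forall_and
  rw [← hmp.setIntegral_preimage_emb hme, hpre]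
  rfl

/-- The spatial mean depends on time only, and derivatives of periodic tests have zero integral over
the cell. The pressure may thus be normalised in the weak equation, which determines it only up to a
function of time. -/
lemma integral_mean_mul_dx (hP : 0 < P) {p : ℝ → E3 → ℝ}
    (hp : Integrable (Function.uncurry p) (slabMeasure P T)) {ψ : ℝ → E3 → ℝ}
    (hψ : IsTest P T ψ) (i : Fin 3) :
    ∫ z, meanFree P p z.1 z.2 * dx i ψ z.1 z.2 ∂slabMeasure P T
      = ∫ z, p z.1 z.2 * dx i ψ z.1 z.2 ∂slabMeasure P T := by
  have hc := continuous_dx hψ.smooth i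
  have h1 : Integrable (fun z : ℝ × E3 => p z.1 z.2 * dx i ψ z.1 z.2) (slabMeasure P T) :=
    integrable_mul_continuous (G := Function.uncurry p) hp hc
  have h2 := integrable_mul_continuous (integrable_mean hp) hc
  have e : ∀ z : ℝ × E3, meanFree P p z.1 z.2 * dx i ψ z.1 z.2
      = p z.1 z.2 * dx i ψ z.1 z.2
        - ((P ^ 3)⁻¹ * ∫ y, p z.1 y ∂cellMeasure P) * dx i ψ z.1 z.2 := fun z => by
    rw [meanFree]; ring
  simp only [e]
  rw [integral_sub h1 h2, integral_slab h2]
  have h0 : ∀ t, ∫ x, ((P ^ 3)⁻¹ * ∫ y, p t y ∂cellMeasure P) * dx i ψ t x ∂cellMeasure P = 0 :=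
    fun t => by
      rw [integral_const_mul]
      have hs : ContDiff ℝ ∞ (ψ t) := hψ.smooth.comp (contDiff_const.prodMk contDiff_id)
      have := integral_fderiv_eq_zero hP (hs.of_le (by simp)) (hψ.periodic t) i
      simp only [dx]
      rw [this, mul_zero]
  simp only [h0, integral_zero, sub_zero]

end TestFunctions

section Limit

variable {P T : ℝ}

lemma tendsto_integral_mul {G : ℕ → ℝ × E3 → ℝ} {G' w : ℝ × E3 → ℝ}
    (hG : ∀ k, Integrable (G k) (slabMeasure P T)) (hG' : Integrable G' (slabMeasure P T))
    (hw : Continuous w)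
    (h : Tendsto (fun k => ∫⁻ z, ‖G k z - G' z‖ₑ ∂slabMeasure P T) atTop (𝓝 0)) :
    Tendsto (fun k => ∫ z, G k z * w z ∂slabMeasure P T) atTop
      (𝓝 (∫ z, G' z * w z ∂slabMeasure P T)) := by
  obtain ⟨K, hK0, hK⟩ := exists_bound_slab P T hw
  refine tendsto_integral_of_L1 _ (integrable_mul_continuous hG' hw).1
    (Eventually.of_forall fun k => integrable_mul_continuous (hG k) hw) ?_
  have h2 := ENNReal.Tendsto.mul_const (b := ENNReal.ofReal K) h (Or.inr ENNReal.ofReal_ne_top)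
  rw [zero_mul] at h2
  refine tendsto_of_tendsto_of_tendsto_of_le_of_le tendsto_const_nhds h2 (fun _ => zero_le)
    fun k => ?_
  simp only
  rw [← lintegral_mul_const' _ _ ENNReal.ofReal_ne_top]
  refine lintegral_mono_ae ?_
  filter_upwards [hK] with z hz
  rw [← sub_mul, enorm_mul]
  gcongr
  rw [← ofReal_norm]
  exact ENNReal.ofReal_le_ofReal hz

variable {U : ℕ → ℝ → E3 → E3} {V : ℝ → E3 → E3}

lemma tendsto_lintegral_component
    (hU : ∀ k, MemLp (Function.uncurry (U k)) 2 (slabMeasure P T))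
    (hV : MemLp (Function.uncurry V) 2 (slabMeasure P T))
    (h : Tendsto (fun k => eLpNorm (Function.uncurry (U k) - Function.uncurry V) 2
      (slabMeasure P T)) atTop (𝓝 0)) (i : Fin 3) :
    Tendsto (fun k => ∫⁻ z, ‖U k z.1 z.2 i - V z.1 z.2 i‖ₑ ∂slabMeasure P T) atTop (𝓝 0) := by
  have hc : eLpNorm (fun _ : ℝ × E3 => (1 : ℝ)) 2 (slabMeasure P T) ≠ ⊤ :=
    (memLp_const (1 : ℝ)).2.ne
  have h2 := ENNReal.Tendsto.mul_const h (Or.inr hc)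
  rw [zero_mul] at h2
  refine tendsto_of_tendsto_of_tendsto_of_le_of_le tendsto_const_nhds h2 (fun _ => zero_le)
    fun k => ?_
  refine le_trans (lintegral_mono fun z => ?_)
    (lintegral_enorm_mul_enorm_le ((hU k).sub hV).1 aestronglyMeasurable_const)
  rw [enorm_one, mul_one]
  exact enorm_apply_le ((Function.uncurry (U k) - Function.uncurry V) z) i

lemma tendsto_lintegral_quadratic
    (hU : ∀ k, MemLp (Function.uncurry (U k)) 2 (slabMeasure P T))
    (hV : MemLp (Function.uncurry V) 2 (slabMeasure P T))
    (h : Tendsto (fun k => eLpNorm (Function.uncurry (U k) - Function.uncurry V) 2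
      (slabMeasure P T)) atTop (𝓝 0)) (i j : Fin 3) :
    Tendsto (fun k => ∫⁻ z, ‖U k z.1 z.2 i * U k z.1 z.2 j - V z.1 z.2 i * V z.1 z.2 j‖ₑ
      ∂slabMeasure P T) atTop (𝓝 0) := by
  set N := eLpNorm (Function.uncurry V) 2 (slabMeasure P T) with hN
  have hNt : N ≠ ⊤ := hV.2.ne
  have h1 : Tendsto (fun k => eLpNorm (Function.uncurry (U k) - Function.uncurry V) 2
      (slabMeasure P T) + N + N) atTop (𝓝 (0 + N + N)) :=
    (h.add tendsto_const_nhds).add tendsto_const_nhds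
  have h2 := ENNReal.Tendsto.mul h1 (Or.inr ENNReal.zero_ne_top) h
    (Or.inr (ENNReal.add_ne_top.2 ⟨ENNReal.add_ne_top.2 ⟨ENNReal.zero_ne_top, hNt⟩, hNt⟩))
  rw [mul_zero] at h2
  refine tendsto_of_tendsto_of_tendsto_of_le_of_le tendsto_const_nhds h2 (fun _ => zero_le)
    fun k => ?_
  refine (lintegral_quadratic_diff_le (hU k).1 hV.1 i j).trans ?_
  gcongr
  have := eLpNorm_add_le ((hU k).sub hV).1 hV.1 (one_le_two : (1 : ℝ≥0∞) ≤ 2)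
  rwa [sub_add_cancel] at this

lemma divFree_of_tendsto (hU : ∀ k, MemLp (Function.uncurry (U k)) 2 (slabMeasure P T))
    (hV : MemLp (Function.uncurry V) 2 (slabMeasure P T))
    (h : Tendsto (fun k => eLpNorm (Function.uncurry (U k) - Function.uncurry V) 2
      (slabMeasure P T)) atTop (𝓝 0)) (hd : ∀ k, DivFree P T (U k)) : DivFree P T V := by
  intro ψ hψ
  have hc := fun j => continuous_dx hψ.smooth j
  have hlim : Tendsto (fun k => ∑ j, ∫ z, U k z.1 z.2 j * dx j ψ z.1 z.2 ∂slabMeasure P T) atTop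
      (𝓝 (∑ j, ∫ z, V z.1 z.2 j * dx j ψ z.1 z.2 ∂slabMeasure P T)) :=
    tendsto_finsetSum _ fun j _ => tendsto_integral_mul (fun k => integrable_component (hU k) j)
      (integrable_component hV j) (hc j) (tendsto_lintegral_component hU hV h j)
  rw [integral_finsetSum _ fun j _ =>
    integrable_mul_continuous (integrable_component hV j) (hc j)]
  refine tendsto_nhds_unique hlim ?_
  refine tendsto_const_nhds.congr fun k => ?_
  have := hd k ψ hψ
  rw [integral_finsetSum _ fun j _ =>
    integrable_mul_continuous (integrable_component (hU k) j) (hc j)] at this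
  exact this.symm

/-- Each term is continuous under `L²` convergence of the velocity and `L¹` convergence of the
normalised pressure; the viscous integral converges and is multiplied by `μ → 0`. -/
lemma momentum_of_tendsto (hP : 0 < P) {u₀ : E3 → E3} {f : ℝ → E3 → E3} {μ : ℕ → ℝ}
    {p : ℕ → ℝ → E3 → ℝ} {π : ℝ → E3 → ℝ}
    (hf : MemLp (Function.uncurry f) 2 (slabMeasure P T))
    (hU : ∀ k, MemLp (Function.uncurry (U k)) 2 (slabMeasure P T))
    (hV : MemLp (Function.uncurry V) 2 (slabMeasure P T))
    (hp : ∀ k, Integrable (Function.uncurry (p k)) (slabMeasure P T))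
    (hπ : Integrable (Function.uncurry π) (slabMeasure P T)) (hμ : Tendsto μ atTop (𝓝 0))
    (h : Tendsto (fun k => eLpNorm (Function.uncurry (U k) - Function.uncurry V) 2
      (slabMeasure P T)) atTop (𝓝 0))
    (hπl : Tendsto (fun k => ∫⁻ z, ‖meanFree P (p k) z.1 z.2 - π z.1 z.2‖ₑ ∂slabMeasure P T)
      atTop (𝓝 0))
    (hm : ∀ k, Momentum P T (μ k) u₀ f (U k) (p k)) : Momentum P T 0 u₀ f V π := by
  intro i ψ hψ
  have cdx := fun j => continuous_dx hψ.smooth j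
  have cdt := continuous_dt hψ.smooth
  have clap := continuous_lap hψ.smooth
  have cψ : Continuous fun z : ℝ × E3 => ψ z.1 z.2 := hψ.smooth.continuous
  have split : ∀ (ν : ℝ) (u : ℝ → E3 → E3) (r : ℝ → E3 → ℝ),
      MemLp (Function.uncurry u) 2 (slabMeasure P T) →
      Integrable (Function.uncurry r) (slabMeasure P T) →
      ∫ z, (u z.1 z.2 i * dt ψ z.1 z.2 + (∑ j, u z.1 z.2 i * u z.1 z.2 j * dx j ψ z.1 z.2)
        + r z.1 z.2 * dx i ψ z.1 z.2 + ν * (u z.1 z.2 i * lap ψ z.1 z.2)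
        + f z.1 z.2 i * ψ z.1 z.2) ∂(slabMeasure P T)
      = ∫ z, u z.1 z.2 i * dt ψ z.1 z.2 ∂slabMeasure P T
        + ∑ j, ∫ z, u z.1 z.2 i * u z.1 z.2 j * dx j ψ z.1 z.2 ∂slabMeasure P T
        + ∫ z, r z.1 z.2 * dx i ψ z.1 z.2 ∂slabMeasure P T
        + ν * ∫ z, u z.1 z.2 i * lap ψ z.1 z.2 ∂slabMeasure P T
        + ∫ z, f z.1 z.2 i * ψ z.1 z.2 ∂slabMeasure P T := fun ν u r hu hr =>
    integral_momentum_split ν (integrable_mul_continuous (integrable_component hu i) cdt)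
      (fun j => integrable_mul_continuous (integrable_component_mul hu hu i j) (cdx j))
      (integrable_mul_continuous (G := Function.uncurry r) hr (cdx i))
      (integrable_mul_continuous (integrable_component hu i) clap)
      (integrable_mul_continuous (integrable_component hf i) cψ)
  rw [split 0 V π hV hπ]
  have hcomp := tendsto_lintegral_component hU hV h i
  have t1 := tendsto_integral_mul (fun k => integrable_component (hU k) i)
    (integrable_component hV i) cdt hcomp
  have t2 := tendsto_finsetSum Finset.univ fun j _ => tendsto_integral_mul
    (fun k => integrable_component_mul (hU k) (hU k) i j) (integrable_component_mul hV hV i j)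
    (cdx j) (tendsto_lintegral_quadratic hU hV h i j)
  have t3 : Tendsto (fun k => ∫ z, p k z.1 z.2 * dx i ψ z.1 z.2 ∂slabMeasure P T) atTop
      (𝓝 (∫ z, π z.1 z.2 * dx i ψ z.1 z.2 ∂slabMeasure P T)) := by
    have := tendsto_integral_mul (G := fun k => Function.uncurry (meanFree P (p k)))
      (G' := Function.uncurry π) (fun k => integrable_meanFree (hp k)) hπ (cdx i) hπl
    refine this.congr fun k => ?_
    exact integral_mean_mul_dx hP (hp k) hψ i
  have t4 := hμ.mul (tendsto_integral_mul (fun k => integrable_component (hU k) i)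
    (integrable_component hV i) clap hcomp)
  have t := ((((t1.add t2).add t3).add t4).add
    (tendsto_const_nhds (x := ∫ z, f z.1 z.2 i * ψ z.1 z.2 ∂slabMeasure P T))).add
    (tendsto_const_nhds (x := ∫ x, u₀ x i * ψ 0 x ∂cellMeasure P))
  refine tendsto_nhds_unique t ?_
  refine tendsto_const_nhds.congr fun k => ?_
  have := hm k i ψ hψ
  rw [split (μ k) (U k) (p k) (hU k) (hp k)] at this
  exact this.symm

end Limit

end

/-! ### Pointwise limits and the energy inequality in the limit -/

section

section PointwiseLimit

variable {E : Type*} [NormedAddCommGroup E]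

/-- The limit of a sequence, and zero if the sequence diverges. -/
def seqLim (s : ℕ → E) : E :=
  open Classical in if h : ∃ l, Tendsto s atTop (𝓝 l) then h.choose else 0

lemma seqLim_eq {s : ℕ → E} {l : E} (h : Tendsto s atTop (𝓝 l)) : seqLim s = l := by
  have h' : ∃ l, Tendsto s atTop (𝓝 l) := ⟨l, h⟩
  rw [seqLim, dif_pos h']
  exact tendsto_nhds_unique h'.choose_spec h

end PointwiseLimit

section EnergyLimit

variable {P T : ℝ} {f : ℝ → E3 → E3} {U : ℕ → ℝ → E3 → E3} {V : ℝ → E3 → E3}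

lemma lintegral_slab {F : ℝ × E3 → ℝ≥0∞} (hF : AEMeasurable F (slabMeasure P T)) :
    ∫⁻ z, F z ∂slabMeasure P T = ∫⁻ t, ∫⁻ x, F (t, x) ∂cellMeasure P ∂timeMeasure T :=
  lintegral_prod _ hF

lemma lintegral_power_sub_le (hf : MemLp (Function.uncurry f) 2 (slabMeasure P T))
    {u : ℝ → E3 → E3} (hu : MemLp (Function.uncurry u) 2 (slabMeasure P T))
    (hV : MemLp (Function.uncurry V) 2 (slabMeasure P T)) :
    ∫⁻ t, ‖power P f u t - power P f V t‖ₑ ∂timeMeasure T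
      ≤ eLpNorm (Function.uncurry f) 2 (slabMeasure P T)
        * eLpNorm (Function.uncurry u - Function.uncurry V) 2 (slabMeasure P T) := by
  refine le_trans ?_ (lintegral_enorm_mul_enorm_le hf.1 (hu.sub hV).1)
  have hm : AEMeasurable (fun z => ‖Function.uncurry f z‖ₑ
      * ‖(Function.uncurry u - Function.uncurry V) z‖ₑ) (slabMeasure P T) :=
    hf.1.enorm.mul (hu.sub hV).1.enorm
  rw [lintegral_slab hm]
  have j1 : ∀ᵐ t ∂timeMeasure T, Integrable (fun x => inner ℝ (f t x) (u t x)) (cellMeasure P) :=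
    (integrable_inner_slab hf hu).prod_right_ae
  have j2 : ∀ᵐ t ∂timeMeasure T, Integrable (fun x => inner ℝ (f t x) (V t x)) (cellMeasure P) :=
    (integrable_inner_slab hf hV).prod_right_ae
  refine lintegral_mono_ae ?_
  filter_upwards [j1, j2] with t h1 h2
  rw [power, power, ← integral_sub h1 h2]
  refine (enorm_integral_le_lintegral_enorm _).trans (lintegral_mono fun x => ?_)
  rw [← inner_sub_right, ← ofReal_norm, ← ofReal_norm, ← ofReal_norm,
    ← ENNReal.ofReal_mul (norm_nonneg _)]
  exact ENNReal.ofReal_le_ofReal (norm_inner_le_norm _ _)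

lemma tendsto_integral_power (hf : MemLp (Function.uncurry f) 2 (slabMeasure P T))
    (hU : ∀ k, MemLp (Function.uncurry (U k)) 2 (slabMeasure P T))
    (hV : MemLp (Function.uncurry V) 2 (slabMeasure P T))
    (h : Tendsto (fun k => eLpNorm (Function.uncurry (U k) - Function.uncurry V) 2
      (slabMeasure P T)) atTop (𝓝 0)) {t : ℝ} (ht : t ≤ T) :
    Tendsto (fun k => ∫ s in Ico 0 t, power P f (U k) s) atTop
      (𝓝 (∫ s in Ico 0 t, power P f V s)) := by
  have hle := Measure.restrict_mono (Ico_subset_Ico_right ht : Ico 0 t ⊆ Ico 0 T)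
    (le_refl (volume : Measure ℝ))
  have hi : ∀ {u : ℝ → E3 → E3}, MemLp (Function.uncurry u) 2 (slabMeasure P T) →
      Integrable (power P f u) (volume.restrict (Ico 0 t)) := fun hu =>
    (integrable_power hf hu).mono_measure hle
  refine tendsto_integral_of_L1 _ (hi hV).1 (Eventually.of_forall fun k => hi (hU k)) ?_
  have h2 := ENNReal.Tendsto.const_mul (a := eLpNorm (Function.uncurry f) 2 (slabMeasure P T)) h
    (Or.inr hf.2.ne)
  rw [mul_zero] at h2
  refine tendsto_of_tendsto_of_tendsto_of_le_of_le tendsto_const_nhds h2 (fun _ => zero_le)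
    fun k => (lintegral_mono' hle le_rfl).trans (lintegral_power_sub_le hf (hU k) hV)

lemma memLp_slice {v : ℝ → E3 → E3} (hv : MemLp (Function.uncurry v) 2 (slabMeasure P T)) :
    ∀ᵐ t ∂timeMeasure T, MemLp (v t) 2 (cellMeasure P) := by
  have h1 : ∀ᵐ t ∂timeMeasure T, Integrable (fun x => ‖v t x‖ ^ 2) (cellMeasure P) :=
    (integrable_norm_sq_slab hv).prod_right_ae
  have h2 : ∀ᵐ t ∂timeMeasure T, AEStronglyMeasurable (fun x => v t x) (cellMeasure P) :=
    AEStronglyMeasurable.prodMk_left (f := Function.uncurry v) hv.1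
  filter_upwards [h1, h2] with t ht1 ht2
  exact (memLp_two_iff_integrable_sq_norm ht2).2 ht1

lemma lintegral_enorm_sq_eq_kinetic {v : ℝ → E3 → E3} {t : ℝ}
    (hv : MemLp (v t) 2 (cellMeasure P)) :
    ∫⁻ x, ‖v t x‖ₑ ^ 2 ∂cellMeasure P = ENNReal.ofReal (kinetic P v t) := by
  rw [kinetic, ofReal_integral_eq_lintegral_ofReal
    ((memLp_two_iff_integrable_sq_norm hv.1).1 hv) (Eventually.of_forall fun _ => sq_nonneg _)]
  refine lintegral_congr fun x => ?_
  rw [ENNReal.ofReal_pow (norm_nonneg _), ofReal_norm]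

/-- The energy inequality passes to limits, by Fatou's lemma. -/
lemma energy_of_tendsto {E₀ : ℝ} (hf : MemLp (Function.uncurry f) 2 (slabMeasure P T))
    (hU : ∀ k, MemLp (Function.uncurry (U k)) 2 (slabMeasure P T))
    (hV : MemLp (Function.uncurry V) 2 (slabMeasure P T))
    (h : Tendsto (fun k => eLpNorm (Function.uncurry (U k) - Function.uncurry V) 2
      (slabMeasure P T)) atTop (𝓝 0))
    (hae : ∀ᵐ z ∂slabMeasure P T, Tendsto (fun k => U k z.1 z.2) atTop (𝓝 (V z.1 z.2)))
    (hE : ∀ k, ∀ᵐ t ∂timeMeasure T, kinetic P (U k) t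
      ≤ E₀ + 2 * ∫ s in Ico 0 t, power P f (U k) s) :
    ∀ᵐ t ∂timeMeasure T, kinetic P V t ≤ E₀ + 2 * ∫ s in Ico 0 t, power P f V s := by
  have hae' : ∀ᵐ t ∂timeMeasure T, ∀ᵐ x ∂cellMeasure P,
      Tendsto (fun k => U k t x) atTop (𝓝 (V t x)) := Measure.ae_ae_of_ae_prod hae
  filter_upwards [hae', ae_all_iff.2 hE, ae_all_iff.2 fun k => memLp_slice (hU k),
    memLp_slice hV, ae_restrict_mem measurableSet_Ico] with t h1 h2 h3 h4 h5
  have hlim : Tendsto (fun k => E₀ + 2 * ∫ s in Ico 0 t, power P f (U k) s) atTop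
      (𝓝 (E₀ + 2 * ∫ s in Ico 0 t, power P f V s)) :=
    ((tendsto_integral_power hf hU hV h h5.2.le).const_mul 2).const_add E₀
  -- Nonnegativity of the limiting right-hand side allows the comparison to be carried out through
  -- `ENNReal.ofReal`, where Fatou's lemma applies.
  have hpos : 0 ≤ E₀ + 2 * ∫ s in Ico 0 t, power P f V s := by
    refine ge_of_tendsto hlim (Eventually.of_forall fun k => le_trans ?_ (h2 k))
    exact integral_nonneg fun _ => by positivity
  rw [← ENNReal.ofReal_le_ofReal_iff hpos, ← lintegral_enorm_sq_eq_kinetic h4]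
  have hpt : ∀ᵐ x ∂cellMeasure P, ‖V t x‖ₑ ^ 2 ≤ liminf (fun k => ‖U k t x‖ₑ ^ 2) atTop := by
    filter_upwards [h1] with x hx
    have := ENNReal.tendsto_ofReal ((hx.norm).pow 2)
    simp only [ENNReal.ofReal_pow (norm_nonneg _), ofReal_norm] at this
    exact this.liminf_eq.ge
  refine (lintegral_mono_ae hpt).trans ((lintegral_liminf_le' fun k =>
    (h3 k).1.enorm.pow_const 2).trans ?_)
  have hlim' := ENNReal.tendsto_ofReal hlim
  rw [← hlim'.liminf_eq]
  refine liminf_le_liminf (Eventually.of_forall fun k => ?_)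
  simp only [lintegral_enorm_sq_eq_kinetic (h3 k)]
  exact ENNReal.ofReal_le_ofReal (h2 k)

/-- A negative value would persist on a nonempty open subset of `(t, T)`, which has positive
measure; approaching from the right also covers `t = 0`. -/
lemma nonneg_of_ae_nonneg {N : ℝ → ℝ} (hN : Continuous N)
    (h : ∀ᵐ t ∂timeMeasure T, 0 ≤ N t) {t : ℝ} (ht : t ∈ Ico 0 T) : 0 ≤ N t := by
  by_contra hcon
  have ho : IsOpen (N ⁻¹' Iio 0 ∩ Ioo t T) := (isOpen_Iio.preimage hN).inter isOpen_Ioo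
  have hne : (N ⁻¹' Iio 0 ∩ Ioo t T).Nonempty := by
    have hcl : t ∈ closure (Ioo t T) := by
      rw [closure_Ioo ht.2.ne]; exact ⟨le_rfl, ht.2.le⟩
    exact mem_closure_iff.1 hcl _ (isOpen_Iio.preimage hN) (not_le.1 hcon)
  have hpos := ho.measure_pos (volume : Measure ℝ) hne
  have h0 : volume (N ⁻¹' Iio 0 ∩ Ioo t T) = 0 := by
    rw [ae_restrict_iff' measurableSet_Ico] at h
    refine measure_mono_null (fun s hs => ?_) h
    simp only [mem_compl_iff, mem_ofPred_eq, Classical.not_imp, not_le]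
    exact ⟨⟨ht.1.trans hs.2.1.le, hs.2.2⟩, hs.1⟩
  exact hpos.ne' h0

/-- A function that satisfies the energy inequality at almost every time satisfies it at every time
after modification at a null set of times. -/
lemma exists_energyIneq_representative {u₀ : E3 → E3}
    (hf : MemLp (Function.uncurry f) 2 (slabMeasure P T))
    (hV : MemLp (Function.uncurry V) 2 (slabMeasure P T))
    (hE : ∀ᵐ t ∂timeMeasure T, kinetic P V t
      ≤ ∫ x, ‖u₀ x‖ ^ 2 ∂cellMeasure P + 2 * ∫ s in Ico 0 t, power P f V s) :
    ∃ v : ℝ → E3 → E3, (∀ t, v t = V t ∨ v t = 0) ∧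
      Function.uncurry v =ᵐ[slabMeasure P T] Function.uncurry V ∧ EnergyIneq P T u₀ f v := by
  classical
  set E₀ := ∫ x, ‖u₀ x‖ ^ 2 ∂cellMeasure P with hE₀
  set R : ℝ → ℝ := fun t => E₀ + 2 * ∫ s in Ico 0 t, power P f V s with hR
  set good : ℝ → Prop := fun t => MemLp (V t) 2 (cellMeasure P) ∧ kinetic P V t ≤ R t with hgood
  have hga : ∀ᵐ t ∂timeMeasure T, good t := by
    filter_upwards [memLp_slice hV, hE] with t h1 h2 using ⟨h1, h2⟩
  set v : ℝ → E3 → E3 := fun t => if good t then V t else 0 with hv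
  have hvV : ∀ t, good t → v t = V t := fun t ht => if_pos ht
  -- At exceptional times the field is replaced by zero, so the right-hand side must be nonnegative
  -- at every time. It is so at good times, and it agrees on `[0,T)` with a continuous function.
  have hR0 : ∀ t ∈ Ico 0 T, 0 ≤ R t := by
    set N : ℝ → ℝ := fun t => E₀ + 2 * ∫ s in (0 : ℝ)..t, (Ico 0 T).indicator (power P f V) s
      with hN
    have hi : Integrable ((Ico 0 T).indicator (power P f V)) :=
      IntegrableOn.integrable_indicator (integrable_power hf hV) measurableSet_Ico
    have hNc : Continuous N := continuous_const.add (continuous_const.mul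
      (intervalIntegral.continuous_primitive (fun _ _ => hi.intervalIntegrable) 0))
    have hNR : ∀ t ∈ Ico 0 T, N t = R t := fun t ht => by
      simp only [hN, hR]
      rw [intervalIntegral.integral_of_le ht.1, ← integral_Ico_eq_integral_Ioc]
      congr 2
      refine setIntegral_congr_fun measurableSet_Ico fun s hs => ?_
      exact indicator_of_mem (show s ∈ Ico 0 T from ⟨hs.1, hs.2.trans ht.2⟩) _
    intro t ht
    rw [← hNR t ht]
    refine nonneg_of_ae_nonneg hNc ?_ ht
    filter_upwards [hga, ae_restrict_mem measurableSet_Ico] with s hs hsm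
    rw [hNR s hsm]
    exact le_trans (integral_nonneg fun _ => by positivity) hs.2
  refine ⟨v, fun t => ?_, ?_, fun t ht => ?_⟩
  · by_cases h : good t
    · exact Or.inl (if_pos h)
    · exact Or.inr (if_neg h)
  · have : ∀ᵐ z ∂slabMeasure P T, good z.1 := Measure.quasiMeasurePreserving_fst.ae hga
    filter_upwards [this] with z hz
    simp only [Function.uncurry, hvV z.1 hz]
  · have hrhs : ∫ s in Ico 0 t, ∫ x, inner ℝ (v s x) (f s x) ∂cellMeasure P
        = ∫ s in Ico 0 t, power P f V s := by
      refine integral_congr_ae ?_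
      filter_upwards [ae_mono (Measure.restrict_mono
        (Ico_subset_Ico_right ht.2.le : Ico 0 t ⊆ Ico 0 T) le_rfl) hga] with s hs
      simp only [hvV s hs, power, real_inner_comm]
    rw [hrhs]
    by_cases h : good t
    · rw [hvV t h]
      exact h
    · have hv0 : v t = 0 := if_neg h
      rw [hv0]
      refine ⟨MemLp.zero, ?_⟩
      simpa using hR0 t ht

end EnergyLimit

end

/-! ### Assembly of the uniform bounds and of the limits -/

section

section UniformControl

variable {P T : ℝ} {u₀ : E3 → E3} {f : ℝ → E3 → E3}

/-- The bounds for a family of Navier–Stokes solutions that do not depend on the viscosity. -/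
structure IsControlled (P T β C M : ℝ) (u₀ : E3 → E3) (f u : ℝ → E3 → E3) : Prop where
  energy : ∀ᵐ t ∂timeMeasure T, kinetic P u t
    ≤ ∫ x, ‖u₀ x‖ ^ 2 ∂cellMeasure P + 2 * ∫ s in Ico 0 t, power P f u s
  coef_le : ∀ᵐ t ∂timeMeasure T, ∀ n i, ‖fc P n (fun z => u z.1 z.2 i) t‖ ≤ M
  coef_mul_le : ∀ᵐ t ∂timeMeasure T, ∀ n i j,
    ‖fc P n (fun z => u z.1 z.2 i * u z.1 z.2 j) t‖ ≤ M
  decay : ∀ i, HasSpectralDecay T β C (lift P fun z => u z.1 z.2 i)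

/-- The energy bound depends only on the data and fixes `M`; together with (K41w) it yields decay.
Lowering `β` to at most `1` keeps later exponents in the range where the moment and translation
estimates apply. -/
lemma exists_isControlled (hP : 0 < P) (hT : 0 < T)
    (hf : MemLp (Function.uncurry f) 2 (slabMeasure P T)) {S : Set ℝ} (hS : S ⊆ Ioi 0)
    {u : ℝ → ℝ → E3 → E3} {p : ℝ → ℝ → E3 → ℝ}
    (hsol : ∀ μ ∈ S, IsNavierStokesSolution P T μ u₀ f (u μ) (p μ)) (hK : K41w P T S u) :
    ∃ β C M : ℝ, 0 < β ∧ β ≤ 1 ∧ 0 ≤ C ∧ 1 ≤ M ∧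
      ∀ μ ∈ S, IsControlled P T β C M u₀ f (u μ) := by
  obtain ⟨β, hβ, C, hC, kStar, hK⟩ := hK
  set M := coefBound P (energyBound P T u₀ f) with hM
  have hM1 : 1 ≤ M := one_le_coefBound hP (energyBound_nonneg hT u₀ f)
  obtain ⟨C', hC', hdec⟩ := exists_hasSpectralDecay (M := M) hP hT kStar hβ hC.le
  refine ⟨min β 1, C', M, lt_min hβ one_pos, min_le_right _ _, hC', hM1, fun μ hμ => ?_⟩
  have hs := hsol μ hμ
  obtain ⟨G, -, hG⟩ := hs.energy
  have hE := energy_inequality (le_of_lt (hS hμ)) hf hs.memLp hG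
  have hb := ae_norm_fc_le hP hs.weaklyContinuous.1 (kinetic_le_energyBound hT hf hs.memLp hE)
  have hb1 : ∀ᵐ t ∂timeMeasure T, ∀ n i, ‖fc P n (fun z => u μ z.1 z.2 i) t‖ ≤ M := by
    filter_upwards [hb] with t ht n i using (ht n).1 i
  refine ⟨hE, hb1, ?_, hdec _ hs.memLp hs.weaklyContinuous.1 hb1 (hK μ hμ)⟩
  filter_upwards [hb] with t ht n i j using (ht n).2 i j

lemma exists_velocity_subseq (hP : 0 < P) (hT : 0 < T) (hu₀ : MemLp u₀ 2 (cellMeasure P))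
    (hf : MemLp (Function.uncurry f) 2 (slabMeasure P T)) {β C M : ℝ} (hβ : 0 < β) (hC : 0 ≤ C)
    (hM : 1 ≤ M) {μ : ℕ → ℝ} (hμ : Tendsto μ atTop (𝓝 0)) {U : ℕ → ℝ → E3 → E3}
    {p : ℕ → ℝ → E3 → ℝ} (hsol : ∀ k, IsNavierStokesSolution P T (μ k) u₀ f (U k) (p k))
    (hctl : ∀ k, IsControlled P T β C M u₀ f (U k)) :
    ∃ (σ : ℕ → ℕ) (V : ℝ × E3 → E3), StrictMono σ ∧ MemLp V 2 (slabMeasure P T) ∧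
      Tendsto (fun k => eLpNorm (Function.uncurry (U (σ k)) - V) 2 (slabMeasure P T)) atTop
        (𝓝 0) ∧
      ∀ᵐ z ∂slabMeasure P T, Tendsto (fun k => U (σ k) z.1 z.2) atTop (𝓝 (V z)) := by
  obtain ⟨L, hL⟩ := (Metric.isBounded_range_of_tendsto μ hμ).exists_norm_le
  have hL' : ∀ k, |μ k| ≤ L := fun k => hL _ (mem_range_self k)
  choose K hK0 hK using fun n i => exists_primitive_fc (T := T) (L := L) hP
    (zero_le_one.trans hM) n i
  have hD : ∀ a : (Fin 3 → ℤ) × Fin 3, Integrable (fun t => K a.1 a.2 *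
      (1 + ∑ l, ‖fc P a.1 (fun z => f z.1 z.2 l) t‖)) (timeMeasure T) := fun a =>
    ((integrable_const 1).add (integrable_finsetSum _ fun l _ =>
      (integrable_fc hP (integrable_component hf l) a.1).norm)).const_mul _
  obtain ⟨σ, hσ, hc⟩ := exists_subseq_cauchy (M := M) hT hβ hC
    (g := fun k i => lift P fun z => U k z.1 z.2 i) (fun k i => (hctl k).decay i) hD
    (fun k n i => hK n i (μ k) u₀ f (U k) (p k) (hL' k) hu₀ hf (hsol k).memLp
      (hsol k).integrable_pressure (hsol k).momentum (hsol k).divFree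
      ((hctl k).coef_le.mono fun t ht => ht n) ((hctl k).coef_mul_le.mono fun t ht => ht n))
    (fun k n i => (hctl k).coef_le.mono fun t ht => ht n i)
  obtain ⟨τ, V, hτ, hV, hlim, hae⟩ := exists_limit_of_cauchy (fun k => (hsol (σ k)).memLp)
    (tendsto_eLpNorm_slab_of_torus (U := fun k => U (σ k)) hP (fun k => (hsol (σ k)).memLp) hc)
  exact ⟨σ ∘ τ, V, hσ.comp hτ, hV, hlim.comp hτ.tendsto_atTop, hae⟩

lemma isPeriodic_meanFree {p : ℝ → E3 → ℝ} {t : ℝ} (h : IsPeriodic P (p t)) :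
    IsPeriodic P (meanFree P p t) := fun x j => by
  simp only [meanFree, h x j]

/-- The quadratic terms form a Cauchy sequence in `L¹`, and the pressure estimate for differences
transfers this to the mean-free pressures; no estimate on an individual pressure is involved. -/
lemma exists_pressure_limit (hP : 0 < P) (hu₀ : MemLp u₀ 2 (cellMeasure P))
    (hf : MemLp (Function.uncurry f) 2 (slabMeasure P T)) {β C M : ℝ} (hβ : 0 < β) (hβ1 : β ≤ 1)
    (hC : 0 ≤ C) {μ : ℕ → ℝ} {U : ℕ → ℝ → E3 → E3} {p : ℕ → ℝ → E3 → ℝ}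
    (hsol : ∀ k, IsNavierStokesSolution P T (μ k) u₀ f (U k) (p k))
    (hctl : ∀ k, IsControlled P T β C M u₀ f (U k)) {V : ℝ → E3 → E3}
    (hV : MemLp (Function.uncurry V) 2 (slabMeasure P T))
    (h : Tendsto (fun k => eLpNorm (Function.uncurry (U k) - Function.uncurry V) 2
      (slabMeasure P T)) atTop (𝓝 0)) :
    ∃ π : ℝ → E3 → ℝ, (∀ t, IsPeriodic P (π t)) ∧
      Integrable (Function.uncurry π) (slabMeasure P T) ∧
      Tendsto (fun k => ∫⁻ z, ‖meanFree P (p k) z.1 z.2 - π z.1 z.2‖ₑ ∂slabMeasure P T) atTop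
        (𝓝 0) := by
  obtain ⟨B, hB, hbound⟩ := exists_pressure_diff_bound hP T hβ hβ1 hC
  have hU := fun k => (hsol k).memLp
  set d : ℕ → ℝ≥0∞ := fun k => ∑ i, ∑ j, ∫⁻ z, ‖U k z.1 z.2 i * U k z.1 z.2 j
    - V z.1 z.2 i * V z.1 z.2 j‖ₑ ∂slabMeasure P T with hd
  have hd0 : Tendsto d atTop (𝓝 0) := by
    have : Tendsto d atTop (𝓝 (∑ _i : Fin 3, ∑ _j : Fin 3, 0)) :=
      tendsto_finsetSum _ fun i _ => tendsto_finsetSum _ fun j _ =>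
        tendsto_lintegral_quadratic hU hV h i j
    simpa using this
  have hdd : ∀ k l, ∑ i, ∑ j, ∫⁻ z, ‖U k z.1 z.2 i * U k z.1 z.2 j
      - U l z.1 z.2 i * U l z.1 z.2 j‖ₑ ∂slabMeasure P T ≤ d k + d l := fun k l => by
    simp only [hd, ← Finset.sum_add_distrib]
    refine Finset.sum_le_sum fun i _ => Finset.sum_le_sum fun j _ => ?_
    rw [← lintegral_add_left' (f := fun z : ℝ × E3 =>
      ‖U k z.1 z.2 i * U k z.1 z.2 j - V z.1 z.2 i * V z.1 z.2 j‖ₑ)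
      (((integrable_component_mul (hU k) (hU k) i j).sub
        (integrable_component_mul hV hV i j)).1.enorm)]
    refine lintegral_mono fun z => ?_
    have e : U k z.1 z.2 i * U k z.1 z.2 j - U l z.1 z.2 i * U l z.1 z.2 j
        = (U k z.1 z.2 i * U k z.1 z.2 j - V z.1 z.2 i * V z.1 z.2 j)
          - (U l z.1 z.2 i * U l z.1 z.2 j - V z.1 z.2 i * V z.1 z.2 j) := by ring
    rw [e]
    exact enorm_sub_le
  have hcauchy : Tendsto (fun q : ℕ × ℕ => eLpNorm (Function.uncurry (meanFree P (p q.1))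
      - Function.uncurry (meanFree P (p q.2))) 1 (slabMeasure P T)) (atTop ×ˢ atTop) (𝓝 0) := by
    have hsum : Tendsto (fun q : ℕ × ℕ => volFactor P * (d q.1 + d q.2)) (atTop ×ˢ atTop)
        (𝓝 0) := by
      have h1 : Tendsto (fun q : ℕ × ℕ => d q.1 + d q.2) (atTop ×ˢ atTop) (𝓝 (0 + 0)) :=
        (hd0.comp tendsto_fst).add (hd0.comp tendsto_snd)
      have h2 := ENNReal.Tendsto.const_mul h1 (Or.inr (volFactor_ne_top P))
      simpa using h2
    have hrt : Tendsto (fun q : ℕ × ℕ => (volFactor P * (d q.1 + d q.2)) ^ (1 / 2 : ℝ))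
        (atTop ×ˢ atTop) (𝓝 0) := by
      have h2 := (ENNReal.continuous_rpow_const (y := (1 / 2 : ℝ))).continuousAt.tendsto.comp hsum
      rw [ENNReal.zero_rpow_of_pos (by positivity)] at h2
      exact h2
    have hall := ENNReal.Tendsto.const_mul (hsum.add hrt) (Or.inr hB)
    rw [add_zero, mul_zero] at hall
    refine tendsto_of_tendsto_of_tendsto_of_le_of_le tendsto_const_nhds hall (fun _ => zero_le)
      fun q => ?_
    rw [eLpNorm_one_eq_lintegral_enorm]
    refine (hbound _ _ u₀ f _ _ _ _ hu₀ hf (hU q.1) (hsol q.1).integrable_pressure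
      (hsol q.1).momentum (hsol q.1).divFree (hctl q.1).decay (hU q.2)
      (hsol q.2).integrable_pressure (hsol q.2).momentum (hsol q.2).divFree
      (hctl q.2).decay).trans ?_
    gcongr
    · exact hdd _ _
    · exact hdd _ _
  obtain ⟨τ, Q, -, hQ, hlim, hae⟩ := exists_limit_of_cauchy (fun k => memLp_one_iff_integrable.2
    (integrable_meanFree (hsol k).integrable_pressure)) hcauchy
  -- A pointwise limit, set to zero where it does not exist, is periodic at every point, which an
  -- arbitrary representative of the `L¹` limit need not be.
  set π : ℝ → E3 → ℝ := fun t x => seqLim fun k => meanFree P (p (τ k)) t x with hπ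
  have hπQ : Function.uncurry π =ᵐ[slabMeasure P T] Q := by
    filter_upwards [hae] with z hz
    exact seqLim_eq hz
  refine ⟨π, fun t x j => ?_, (memLp_one_iff_integrable.1 hQ).congr hπQ.symm, ?_⟩
  · simp only [hπ]
    congr 1
    funext k
    exact isPeriodic_meanFree ((hsol (τ k)).periodic_pressure t) x j
  · refine hlim.congr fun k => ?_
    rw [eLpNorm_one_eq_lintegral_enorm]
    refine lintegral_congr_ae ?_
    filter_upwards [hπQ] with z hz
    simp only [Pi.sub_apply, ← hz, Function.uncurry]

end UniformControl

end

end

end InviscidLimit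

theorem theorem5p1 (P T : ℝ) (hP : 0 < P) (hT : 0 < T)
    (u₀ : E3 → E3) (hu₀ : MemLp u₀ 2 (cellMeasure P)) (hu₀_per : IsPeriodic P u₀)
    (f : ℝ → E3 → E3) (hf : MemLp (Function.uncurry f) 2 (slabMeasure P T))
    (hf_per : ∀ t, IsPeriodic P (f t))
    (S : Set ℝ) (hS : S ⊆ Ioi 0)
    (u : ℝ → ℝ → E3 → E3) (p : ℝ → ℝ → E3 → ℝ)
    (hsol : ∀ μ ∈ S, IsNavierStokesSolution P T μ u₀ f (u μ) (p μ))
    (hK : K41w P T S u) :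
    ∃ q : ℝ, 2 < q ∧
      (∀ μ ∈ S, MemLp (Function.uncurry (u μ)) 2 (slabMeasure P T) ∧
        MemLp (Function.uncurry (u μ)) (ENNReal.ofReal q) (slabMeasure P T)) ∧
      ∀ m : ℕ → ℝ, (∀ n, m n ∈ S) → Tendsto m atTop (𝓝 0) →
        ∃ σ : ℕ → ℕ, StrictMono σ ∧ ∃ (v : ℝ → E3 → E3) (π : ℝ → E3 → ℝ),
          MemLp (Function.uncurry v) 2 (slabMeasure P T) ∧
          MemLp (Function.uncurry v) (ENNReal.ofReal q) (slabMeasure P T) ∧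
          Tendsto (fun n => eLpNorm (Function.uncurry (u (m (σ n))) - Function.uncurry v)
            2 (slabMeasure P T)) atTop (𝓝 0) ∧
          Tendsto (fun n => eLpNorm (Function.uncurry (u (m (σ n))) - Function.uncurry v)
            (ENNReal.ofReal q) (slabMeasure P T)) atTop (𝓝 0) ∧
          (∀ᵐ z ∂(slabMeasure P T),
            Tendsto (fun n => u (m (σ n)) z.1 z.2) atTop (𝓝 (v z.1 z.2))) ∧
          IsEulerSolution P T u₀ f v π ∧
          EnergyIneq P T u₀ f v := by
  obtain ⟨β, C, M, hβ, hβ1, hC, hM, hctl⟩ := exists_isControlled hP hT hf hS hsol hK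
  obtain ⟨B, hB, hbound⟩ := exists_eLpNorm_bound hP T hβ hC hM
  -- Uniform bounds hold with gain `β/12`; the final exponent takes half of it, leaving room to
  -- interpolate with `L²` convergence.
  have hδ : 0 < β / 24 := by positivity
  have hexp : 2 + β / 12 = 2 + 2 * (β / 24) := by ring
  have hexp_le : ENNReal.ofReal (2 + β / 24) ≤ ENNReal.ofReal (2 + β / 12) :=
    ENNReal.ofReal_le_ofReal (by linarith)
  have hB' : ∀ μ ∈ S, eLpNorm (Function.uncurry (u μ)) (ENNReal.ofReal (2 + β / 12))
      (slabMeasure P T) ≤ B := fun μ hμ =>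
    hbound (u μ) (hsol μ hμ).memLp (hctl μ hμ).decay (hctl μ hμ).coef_le
  refine ⟨2 + β / 24, by linarith, fun μ hμ => ⟨(hsol μ hμ).memLp, ?_⟩, fun m hmS hm => ?_⟩
  · have : MemLp (Function.uncurry (u μ)) (ENNReal.ofReal (2 + β / 12)) (slabMeasure P T) :=
      ⟨(hsol μ hμ).memLp.1, (hB' μ hμ).trans_lt hB.lt_top⟩
    exact this.mono_exponent hexp_le
  obtain ⟨σ, V, hσ, hV, hlim, hae⟩ := exists_velocity_subseq hP hT hu₀ hf hβ hC hM hm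
    (fun k => hsol (m k) (hmS k)) (fun k => hctl (m k) (hmS k))
  set U : ℕ → ℝ → E3 → E3 := fun k => u (m (σ k)) with hU_def
  have hU : ∀ k, MemLp (Function.uncurry (U k)) 2 (slabMeasure P T) := fun k =>
    (hsol _ (hmS (σ k))).memLp
  set w : ℝ → E3 → E3 := fun t x => seqLim fun k => U k t x with hw_def
  have hwV : Function.uncurry w =ᵐ[slabMeasure P T] V := by
    filter_upwards [hae] with z hz
    exact seqLim_eq hz
  have hw : MemLp (Function.uncurry w) 2 (slabMeasure P T) := hV.ae_eq hwV.symm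
  have hwlim : Tendsto (fun k => eLpNorm (Function.uncurry (U k) - Function.uncurry w) 2
      (slabMeasure P T)) atTop (𝓝 0) := by
    refine hlim.congr fun k => eLpNorm_congr_ae ?_
    filter_upwards [hwV] with z hz
    simp only [Pi.sub_apply, hz, hU_def]
  have hwae : ∀ᵐ z ∂slabMeasure P T, Tendsto (fun k => U k z.1 z.2) atTop (𝓝 (w z.1 z.2)) := by
    filter_upwards [hae, hwV] with z hz hz'
    have : w z.1 z.2 = V z := hz'
    rw [this]
    exact hz
  obtain ⟨v, hvw, hve, hvE⟩ := exists_energyIneq_representative (u₀ := u₀) hf hw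
    (energy_of_tendsto hf hU hw hwlim hwae fun k => (hctl _ (hmS (σ k))).energy)
  have hv : MemLp (Function.uncurry v) 2 (slabMeasure P T) := hw.ae_eq hve.symm
  have hvlim : Tendsto (fun k => eLpNorm (Function.uncurry (U k) - Function.uncurry v) 2
      (slabMeasure P T)) atTop (𝓝 0) := by
    refine hwlim.congr fun k => eLpNorm_congr_ae ?_
    filter_upwards [hve] with z hz
    simp only [Pi.sub_apply, hz]
  have hvae : ∀ᵐ z ∂slabMeasure P T, Tendsto (fun k => U k z.1 z.2) atTop (𝓝 (v z.1 z.2)) := by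
    filter_upwards [hwae, hve] with z hz hz'
    have : v z.1 z.2 = w z.1 z.2 := hz'
    rw [this]
    exact hz
  -- Lower semicontinuity of the norm under almost everywhere convergence gives the limit the same
  -- higher integrability bound.
  have hvB : eLpNorm (Function.uncurry v) (ENNReal.ofReal (2 + β / 12)) (slabMeasure P T) ≤ B :=
    Lp.eLpNorm_le_of_ae_tendsto (Eventually.of_forall fun k => hB' _ (hmS (σ k)))
      (fun k => (hU k).1) hvae
  have hvq : MemLp (Function.uncurry v) (ENNReal.ofReal (2 + β / 12)) (slabMeasure P T) :=
    ⟨hv.1, hvB.trans_lt hB.lt_top⟩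
  have hvperiodic : ∀ t, IsPeriodic P (v t) := fun t x j => by
    rcases hvw t with h | h
    · rw [h]
      simp only [hw_def]
      congr 1
      funext k
      exact (hsol _ (hmS (σ k))).periodic t x j
    · simp [h]
  obtain ⟨π, hπper, hπi, hπlim⟩ := exists_pressure_limit hP hu₀ hf hβ hβ1 hC
    (fun k => hsol _ (hmS (σ k))) (fun k => hctl _ (hmS (σ k))) hv hvlim
  refine ⟨σ, hσ, v, π, hv, hvq.mono_exponent hexp_le, hvlim, ?_, hvae, ?_, hvE⟩
  · refine tendsto_eLpNorm_interpolate (B := B + B) (fun k => ((hU k).sub hv).1) hδ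
      (ENNReal.add_ne_top.2 ⟨hB, hB⟩) (fun k => ?_) hvlim
    rw [← hexp]
    refine (eLpNorm_sub_le (hU k).1 hv.1 ?_).trans (add_le_add (hB' _ (hmS (σ k))) hvB)
    rw [ENNReal.one_le_ofReal]
    linarith
  · exact ⟨hvperiodic, hπper, hv, hπi, divFree_of_tendsto hU hv hvlim
      fun k => (hsol _ (hmS (σ k))).divFree, momentum_of_tendsto hP hf hU hv
      (fun k => (hsol _ (hmS (σ k))).integrable_pressure) hπi (hm.comp hσ.tendsto_atTop) hvlim
      hπlim fun k => (hsol _ (hmS (σ k))).momentum⟩
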